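/- For a sequence $(f_n)_{n\ge 0}$ put $\Delta f_n=f_{n+1}-f_n$, and say that $(f_n)$ satisfies the condition $(\mathrm H)$ if there is a constant $M>0$ such that $$(n+1)\sum_{i=0}^n\binom ni^2\,\bigl|\Delta^i f_{n-i}\bigr|^2<M\qquad(n=0,1,2,\dots).$$ Let $(a_n)_{n\in\mathbb Z}$ be real or complex numbers with $a_n=a_{-n}$, let $p\ge 1$ be an integer, and suppose that $(a_n)_{n\ge0}$ and $(n^pa_n)_{n\ge 0}$ both satisfy $(\mathrm H)$. Suppose also that for some $\xi_0>0$, $m>0$ and $C$, $$|a_n|\le C\,e^{-(n-m)\xi_0}\qquad(n>m).$$ Then there is a unique $\tilde a$ in the Hardy space $H^2$ of the half-plane $\operatorname{Re}\lambda>-\tfrac12$ with $\tilde a(n)=a_n$ for all integers $n\ge0$ (the Carlsonian interpolation). Let $\tilde a(-\tfrac12+i\nu)$ denote its $L^2$ boundary values, and for $\sigma\ge-\tfrac12$ let $\|\tilde a_\sigma\|_1=\frac1{2\pi}\int_{-\infty}^{\infty}|\tilde a(\sigma+i\nu)|\,d\nu$. Moreover: 1. The series $\frac1{2\pi}\sum_{n=-\infty}^{+\infty}a_nz^n$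 converges uniformly to a function $f$ analytic in the annulus $\{e^{-\xi_0}<|z|<e^{\xi_0}\}$. 2. $f$ extends holomorphically to the cut domain $\mathbb C\setminus\bigl([0,e^{-\xi_0}]\cup[e^{\xi_0},\infty)\bigr)$. 3. The limits $f_\pm(x)=\lim_{\epsilon\to0^+}f(x\pm i\epsilon)$ exist for all real $x>0$ with $x\ne e^{\pm\xi_0}$. The jump function $F(x)=-i\,(f_+(x)-f_-(x))$ vanishes for $e^{-\xi_0}<x<e^{\xi_0}$ and satisfies $F(x)=-F(1/x)$ for $0<x<e^{-\xi_0}$. For every $\sigma\ge-\tfrac12$ the norm $\|\tilde a_\sigma\|_1$ is finite and $$|F(x)|\le\|\tilde a_\sigma\|_1\,x^{\sigma}\quad(x>e^{\xi_0}),\qquad \bigl|F(1/x)\bigr|\le\|\tilde a_\sigma\|_1\,x^{-\sigma}\quad(0<x<e^{-\xi_0}).$$ 4. For all $\sigma>-\tfrac12$ and $\nu\in\mathbb R$, with absolutely convergent integrals, $$\tilde a(\sigma+i\nu)=\int_1^\infty F(x)\,x^{-(\sigma+i\nu)-1}\,dx=\int_0^1F(1/x)\,x^{(\sigma+i\nu)-1}\,dx.$$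 5. For all $\sigma\ge-\tfrac12$, with all integrals finite, $$\int_{-\infty}^{\infty}|\tilde a(\sigma+i\nu)|^2\,d\nu=2\pi\int_1^\infty|F(x)|^2x^{-2\sigma-1}\,dx=2\pi\int_0^1|F(1/x)|^2x^{2\sigma-1}\,dx.$$ -/

import Mathlib

open Set Filter Topology MeasureTheory

/-- The Hausdorff-type condition: for some constant `M`,
`(n+1) * ∑_{i=0}^{n} binom(n,i)^2 |Δ^i f_{n-i}|^2 < M` for all `n`, where `Δ f_n = f_{n+1} - f_n`. -/
def HausdorffCondition (f : ℕ → ℂ) : Prop :=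
  ∃ M : ℝ, 0 < M ∧ ∀ n : ℕ,
    ((n : ℝ) + 1) * ∑ i ∈ Finset.range (n + 1),
      ((n.choose i : ℝ)) ^ 2 * ‖((fwdDiff (1 : ℕ))^[i] f) (n - i)‖ ^ 2 < M

/-- The restriction `ν ↦ g (σ + iν)` of `g` to the vertical line of abscissa `σ`. -/
noncomputable def vertical (g : ℂ → ℂ) (σ : ℝ) (ν : ℝ) : ℂ :=
  g ((σ : ℂ) + (ν : ℂ) * Complex.I)

/-- `g` restricted to `Re s > -1/2` belongs to the Hardy space `H²` of that half-plane, and the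
values of `g` on the line `Re s = -1/2` are its `L²` boundary values. (The values of `g` to the
left of that line are irrelevant.) -/
structure IsHardyTwo (g : ℂ → ℂ) : Prop where
  holomorphic : DifferentiableOn ℂ g {s : ℂ | -(1 / 2 : ℝ) < s.re}
  bounded : ∃ C : NNReal, ∀ σ : ℝ, -(1 / 2 : ℝ) < σ → ∫⁻ ν : ℝ, ‖vertical g σ ν‖ₑ ^ 2 ≤ C
  boundary_memLp : MemLp (vertical g (-(1 / 2 : ℝ))) 2 volume
  boundary_limit :
    Tendsto (fun σ : ℝ => eLpNorm (vertical g σ - vertical g (-(1 / 2 : ℝ))) 2 volume)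
      (𝓝[>] (-(1 / 2 : ℝ))) (𝓝 0)

/-- `g` is a Carlsonian interpolation of `a_0, a_1, a_2, …`: it is in the Hardy space `H²` of the
half-plane `Re s > -1/2` (with its boundary values on `Re s = -1/2`), and `g n = a_n`. -/
structure IsCarlsonianInterpolation (a : ℕ → ℂ) (g : ℂ → ℂ) : Prop where
  hardy : IsHardyTwo g
  interpolates : ∀ n : ℕ, g (n : ℂ) = a n

/-- The norm `(1/2π) ∫ |g (σ + iν)| dν`. -/
noncomputable def lineNormOne (g : ℂ → ℂ) (σ : ℝ) : ℝ :=
  (1 / (2 * Real.pi)) * ∫ ν : ℝ, ‖vertical g σ ν‖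

/-- The annulus `e^{-ξ} < |z| < e^{ξ}`. -/
def annulus (ξ : ℝ) : Set ℂ := {z : ℂ | Real.exp (-ξ) < ‖z‖ ∧ ‖z‖ < Real.exp ξ}

/-- The plane cut along the real intervals `[0, e^{-ξ}]` and `[e^{ξ}, ∞)`. -/
def cutPlane (ξ : ℝ) : Set ℂ :=
  ((fun x : ℝ => (x : ℂ)) '' (Icc 0 (Real.exp (-ξ)) ∪ Ici (Real.exp ξ)))ᶜ

/-- At the real point `x` the limits `f_±(x) = lim_{ε → 0+} f (x ± iε)` exist, and
`-i (f_+(x) - f_-(x)) = J`. -/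
def HasJumpAt (f : ℂ → ℂ) (x : ℝ) (J : ℂ) : Prop :=
  ∃ fp fm : ℂ,
    Tendsto (fun ε : ℝ => f ((x : ℂ) + (ε : ℂ) * Complex.I)) (𝓝[>] 0) (𝓝 fp) ∧
    Tendsto (fun ε : ℝ => f ((x : ℂ) - (ε : ℂ) * Complex.I)) (𝓝[>] 0) (𝓝 fm) ∧
    J = -Complex.I * (fp - fm)

/-- `F` is the jump function of `f` on the positive real axis, apart from the two end points
`e^{-ξ}`, `e^{ξ}` of the cuts; between the cuts, where `f` is continuous, the jump vanishes. -/
def IsJumpFunction (ξ : ℝ) (f : ℂ → ℂ) (F : ℝ → ℂ) : Prop :=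
  ∀ x : ℝ, 0 < x → x ≠ Real.exp (-ξ) → x ≠ Real.exp ξ → HasJumpAt f x (F x)

/-! The condition (H) says that certain step functions built from the differences of the sequence
are bounded in `L²(0,1)`; a weak cluster point `u` has moments `∫ x^j u = f_j`
(`HausdorffCondition.exists_memLp`). With `x = e^{-t}` and `ψ(t) = e^{-t/2} u(e^{-t})` the moments
become values at the integers of `ã(s) = ∫ e^{-(s+1/2)t} ψ(t) dt`, `ψ ∈ L²(0,∞)`. By Plancherel `ã`
is in `H²`. It is unique by Carlson's theorem: an `H²` function is bounded on smaller half-planes,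
and a bounded function with zeros at all positive integers violates the Blaschke condition
(`eq_zero_of_zeros_nat`).

The same construction for `n^p a_n` gives `V ∈ H²`, and Carlson's theorem forces `V(s) = s^p ã(s)`.
Hence `(1+|ν|) ã(σ+iν)` is square integrable, `ã` is integrable on every line, and `ψ` has a
continuous representative `Φ`, the inverse Fourier integral of `ã`.

The power series `∑ a_n z^n` is the Cauchy integral `G(z) = ∫ Φ(t) e^{t/2} / (e^t - z) dt`. Fubini
and a Beta integral rewrite it as a superposition of the powers `(-z)^{-1/2+iν} / cosh(πν)` (a
Watson resummation), so the limits on the two sides of the cut follow by dominated convergence, and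
the jump at `x` is `2πi x^{-1/2} Φ(log x)` (`exists_tendsto_cauchyExp_invFourier`). Exponential
decay of `a_n` continues `G` across `(1, e^{ξ₀})`, where the jump must then vanish; so `Φ = 0` on
`(-∞, ξ₀]`.

By symmetry of `a`, `f(z) = (G(z) + G(1/z) - a_0) / 2π`. The Mellin formulas are the Laplace
transform and Plancherel in the variable `x = e^t`, and the bounds on `F` compare an inverse Fourier
integral with an `L¹` norm. Uniform convergence up to the edge of the annulus needs more than the
assumed decay: `a_n = O(n^{-3/2} e^{-nξ₀})`, from `exists_norm_halfPlaneTransform_nat_le`. -/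

open scoped FourierTransform SchwartzMap ContDiff ENNReal

/-! ### The Hausdorff moment problem in `L²(0,1)` -/

/-- A bounded sequence in a Hilbert space has a weak cluster point: if its inner products with
given vectors converge, some vector realizes the limits. -/
theorem exists_inner_eq_of_tendsto {H ι : Type*} [NormedAddCommGroup H] [InnerProductSpace ℂ H]
    [CompleteSpace H] (w : ℕ → H) (R : ℝ) (hw : ∀ n, ‖w n‖ ≤ R) (e : ι → H) (c : ι → ℂ)
    (h : ∀ j, Tendsto (fun n => inner ℂ (w n) (e j)) atTop (𝓝 (c j))) :
    ∃ v : H, ∀ j, inner ℂ v (e j) = c j := by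
  let φ : ℕ → WeakDual ℂ H := fun n => StrongDual.toWeakDual (InnerProductSpace.toDual ℂ H (w n))
  have hK : IsCompact (WeakDual.toStrongDual ⁻¹' Metric.closedBall (0 : StrongDual ℂ H) R) :=
    WeakDual.isCompact_closedBall (0 : StrongDual ℂ H) R
  have hφ : ∀ n, φ n ∈ WeakDual.toStrongDual ⁻¹' Metric.closedBall (0 : StrongDual ℂ H) R := by
    intro n
    simp only [mem_preimage, mem_closedBall_zero_iff]
    change ‖InnerProductSpace.toDual ℂ H (w n)‖ ≤ R
    simpa using hw n
  -- Banach–Alaoglu along an ultrafilter: no subsequence, hence no separability, is needed, and the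
  -- inner products that converge keep their limits.
  obtain ⟨x, -, hx⟩ := hK.ultrafilter_le_nhds ((hyperfilter ℕ).map φ)
    (by rw [Ultrafilter.coe_map, le_principal_iff]; exact mem_map.2 (Eventually.of_forall hφ))
  refine ⟨(InnerProductSpace.toDual ℂ H).symm (WeakDual.toStrongDual x), fun j => ?_⟩
  rw [InnerProductSpace.toDual_symm_apply]
  have h1 : Tendsto (fun n => φ n (e j)) (hyperfilter ℕ) (𝓝 (x (e j))) :=
    ((WeakDual.eval_continuous (e j)).tendsto x).comp hx
  have h2 : Tendsto (fun n => φ n (e j)) (hyperfilter ℕ) (𝓝 (c j)) := by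
    refine ((h j).mono_left Nat.hyperfilter_le_atTop).congr fun n => ?_
    exact (InnerProductSpace.toDual_apply_apply (𝕜 := ℂ)).symm
  exact tendsto_nhds_unique h1 h2

/-- Expansion of `f j` in iterated differences on the antidiagonal `n`. -/
theorem eq_sum_fwdDiff (f : ℕ → ℂ) (j m : ℕ) :
    f j = ∑ k ∈ Finset.range (m + 1),
      (m.choose k : ℂ) * ((-1) ^ (m - k) * ((fwdDiff (1 : ℕ))^[m - k] f) (j + k)) := by
  induction m generalizing f j with
  | zero => simp
  | succ m ih =>
    have hs : ∀ (i y : ℕ), ((fwdDiff (1 : ℕ))^[i + 1] f) y =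
        ((fwdDiff (1 : ℕ))^[i] f) (y + 1) - ((fwdDiff (1 : ℕ))^[i] f) y := by
      intro i y
      rw [Function.iterate_succ_apply']; rfl
    rw [Finset.sum_range_succ']
    -- Induction through `f j = f (j+1) - Δf j`. Pascal's rule splits each term: one half rebuilds
    -- the expansion of `f (j+1)`, and `h2` recognizes the rest as that of `-Δf j`.
    have h1 : ∀ k ∈ Finset.range (m + 1),
        (((m + 1).choose (k + 1) : ℕ) : ℂ) * ((-1) ^ (m + 1 - (k + 1)) *
          ((fwdDiff (1 : ℕ))^[m + 1 - (k + 1)] f) (j + (k + 1))) =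
        (m.choose k : ℂ) * ((-1) ^ (m - k) * ((fwdDiff (1 : ℕ))^[m - k] f) ((j + 1) + k)) +
        (m.choose (k + 1) : ℂ) *
          ((-1) ^ (m - k) * ((fwdDiff (1 : ℕ))^[m - k] f) (j + (k + 1))) := by
      intro k _
      rw [Nat.choose_succ_succ, show m + 1 - (k + 1) = m - k by omega,
        show j + 1 + k = j + (k + 1) by omega]
      push_cast; ring
    rw [Finset.sum_congr rfl h1, Finset.sum_add_distrib, ← ih f (j + 1)]
    have h2 : ∑ k ∈ Finset.range (m + 1), (m.choose (k + 1) : ℂ) *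
          ((-1) ^ (m - k) * ((fwdDiff (1 : ℕ))^[m - k] f) (j + (k + 1))) +
        ((m + 1).choose 0 : ℂ) * ((-1) ^ (m + 1 - 0) *
          ((fwdDiff (1 : ℕ))^[m + 1 - 0] f) (j + 0)) =
        - ∑ k ∈ Finset.range (m + 1), (m.choose k : ℂ) *
          ((-1) ^ (m - k) * ((fwdDiff (1 : ℕ))^[m - k] (fwdDiff (1 : ℕ) f)) (j + k)) := by
      rw [Finset.sum_range_succ, Finset.sum_range_succ' (fun k => (m.choose k : ℂ) *
          ((-1) ^ (m - k) * ((fwdDiff (1 : ℕ))^[m - k] (fwdDiff (1 : ℕ) f)) (j + k)))]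
      simp only [Nat.choose_succ_self, Nat.cast_zero, zero_mul, add_zero, Nat.choose_zero_right,
        Nat.cast_one, one_mul, Nat.sub_zero, ← Function.iterate_succ_apply]
      rw [neg_add, ← Finset.sum_neg_distrib]
      congr 1
      · refine Finset.sum_congr rfl fun k hk => ?_
        have hk' := Finset.mem_range.1 hk
        rw [show m - k = (m - (k + 1)) + 1 by omega, pow_succ]
        simp only [Nat.succ_eq_add_one]
        ring
      · simp only [Nat.succ_eq_add_one, pow_succ]; ring
    rw [add_assoc, h2]
    rw [← ih (fwdDiff (1 : ℕ) f) j]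
    simp [fwdDiff]

/-- A moment sequence term as a mean of the weighted differences occurring in the Hausdorff
condition. -/
theorem eq_sum_choose_fwdDiff (f : ℕ → ℂ) {j n : ℕ} (hj : j ≤ n) :
    f j = ∑ k ∈ Finset.range (n + 1), ((k.choose j : ℂ) / (n.choose j : ℂ)) *
      ((n.choose k : ℂ) * ((-1) ^ (n - k) * ((fwdDiff (1 : ℕ))^[n - k] f) k)) := by
  obtain ⟨m, rfl⟩ := Nat.exists_eq_add_of_le hj
  -- The terms with `k < j` vanish. For the others, `C(n,k) C(k,j) = C(n,j) C(n-j,k-j)` reduces the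
  -- claim to `eq_sum_fwdDiff`.
  rw [show j + m + 1 = j + (m + 1) by ring, Finset.sum_range_add, Finset.sum_eq_zero, zero_add]
  · refine (eq_sum_fwdDiff f j m).trans (Finset.sum_congr rfl fun k hk => ?_)
    have hk' : k ≤ m := by have := Finset.mem_range.1 hk; omega
    have h0 : (((j + m).choose j : ℕ) : ℂ) ≠ 0 :=
      Nat.cast_ne_zero.2 (Nat.choose_pos (by omega)).ne'
    have h1 := Nat.choose_mul (n := j + m) (k := j + k) (s := j) (by omega)
    rw [show j + m - j = m by omega, show j + k - j = k by omega] at h1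
    have h2 : (((j + m).choose (j + k) : ℕ) : ℂ) * ((j + k).choose j : ℕ) =
      ((j + m).choose j : ℕ) * (m.choose k : ℕ) := by exact_mod_cast h1
    rw [show j + m - (j + k) = m - k by omega, div_mul_eq_mul_div, eq_div_iff h0]
    linear_combination (-((-1) ^ (m - k) * ((fwdDiff (1 : ℕ))^[m - k] f) (j + k))) * h2
  · intro k hk
    rw [Nat.choose_eq_zero_of_lt (Finset.mem_range.1 hk)]; simp

/-- The quotient is the product of `(k-i)/(n-i)` over `i < j`, and each factor is at most
`(k+1)/(n+1)` because `k ≤ n`. -/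
theorem choose_div_choose_le_pow {j k n : ℕ} (hkn : k ≤ n) (hj : j ≤ n) :
    (k.choose j : ℝ) / (n.choose j : ℝ) ≤ (((k : ℝ) + 1) / (n + 1)) ^ j := by
  induction j with
  | zero => simp
  | succ j ih =>
    have h1 : (0 : ℝ) < n.choose (j + 1) := Nat.cast_pos.2 (Nat.choose_pos hj)
    have h2 : (0 : ℝ) < n.choose j := Nat.cast_pos.2 (Nat.choose_pos (by omega))
    by_cases hjk : k ≤ j
    · rw [Nat.choose_eq_zero_of_lt (by omega)]
      simp only [Nat.cast_zero, zero_div]; positivity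
    push Not at hjk
    have e1 : (k.choose (j + 1) : ℝ) * (j + 1) = k.choose j * (k - j) := by
      have := Nat.choose_succ_right_eq k j
      have h : (k.choose (j + 1) : ℝ) * ((j + 1 : ℕ) : ℝ) = k.choose j * ((k - j : ℕ) : ℝ) := by
        exact_mod_cast this
      rw [Nat.cast_sub hjk.le] at h; push_cast at h; exact h
    have e2 : (n.choose (j + 1) : ℝ) * (j + 1) = n.choose j * (n - j) := by
      have := Nat.choose_succ_right_eq n j
      have h : (n.choose (j + 1) : ℝ) * ((j + 1 : ℕ) : ℝ) = n.choose j * ((n - j : ℕ) : ℝ) := by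
        exact_mod_cast this
      rw [Nat.cast_sub (by omega)] at h; push_cast at h; exact h
    have hj1 : (0 : ℝ) < j + 1 := by positivity
    have hnj : (0 : ℝ) < (n : ℝ) - j := by
      have : ((j : ℝ) + 1) ≤ n := by exact_mod_cast hj
      linarith
    have hkj : (0 : ℝ) < (k : ℝ) - j := sub_pos.2 (by exact_mod_cast hjk)
    have hkn' : (k : ℝ) ≤ n := by exact_mod_cast hkn
    have e3 : (k.choose (j + 1) : ℝ) / n.choose (j + 1) =
        (k.choose j : ℝ) / n.choose j * ((k - j) / (n - j)) := by
      rw [div_mul_div_comm, ← e1, ← e2, mul_div_mul_right _ _ hj1.ne']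
    rw [e3, pow_succ]
    refine mul_le_mul (ih (by omega)) ?_ (by positivity) (by positivity)
    rw [div_le_div_iff₀ hnj (by positivity)]
    nlinarith [(Nat.cast_nonneg j : (0 : ℝ) ≤ j)]

/-- Each factor `(k-l)/(n-l)` with `l < j` is at least `(k+1-j)/(n+1)`. The exponent `i` is separate
from `j` so that the base stays fixed in the induction. -/
theorem pow_le_choose_div_choose {i j k n : ℕ} (hkn : k ≤ n) (hj : j ≤ n) (hij : i ≤ j) :
    (max 0 ((k : ℝ) + 1 - j) / (n + 1)) ^ i ≤ (k.choose i : ℝ) / (n.choose i : ℝ) := by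
  rcases le_or_gt ((k : ℝ) + 1 - j) 0 with h0 | h0
  · rw [max_eq_left h0]
    rcases Nat.eq_zero_or_pos i with rfl | hi
    · simp
    · rw [zero_div, zero_pow hi.ne']; positivity
  rw [max_eq_right h0.le]
  have hjk : j ≤ k := by
    have : (j : ℝ) < k + 1 := by linarith
    have : j < k + 1 := by exact_mod_cast this
    omega
  induction i with
  | zero => simp
  | succ i ih =>
    have h1 : (0 : ℝ) < n.choose (i + 1) := Nat.cast_pos.2 (Nat.choose_pos (by omega))
    have h2 : (0 : ℝ) < n.choose i := Nat.cast_pos.2 (Nat.choose_pos (by omega))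
    have e1 : (k.choose (i + 1) : ℝ) * (i + 1) = k.choose i * (k - i) := by
      have := Nat.choose_succ_right_eq k i
      have h : (k.choose (i + 1) : ℝ) * ((i + 1 : ℕ) : ℝ) = k.choose i * ((k - i : ℕ) : ℝ) := by
        exact_mod_cast this
      rw [Nat.cast_sub (by omega)] at h; push_cast at h; exact h
    have e2 : (n.choose (i + 1) : ℝ) * (i + 1) = n.choose i * (n - i) := by
      have := Nat.choose_succ_right_eq n i
      have h : (n.choose (i + 1) : ℝ) * ((i + 1 : ℕ) : ℝ) = n.choose i * ((n - i : ℕ) : ℝ) := by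
        exact_mod_cast this
      rw [Nat.cast_sub (by omega)] at h; push_cast at h; exact h
    have hj1 : (0 : ℝ) < i + 1 := by positivity
    have hij' : (i : ℝ) + 1 ≤ j := by exact_mod_cast hij
    have hjk' : (j : ℝ) ≤ k := by exact_mod_cast hjk
    have hkn' : (k : ℝ) ≤ n := by exact_mod_cast hkn
    have hnj : (0 : ℝ) < (n : ℝ) - i := by linarith
    have e3 : (k.choose (i + 1) : ℝ) / n.choose (i + 1) =
        (k.choose i : ℝ) / n.choose i * ((k - i) / (n - i)) := by
      rw [div_mul_div_comm, ← e1, ← e2, mul_div_mul_right _ _ hj1.ne']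
    rw [e3, pow_succ]
    refine mul_le_mul (ih (by omega)) ?_ (by positivity) (by positivity)
    have hi0 : (0 : ℝ) ≤ i := Nat.cast_nonneg i
    calc ((k : ℝ) + 1 - j) / (n + 1) ≤ (k - i) / (n + 1) :=
        div_le_div_of_nonneg_right (by linarith) (by positivity)
      _ ≤ (k - i) / (n - i) := by
        apply div_le_div_of_nonneg_left _ hnj (by linarith)
        linarith

/-- Integrals against step functions of mesh `1 / N`. -/
theorem integral_mul_step (d : ℕ → ℂ) (g : ℝ → ℂ) (hg : Continuous g) {N : ℕ} (hN : 0 < N) :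
    IntegrableOn (fun x : ℝ => g x * d ⌊(N : ℝ) * x⌋₊) (Ioc 0 1) ∧
    ∫ x in Ioc (0 : ℝ) 1, g x * d ⌊(N : ℝ) * x⌋₊ =
      ∑ k ∈ Finset.range N, (∫ x in ((k : ℝ) / N)..(((k + 1 : ℕ) : ℝ) / N), g x) * d k := by
  have hN' : (0 : ℝ) < N := Nat.cast_pos.2 hN
  have hle : ∀ k : ℕ, (k : ℝ) / N ≤ ((k + 1 : ℕ) : ℝ) / N := fun k => by
    gcongr; exact Nat.le_succ k
  have hfl : ∀ k : ℕ, EqOn (fun x : ℝ => g x * d k) (fun x : ℝ => g x * d ⌊(N : ℝ) * x⌋₊)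
      (Ioo ((k : ℝ) / N) (((k + 1 : ℕ) : ℝ) / N)) := by
    intro k x hx
    have h1 : (k : ℝ) < N * x := by have := (div_lt_iff₀ hN').1 hx.1; linarith
    have h2 : N * x < (k : ℝ) + 1 := by
      have := (lt_div_iff₀ hN').1 hx.2; push_cast at this; linarith
    have : ⌊(N : ℝ) * x⌋₊ = k := (Nat.floor_eq_iff ((Nat.cast_nonneg k).trans h1.le)).2 ⟨h1.le, h2⟩
    simp only [this]
  have hint : ∀ k < N, IntervalIntegrable (fun x : ℝ => g x * d ⌊(N : ℝ) * x⌋₊) volume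
      ((k : ℝ) / N) (((k + 1 : ℕ) : ℝ) / N) := by
    intro k _
    rw [intervalIntegrable_iff_integrableOn_Ioo_of_le (hle k)]
    have : IntervalIntegrable (fun x : ℝ => g x * d k) volume ((k : ℝ) / N)
      (((k + 1 : ℕ) : ℝ) / N) := (hg.mul continuous_const).intervalIntegrable _ _
    rw [intervalIntegrable_iff_integrableOn_Ioo_of_le (hle k)] at this
    exact this.congr_fun (hfl k) measurableSet_Ioo
  have e0 : ((0 : ℕ) : ℝ) / N = 0 := by simp
  have e1 : ((N : ℕ) : ℝ) / N = 1 := div_self hN'.ne'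
  constructor
  · have := IntervalIntegrable.trans_iterate (a := fun k : ℕ => (k : ℝ) / N) hint
    simp only [e0, e1] at this
    exact (intervalIntegrable_iff_integrableOn_Ioc_of_le zero_le_one).1 this
  · rw [← intervalIntegral.integral_of_le zero_le_one]
    have := intervalIntegral.sum_integral_adjacent_intervals (a := fun k : ℕ => (k : ℝ) / N) hint
    simp only [e0, e1] at this
    rw [← this]
    refine Finset.sum_congr rfl fun k _ => ?_
    rw [intervalIntegral.integral_of_le (hle k), integral_Ioc_eq_integral_Ioo,
      ← setIntegral_congr_fun measurableSet_Ioo (hfl k), ← integral_Ioc_eq_integral_Ioo,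
      ← intervalIntegral.integral_of_le (hle k), intervalIntegral.integral_mul_const]

theorem pow_sub_pow_le_of_le_one {x y : ℝ} (hx : 0 ≤ x) (hxy : x ≤ y) (hy : y ≤ 1) (j : ℕ) :
    y ^ j - x ^ j ≤ j * (y - x) := by
  induction j with
  | zero => simp
  | succ j ih =>
    have h1 : x ^ j ≤ 1 := pow_le_one₀ hx (hxy.trans hy)
    have h2 : y ^ (j + 1) - x ^ (j + 1) = y * (y ^ j - x ^ j) + x ^ j * (y - x) := by ring
    have h3 : 0 ≤ y ^ j - x ^ j := sub_nonneg.2 (pow_le_pow_left₀ hx hxy j)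
    have h4 : y * (y ^ j - x ^ j) ≤ 1 * (y ^ j - x ^ j) := mul_le_mul_of_nonneg_right hy h3
    have h5 : x ^ j * (y - x) ≤ 1 * (y - x) := mul_le_mul_of_nonneg_right h1 (by linarith)
    rw [h2]; push_cast; linarith

/-- The normalized binomials are uniformly close to the means of `x ^ j` over the mesh. -/
theorem abs_choose_div_choose_sub_le {j k n : ℕ} (hkn : k ≤ n) (hj : j ≤ n) :
    |(k.choose j : ℝ) / (n.choose j : ℝ) -
      ((n : ℝ) + 1) * ∫ x in ((k : ℝ) / (n + 1))..(((k : ℝ) + 1) / (n + 1)), x ^ j| ≤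
      (j : ℝ) ^ 2 / (n + 1) := by
  have hn : (0 : ℝ) < (n : ℝ) + 1 := by positivity
  have hkn' : (k : ℝ) ≤ n := by exact_mod_cast hkn
  rcases Nat.eq_zero_or_pos j with rfl | hj0
  · simp only [Nat.choose_zero_right, Nat.cast_one, div_one, pow_zero, integral_one]
    rw [← sub_div, add_sub_cancel_left, mul_one_div_cancel hn.ne']; simp
  have hj1 : (1 : ℝ) ≤ j := by exact_mod_cast hj0
  -- The binomial quotient and the mean of `x ^ j` both lie between `lo ^ j` and `hi ^ j`. As `hi -
  -- lo ≤ j/(n+1)`, the mean value estimate gives `j²/(n+1)`.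
  set lo : ℝ := max 0 ((k : ℝ) + 1 - j) / (n + 1) with hlo
  set hi : ℝ := ((k : ℝ) + 1) / (n + 1) with hhi
  have hlo0 : 0 ≤ lo := by positivity
  have hhi1 : hi ≤ 1 := by rw [hhi, div_le_one hn]; linarith
  have hab : (k : ℝ) / (n + 1) ≤ hi := div_le_div_of_nonneg_right (by linarith) hn.le
  have hlok : lo ≤ (k : ℝ) / (n + 1) :=
    div_le_div_of_nonneg_right (max_le (Nat.cast_nonneg k) (by linarith)) hn.le
  have hlh : lo ≤ hi := hlok.trans hab
  have hlen : hi - (k : ℝ) / (n + 1) = 1 / (n + 1) := by rw [hhi]; ring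
  have hint : ∀ f : ℝ → ℝ, Continuous f →
      IntervalIntegrable f volume ((k : ℝ) / (n + 1)) hi := fun f hf => hf.intervalIntegrable _ _
  have hup : ((n : ℝ) + 1) * ∫ x in ((k : ℝ) / (n + 1))..hi, x ^ j ≤ hi ^ j := by
    have : ∫ x in ((k : ℝ) / (n + 1))..hi, x ^ j ≤ ∫ x in ((k : ℝ) / (n + 1))..hi, hi ^ j :=
      intervalIntegral.integral_mono_on hab (hint _ (by fun_prop)) (hint _ (by fun_prop))
        fun x hx => pow_le_pow_left₀ ((hlo0.trans hlok).trans hx.1) hx.2 j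
    rw [intervalIntegral.integral_const, hlen, smul_eq_mul] at this
    calc _ ≤ ((n : ℝ) + 1) * (1 / (n + 1) * hi ^ j) := mul_le_mul_of_nonneg_left this hn.le
      _ = hi ^ j := by field_simp
  have hdn : lo ^ j ≤ ((n : ℝ) + 1) * ∫ x in ((k : ℝ) / (n + 1))..hi, x ^ j := by
    have : ∫ x in ((k : ℝ) / (n + 1))..hi, lo ^ j ≤ ∫ x in ((k : ℝ) / (n + 1))..hi, x ^ j :=
      intervalIntegral.integral_mono_on hab (hint _ (by fun_prop)) (hint _ (by fun_prop))
        fun x hx => pow_le_pow_left₀ hlo0 (hlok.trans hx.1) j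
    rw [intervalIntegral.integral_const, hlen, smul_eq_mul] at this
    calc lo ^ j = ((n : ℝ) + 1) * (1 / (n + 1) * lo ^ j) := by field_simp
      _ ≤ _ := mul_le_mul_of_nonneg_left this hn.le
  have h1 := choose_div_choose_le_pow hkn hj
  have h2 := pow_le_choose_div_choose hkn hj le_rfl
  have h3 : hi ^ j - lo ^ j ≤ (j : ℝ) ^ 2 / (n + 1) := by
    refine (pow_sub_pow_le_of_le_one hlo0 hlh hhi1 j).trans ?_
    rw [pow_two, mul_div_assoc]
    refine mul_le_mul_of_nonneg_left ?_ (Nat.cast_nonneg j)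
    rw [hhi, hlo, ← sub_div]
    refine div_le_div_of_nonneg_right ?_ hn.le
    have := le_max_right 0 ((k : ℝ) + 1 - j)
    linarith
  rw [abs_le]
  constructor <;> linarith

theorem norm_toLp_two_sq {α : Type*} [MeasurableSpace α] {μ : Measure α} {g : α → ℂ}
    (hg : MemLp g 2 μ) : ‖hg.toLp g‖ ^ 2 = ∫ x, ‖g x‖ ^ 2 ∂μ := by
  have h := inner_self_eq_norm_sq_to_K (𝕜 := ℂ) (hg.toLp g)
  rw [L2.inner_def] at h
  have h2 : ∫ a, inner ℂ (hg.toLp g a) (hg.toLp g a) ∂μ = ((∫ x, ‖g x‖ ^ 2 ∂μ : ℝ) : ℂ) := by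
    rw [← integral_complex_ofReal]
    refine integral_congr_ae ?_
    filter_upwards [hg.coeFn_toLp] with x hx
    rw [hx, inner_self_eq_norm_sq_to_K]
    push_cast; rfl
  rw [h2] at h
  have h3 : ((∫ x, ‖g x‖ ^ 2 ∂μ : ℝ) : ℂ) = ((‖hg.toLp g‖ ^ 2 : ℝ) : ℂ) := by
    rw [h]; push_cast; rfl
  exact (Complex.ofReal_inj.1 h3).symm

/-- Hausdorff's moment theorem in `L²`. -/
theorem HausdorffCondition.exists_memLp {f : ℕ → ℂ} (hf : HausdorffCondition f) :
    ∃ u : ℝ → ℂ, MemLp u 2 (volume.restrict (Ioc (0 : ℝ) 1)) ∧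
      ∀ j : ℕ, ∫ x in Ioc (0 : ℝ) 1, (x : ℂ) ^ j * u x = f j := by
  obtain ⟨M, hM, hfM⟩ := hf
  set μ : Measure ℝ := volume.restrict (Ioc (0 : ℝ) 1) with hμ
  let d : ℕ → ℕ → ℂ := fun n k =>
    (n.choose k : ℂ) * ((-1) ^ (n - k) * ((fwdDiff (1 : ℕ))^[n - k] f) k)
  have hd : ∀ n : ℕ, ((n : ℝ) + 1) * ∑ k ∈ Finset.range (n + 1), ‖d n k‖ ^ 2 ≤ M := by
    intro n
    refine le_trans (le_of_eq ?_) (hfM n).le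
    congr 1
    rw [← Finset.sum_range_reflect]
    refine Finset.sum_congr rfl fun k hk => ?_
    have hk' : k ≤ n := by have := Finset.mem_range.1 hk; omega
    have e1 : n + 1 - 1 - k = n - k := by omega
    have e2 : n - (n - k) = k := by omega
    simp only [d, e1, e2, Nat.choose_symm hk']
    simp [mul_pow]
  -- The squared norm of `w n` in `L²(0,1)` is `(n+1) ∑ ‖d n k‖²`, so (H) is exactly boundedness of
  -- this sequence. The conjugate undoes the conjugation in the first slot of the inner product.
  let w : ℕ → ℝ → ℂ := fun n x => ((n + 1 : ℕ) : ℂ) * (starRingEnd ℂ) (d n ⌊((n + 1 : ℕ) : ℝ) * x⌋₊)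
  have hwm : ∀ n, Measurable (w n) := fun n =>
    (((measurable_from_top (f := fun k : ℕ => (starRingEnd ℂ) (d n k))).comp
      (Nat.measurable_floor.comp (measurable_const.mul measurable_id))).const_mul _)
  have hwsq : ∀ n, IntegrableOn (fun x => ‖w n x‖ ^ 2) (Ioc 0 1) ∧
      ∫ x in Ioc (0 : ℝ) 1, ‖w n x‖ ^ 2 ≤ M := by
    intro n
    obtain ⟨h1, h2⟩ := integral_mul_step (fun k => ((‖d n k‖ ^ 2 : ℝ) : ℂ))
      (fun _ => ((((n + 1 : ℕ) : ℝ) ^ 2 : ℝ) : ℂ)) continuous_const (Nat.succ_pos n)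
    have e : (fun x : ℝ => ((((n + 1 : ℕ) : ℝ) ^ 2 : ℝ) : ℂ) *
        ((‖d n ⌊((n + 1 : ℕ) : ℝ) * x⌋₊‖ ^ 2 : ℝ) : ℂ)) = fun x => ((‖w n x‖ ^ 2 : ℝ) : ℂ) := by
      ext x
      simp only [w, norm_mul, RCLike.norm_conj, Complex.norm_natCast]
      push_cast; ring
    rw [e] at h1
    simp only [Nat.succ_eq_add_one] at h2
    have e' := congrArg (fun h : ℝ → ℂ => ∫ x in Ioc (0 : ℝ) 1, h x) e
    beta_reduce at e'
    rw [e'] at h2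
    refine ⟨h1.re, ?_⟩
    have h3 : ((∫ x in Ioc (0 : ℝ) 1, ‖w n x‖ ^ 2 : ℝ) : ℂ) =
        ((((n : ℝ) + 1) * ∑ k ∈ Finset.range (n + 1), ‖d n k‖ ^ 2 : ℝ) : ℂ) := by
      rw [← integral_complex_ofReal, h2]
      simp only [intervalIntegral.integral_const]
      push_cast
      rw [Finset.mul_sum]
      refine Finset.sum_congr rfl fun k _ => ?_
      have : ((n : ℂ) + 1) ≠ 0 := by exact_mod_cast Nat.succ_ne_zero n
      simp only [Complex.real_smul]
      push_cast
      field_simp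
      ring
    rw [Complex.ofReal_inj.1 h3]
    exact hd n
  have hwL : ∀ n, MemLp (w n) 2 μ := fun n =>
    (memLp_two_iff_integrable_sq_norm (hwm n).aestronglyMeasurable).2 (hwsq n).1
  have heL : ∀ j : ℕ, MemLp (fun x : ℝ => (x : ℂ) ^ j) 2 μ := fun j =>
    MemLp.of_bound (by fun_prop) 1 ((ae_restrict_iff' measurableSet_Ioc).2
      (Eventually.of_forall fun x hx => by
        rw [norm_pow, Complex.norm_real, Real.norm_of_nonneg hx.1.le]
        exact pow_le_one₀ hx.1.le hx.2))
  have hinner : ∀ {g : ℝ → ℂ} (hg : MemLp g 2 μ) (j : ℕ),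
      inner ℂ (hg.toLp g) ((heL j).toLp _) = ∫ x in Ioc (0 : ℝ) 1, (x : ℂ) ^ j * starRingEnd ℂ (g x) := by
    intro g hg j
    rw [L2.inner_def]
    refine integral_congr_ae ?_
    filter_upwards [hg.coeFn_toLp, (heL j).coeFn_toLp] with x h1 h2
    rw [h1, h2]; rfl
  have hlim : ∀ j : ℕ, Tendsto (fun n => ∫ x in Ioc (0 : ℝ) 1, (x : ℂ) ^ j * starRingEnd ℂ (w n x))
      atTop (𝓝 (f j)) := by
    intro j
    rw [tendsto_iff_norm_sub_tendsto_zero]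
    -- Replacing normalized binomials by means over cells costs `j²/(n+1) · ∑ ‖d n k‖`, and
    -- Cauchy–Schwarz with (H) bounds that sum by `√M`.
    have hb : ∀ᶠ n : ℕ in atTop,
        ‖(∫ x in Ioc (0 : ℝ) 1, (x : ℂ) ^ j * starRingEnd ℂ (w n x)) - f j‖ ≤
          ((j : ℝ) ^ 2 * √M) * (1 / ((n : ℝ) + 1)) := by
      filter_upwards [eventually_ge_atTop j] with n hjn
      have hn : (0 : ℝ) < (n : ℝ) + 1 := by positivity
      have e1 : ∫ x in Ioc (0 : ℝ) 1, (x : ℂ) ^ j * starRingEnd ℂ (w n x) =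
          ∑ k ∈ Finset.range (n + 1), ((((n : ℝ) + 1) *
            ∫ x in ((k : ℝ) / (n + 1))..(((k : ℝ) + 1) / (n + 1)), x ^ j : ℝ) : ℂ) * d n k := by
        have h2 := (integral_mul_step (d n)
          (fun x => ((((n + 1 : ℕ) : ℝ) * x ^ j : ℝ) : ℂ)) (by fun_prop) (Nat.succ_pos n)).2
        refine Eq.trans (integral_congr_ae (Eventually.of_forall fun x => ?_)) (h2.trans ?_)
        · simp only [w, map_mul, Complex.conj_conj, map_natCast]; push_cast; ring
        · refine Finset.sum_congr rfl fun k _ => ?_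
          rw [intervalIntegral.integral_ofReal, intervalIntegral.integral_const_mul]
          push_cast; rfl
      rw [e1, eq_sum_choose_fwdDiff f hjn, ← Finset.sum_sub_distrib]
      have hterm : ∀ k ∈ Finset.range (n + 1), ‖((((n : ℝ) + 1) *
            ∫ x in ((k : ℝ) / (n + 1))..(((k : ℝ) + 1) / (n + 1)), x ^ j : ℝ) : ℂ) * d n k -
            ((k.choose j : ℂ) / (n.choose j : ℂ)) * d n k‖ ≤ (j : ℝ) ^ 2 / (n + 1) * ‖d n k‖ := by
        intro k hk
        have hk' : k ≤ n := by have := Finset.mem_range.1 hk; omega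
        rw [← sub_mul, norm_mul]
        refine mul_le_mul_of_nonneg_right ?_ (norm_nonneg _)
        have := abs_choose_div_choose_sub_le hk' hjn
        rw [abs_sub_comm, ← Real.norm_eq_abs, ← Complex.norm_real] at this
        refine le_trans (le_of_eq ?_) this
        push_cast; rfl
      refine (norm_sum_le_of_le _ hterm).trans ?_
      rw [← Finset.mul_sum]
      have hs : ∑ k ∈ Finset.range (n + 1), ‖d n k‖ ≤ √M := by
        refine Real.le_sqrt_of_sq_le ?_
        have := sq_sum_le_card_mul_sum_sq (s := Finset.range (n + 1)) (f := fun k => ‖d n k‖)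
        rw [Finset.card_range] at this
        push_cast at this
        exact this.trans (hd n)
      calc (j : ℝ) ^ 2 / (n + 1) * ∑ k ∈ Finset.range (n + 1), ‖d n k‖
          ≤ (j : ℝ) ^ 2 / (n + 1) * √M := mul_le_mul_of_nonneg_left hs (by positivity)
        _ = _ := by ring
    refine squeeze_zero' (Eventually.of_forall fun _ => norm_nonneg _) hb ?_
    simpa using (tendsto_one_div_add_atTop_nhds_zero_nat (𝕜 := ℝ)).const_mul ((j : ℝ) ^ 2 * √M)
  obtain ⟨v, hv⟩ := exists_inner_eq_of_tendsto (fun n => (hwL n).toLp (w n)) (√M) (fun n => by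
      refine Real.le_sqrt_of_sq_le ?_
      rw [norm_toLp_two_sq]
      exact (hwsq n).2) (fun j : ℕ => (heL j).toLp _) f (fun j => by
      simp only [hinner]
      exact hlim j)
  have hvL := Lp.memLp v
  refine ⟨fun x => starRingEnd ℂ (v x), hvL.star, fun j => ?_⟩
  rw [← hv j, ← hinner hvL j, Lp.toLp_coeFn]

/-! ### The Fourier transform on `L²` -/

/-- The transform of an `L²` class agrees with its transform as a tempered distribution; testing
against Schwartz functions thus gives access to its values. -/
theorem integral_smul_fourier_toLp {f : ℝ → ℂ} (hf : MemLp f 2 volume) (g : 𝓢(ℝ, ℂ)) :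
    ∫ x, g x * (𝓕 (hf.toLp f) : Lp ℂ 2 volume) x = ∫ x, (𝓕 g) x * f x := by
  have h := Lp.fourier_toTemperedDistribution_eq (hf.toLp f)
  have h' := congrArg (fun T : 𝓢'(ℝ, ℂ) => T g) h
  simp only [TemperedDistribution.fourier_apply, Lp.toTemperedDistribution_apply,
    smul_eq_mul] at h'
  rw [← h']
  refine integral_congr_ae ?_
  filter_upwards [hf.coeFn_toLp] with x hx
  rw [hx]

theorem ae_eq_of_integral_schwartz_mul_eq {f g : ℝ → ℂ} (hf : LocallyIntegrable f)
    (hg : LocallyIntegrable g) (h : ∀ φ : 𝓢(ℝ, ℂ), ∫ x, φ x * f x = ∫ x, φ x * g x) :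
    f =ᵐ[volume] g := by
  refine ae_eq_of_integral_contDiff_smul_eq hf hg fun φ hφ hs => ?_
  have hs' : HasCompactSupport (fun x => (φ x : ℂ)) := hs.comp_left (g := fun x : ℝ => (x : ℂ)) rfl
  have hφ' : ContDiff ℝ ∞ (fun x => (φ x : ℂ)) := Complex.ofRealCLM.contDiff.comp hφ
  have := h (hs'.toSchwartzMap hφ')
  simp only [Complex.real_smul]
  exact this

theorem integral_fourier_mul_eq_flip {f g : ℝ → ℂ} (hf : Integrable f) (hg : Integrable g) :
    ∫ x, 𝓕 f x * g x = ∫ x, f x * 𝓕 g x := by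
  have := VectorFourier.integral_fourierIntegral_smul_eq_flip (L := innerₗ ℝ)
    Real.continuous_fourierChar continuous_inner hf hg
  rw [flip_innerₗ] at this
  exact this

theorem continuous_fourier_of_integrable {f : ℝ → ℂ} (hf : Integrable f) : Continuous (𝓕 f) :=
  VectorFourier.fourierIntegral_continuous Real.continuous_fourierChar continuous_inner hf

theorem integral_fourierInv_mul_eq_flip {f g : ℝ → ℂ} (hf : Integrable f) (hg : Integrable g) :
    ∫ x, 𝓕⁻ f x * g x = ∫ x, f x * 𝓕⁻ g x := by
  have h1 := integral_fourier_mul_eq_flip hf.comp_neg hg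
  rw [Real.fourierInv_eq_fourier_comp_neg, h1,
    ← integral_neg_eq_self (fun x => f x * 𝓕⁻ g x)]
  refine integral_congr_ae (Eventually.of_forall fun x => ?_)
  simp only [Real.fourierInv_eq_fourier_neg, neg_neg]

/-- On `L¹ ∩ L²` the two definitions of the Fourier transform agree. -/
theorem fourier_toLp_ae_eq {f : ℝ → ℂ} (hf : MemLp f 2 volume) (hf1 : Integrable f) :
    (𝓕 (hf.toLp f) : Lp ℂ 2 volume) =ᵐ[volume] 𝓕 f := by
  have hc : Continuous (𝓕 f) := continuous_fourier_of_integrable hf1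
  refine ae_eq_of_integral_schwartz_mul_eq ((Lp.memLp _).locallyIntegrable (by norm_num))
    hc.locallyIntegrable fun φ => ?_
  rw [integral_smul_fourier_toLp]
  have := integral_fourier_mul_eq_flip hf1 φ.integrable
  simp only [mul_comm (φ _)]
  rw [this]
  simp only [mul_comm, SchwartzMap.fourier_coe]

/-- Fourier inversion for `L²` functions with integrable transform. -/
theorem ae_eq_fourierInv_of_integrable {f : ℝ → ℂ} (hf : MemLp f 2 volume) {h : ℝ → ℂ}
    (hh : (𝓕 (hf.toLp f) : Lp ℂ 2 volume) =ᵐ[volume] h) (hi : Integrable h) :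
    f =ᵐ[volume] 𝓕⁻ h := by
  have hc : Continuous (𝓕⁻ h) := by
    rw [Real.fourierInv_eq_fourier_comp_neg]
    exact continuous_fourier_of_integrable hi.comp_neg
  refine ae_eq_of_integral_schwartz_mul_eq (hf.locallyIntegrable (by norm_num))
    hc.locallyIntegrable fun φ => ?_
  have h1 := integral_smul_fourier_toLp hf (𝓕⁻ φ)
  rw [FourierTransform.fourier_fourierInv_eq] at h1
  rw [← h1]
  have h2 := integral_fourierInv_mul_eq_flip hi φ.integrable
  simp only [mul_comm (φ _)]
  rw [h2]
  refine integral_congr_ae ?_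
  filter_upwards [hh] with x hx
  rw [hx, mul_comm, SchwartzMap.fourierInv_coe]

/-! ### Scaling -/

theorem eLpNorm_comp_div {h : ℝ → ℂ} {R : ℝ} (hR : 0 < R) :
    eLpNorm (fun ν => h (ν / R)) 2 volume = ENNReal.ofReal R ^ (1 / 2 : ℝ) * eLpNorm h 2 volume := by
  have he : MeasurableEmbedding (fun ν : ℝ => ν * R⁻¹) :=
    (Homeomorph.mulRight₀ R⁻¹ (inv_ne_zero hR.ne')).measurableEmbedding
  have h1 := he.eLpNorm_map_measure (g := h) (p := 2) (μ := volume)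
  rw [Real.map_volume_mul_right (inv_ne_zero hR.ne'), inv_inv, abs_of_pos hR,
    eLpNorm_smul_measure_of_ne_top (by norm_num)] at h1
  simpa [div_eq_mul_inv, Function.comp_def] using h1.symm

theorem quasiMeasurePreserving_div {R : ℝ} (hR : 0 < R) :
    Measure.QuasiMeasurePreserving (fun ν : ℝ => ν / R) volume volume := by
  refine ⟨by fun_prop, ?_⟩
  simp only [div_eq_mul_inv]
  rw [Real.map_volume_mul_right (inv_ne_zero hR.ne')]
  exact Measure.smul_absolutelyContinuous

theorem MemLp.comp_div_const {h : ℝ → ℂ} {R : ℝ} (hR : 0 < R) (hh : MemLp h 2 volume) :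
    MemLp (fun ν => h (ν / R)) 2 volume := by
  refine ⟨hh.1.comp_quasiMeasurePreserving (quasiMeasurePreserving_div hR), ?_⟩
  rw [eLpNorm_comp_div hR]
  exact ENNReal.mul_lt_top (ENNReal.rpow_lt_top_of_nonneg (by norm_num) ENNReal.ofReal_ne_top) hh.2

/-! ### The Laplace transform of an `L²` function on the half-line -/

/-- The exponentially damped function `e^{-ct} ψ(t)`. -/
noncomputable def damp (c : ℝ) (ψ : ℝ → ℂ) (t : ℝ) : ℂ := ((Real.exp (-(c * t)) : ℝ) : ℂ) * ψ t

/-- The integrand of the Laplace transform, centred at `s = -1/2`. -/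
noncomputable def laplaceKernel (s : ℂ) (t : ℝ) : ℂ := Complex.exp (-((s + 1 / 2) * t))

theorem norm_laplaceKernel (s : ℂ) (t : ℝ) :
    ‖laplaceKernel s t‖ = Real.exp (-((s.re + 1 / 2) * t)) := by
  rw [laplaceKernel, Complex.norm_exp]
  simp

theorem norm_damp (c : ℝ) (ψ : ℝ → ℂ) (t : ℝ) : ‖damp c ψ t‖ = Real.exp (-(c * t)) * ‖ψ t‖ := by
  rw [damp, norm_mul, Complex.norm_real, Real.norm_of_nonneg (Real.exp_pos _).le]

theorem norm_damp_le {c : ℝ} (hc : 0 ≤ c) {ψ : ℝ → ℂ} (h0 : ∀ t ≤ 0, ψ t = 0) (t : ℝ) :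
    ‖damp c ψ t‖ ≤ ‖ψ t‖ := by
  rw [norm_damp]
  rcases le_or_gt t 0 with ht | ht
  · simp [h0 t ht]
  · exact mul_le_of_le_one_left (norm_nonneg _) (Real.exp_le_one_iff.2 (by nlinarith))

theorem MemLp.damp {ψ : ℝ → ℂ} (hψ : MemLp ψ 2 volume) (h0 : ∀ t ≤ 0, ψ t = 0) {c : ℝ}
    (hc : 0 ≤ c) : MemLp (damp c ψ) 2 volume := by
  refine hψ.mono ?_ (Eventually.of_forall (norm_damp_le hc h0))
  exact (by fun_prop : Continuous fun t : ℝ => ((Real.exp (-(c * t)) : ℝ) : ℂ)).aestronglyMeasurable.mul hψ.1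

theorem inner_toLp {f g : ℝ → ℂ} (hf : MemLp f 2 volume) (hg : MemLp g 2 volume) :
    inner ℂ (hf.toLp f) (hg.toLp g) = ∫ x, g x * starRingEnd ℂ (f x) := by
  rw [L2.inner_def]
  refine integral_congr_ae ?_
  filter_upwards [hf.coeFn_toLp, hg.coeFn_toLp] with x h1 h2
  rw [h1, h2]; rfl

/-- Cauchy–Schwarz against the kernel restricted to `t > a`, whose `L²` norm is `e^{-ca}/√(2c)` with
`c = Re s + 1/2`. The factor `e^{-ca}` later turns vanishing of the density on `(-∞, a]` into
exponential decay. -/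
theorem integrable_laplace {ψ : ℝ → ℂ} (hψ : MemLp ψ 2 volume) {a : ℝ} (h0 : ∀ t ≤ a, ψ t = 0)
    {s : ℂ} (hs : -(1 / 2 : ℝ) < s.re) :
    Integrable (fun t => laplaceKernel s t * ψ t) ∧
    ‖∫ t, laplaceKernel s t * ψ t‖ ≤
      Real.exp (-((s.re + 1 / 2) * a)) / √(2 * (s.re + 1 / 2)) * √(∫ t, ‖ψ t‖ ^ 2) := by
  set c := s.re + 1 / 2 with hc
  have hc0 : 0 < c := by rw [hc]; linarith
  have hkc : Continuous (laplaceKernel s) := by unfold laplaceKernel; fun_prop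
  let k : ℝ → ℂ := (Ioi a).indicator (fun t => starRingEnd ℂ (laplaceKernel s t))
  have hksq : ∀ t, ‖k t‖ ^ 2 = (Ioi a).indicator (fun t => Real.exp (-(2 * c) * t)) t := by
    intro t
    by_cases ht : t ∈ Ioi a
    · simp only [k, indicator_of_mem ht, RCLike.norm_conj, norm_laplaceKernel]
      rw [← Real.exp_nat_mul]; congr 1; push_cast; ring
    · simp only [k, indicator_of_notMem ht]; simp
  have hkm : AEStronglyMeasurable k volume :=
    (Complex.continuous_conj.comp hkc).aestronglyMeasurable.indicator measurableSet_Ioi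
  have hkL : MemLp k 2 volume := by
    rw [memLp_two_iff_integrable_sq_norm hkm]
    simp only [hksq]
    exact (integrable_indicator_iff measurableSet_Ioi).2 (integrableOn_exp_mul_Ioi (by linarith) a)
  have hkint : ∫ t, ‖k t‖ ^ 2 = (Real.exp (-(c * a)) / √(2 * c)) ^ 2 := by
    simp only [hksq]
    rw [integral_indicator measurableSet_Ioi, integral_exp_mul_Ioi (by linarith), div_pow,
      Real.sq_sqrt (by positivity), ← Real.exp_nat_mul, neg_div_neg_eq]
    congr 2; push_cast; ring
  have hprod : ∀ t, ψ t * starRingEnd ℂ (k t) = laplaceKernel s t * ψ t := by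
    intro t
    by_cases ht : t ∈ Ioi a
    · simp only [k, indicator_of_mem ht, Complex.conj_conj]; ring
    · rw [h0 t (not_lt.1 ht)]; simp
  constructor
  · have := hψ.integrable_mul hkL.star
    refine this.congr (Eventually.of_forall fun t => ?_)
    exact hprod t
  · have h1 := norm_inner_le_norm (𝕜 := ℂ) (hkL.toLp k) (hψ.toLp ψ)
    rw [inner_toLp] at h1
    simp only [hprod] at h1
    refine h1.trans (le_of_eq ?_)
    congr 1
    · rw [← Real.sqrt_sq (norm_nonneg (hkL.toLp k)), norm_toLp_two_sq, hkint, Real.sqrt_sq]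
      positivity
    · rw [← norm_toLp_two_sq hψ, Real.sqrt_sq (norm_nonneg _)]

theorem integrable_damp {ψ : ℝ → ℂ} (hψ : MemLp ψ 2 volume) (h0 : ∀ t ≤ 0, ψ t = 0) {c : ℝ}
    (hc : 0 < c) : Integrable (damp c ψ) := by
  have := (integrable_laplace hψ h0 (s := ((c - 1 / 2 : ℝ) : ℂ)) (by simp; linarith)).1
  refine this.congr (Eventually.of_forall fun t => ?_)
  simp only [damp, laplaceKernel]
  push_cast
  congr 2; ring

theorem differentiableAt_laplace {ψ : ℝ → ℂ} (hψ : MemLp ψ 2 volume) (h0 : ∀ t ≤ 0, ψ t = 0)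
    {s : ℂ} (hs : -(1 / 2 : ℝ) < s.re) :
    DifferentiableAt ℂ (fun s => ∫ t, laplaceKernel s t * ψ t) s := by
  set c := (s.re + 1 / 2) / 2 with hc
  have hc0 : 0 < c := by rw [hc]; linarith
  have hball : ∀ w ∈ Metric.ball s c, c ≤ w.re + 1 / 2 := by
    intro w hw
    have h1 : |(w - s).re| < c := (Complex.abs_re_le_norm _).trans_lt (by simpa [dist_eq_norm] using hw)
    rw [Complex.sub_re] at h1
    have := (abs_lt.1 h1).1
    linarith
  have hkc : ∀ w, Continuous (laplaceKernel w) := fun w => by unfold laplaceKernel; fun_prop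
  refine (hasDerivAt_integral_of_dominated_loc_of_deriv_le (Metric.ball_mem_nhds s hc0)
    (F := fun w t => laplaceKernel w t * ψ t)
    (F' := fun w t => (-(t : ℂ) * laplaceKernel w t) * ψ t)
    (bound := fun t => (2 / c) * ‖damp (c / 2) ψ t‖)
    (Eventually.of_forall fun w => (hkc w).aestronglyMeasurable.mul hψ.1)
    (integrable_laplace hψ h0 hs).1
    ((by have := hkc s; fun_prop : Continuous fun t : ℝ =>
      -(t : ℂ) * laplaceKernel s t).aestronglyMeasurable.mul hψ.1)
    (Eventually.of_forall fun t w hw => ?_)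
    ((integrable_damp hψ h0 (by positivity)).norm.const_mul _)
    (Eventually.of_forall fun t w _ => ?_)).2.differentiableAt
  · rcases le_or_gt t 0 with ht | ht
    · simp [h0 t ht, damp]
    rw [norm_mul, norm_mul, norm_neg, norm_laplaceKernel, norm_damp, Complex.norm_real,
      Real.norm_of_nonneg ht.le, ← mul_assoc]
    refine mul_le_mul_of_nonneg_right ?_ (norm_nonneg _)
    -- The factor `t` produced by differentiation is absorbed by half of the damping `e^{-ct}`; the
    -- other half keeps the bound integrable.
    have h1 : t ≤ (2 / c) * Real.exp (c / 2 * t) := by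
      have := Real.add_one_le_exp (c / 2 * t)
      calc t = (2 / c) * (c / 2 * t) := by field_simp
        _ ≤ _ := mul_le_mul_of_nonneg_left (by linarith) (by positivity)
    calc t * Real.exp (-((w.re + 1 / 2) * t))
        ≤ ((2 / c) * Real.exp (c / 2 * t)) * Real.exp (-(c * t)) := by
          refine mul_le_mul h1 (Real.exp_le_exp.2 ?_) (Real.exp_pos _).le (by positivity)
          have := hball w hw
          nlinarith
      _ = _ := by rw [mul_assoc, ← Real.exp_add]; congr 2; ring
  · refine HasDerivAt.mul_const ?_ _
    have : HasDerivAt (fun w : ℂ => -((w + 1 / 2) * (t : ℂ))) (-(1 * (t : ℂ))) w :=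
      (((hasDerivAt_id w).add_const _).mul_const _).neg
    change HasDerivAt (fun w : ℂ => Complex.exp (-((w + 1 / 2) * t)))
      (-(t : ℂ) * Complex.exp (-((w + 1 / 2) * t))) w
    exact this.cexp.congr_deriv (by ring)

/-- With the normalization `e^{-2πiwt}` of `𝓕`, the height `ν` corresponds to the frequency `ν /
2π`; this is the origin of the factor `2π` in the Plancherel identity. -/
theorem fourier_damp {ψ : ℝ → ℂ} (c ν : ℝ) :
    𝓕 (damp c ψ) (ν / (2 * Real.pi)) =
      ∫ t, laplaceKernel (((c - 1 / 2 : ℝ) : ℂ) + (ν : ℂ) * Complex.I) t * ψ t := by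
  rw [Real.fourier_real_eq_integral_exp_smul]
  refine integral_congr_ae (Eventually.of_forall fun t => ?_)
  simp only [damp, laplaceKernel, smul_eq_mul]
  rw [← mul_assoc, Complex.ofReal_exp, ← Complex.exp_add]
  congr 2
  have : (Real.pi : ℂ) ≠ 0 := by exact_mod_cast Real.pi_ne_zero
  push_cast
  field_simp
  ring

open Classical in
/-- The Laplace transform of `ψ`, continued to the line `Re s = -1/2` (and constantly to the left
of it) by the Fourier–Plancherel transform of `ψ`. -/
noncomputable def halfPlaneTransform (ψ : ℝ → ℂ) (s : ℂ) : ℂ :=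
  if -(1 / 2 : ℝ) < s.re then ∫ t, laplaceKernel s t * ψ t
  else if h : MemLp ψ 2 volume then (𝓕 (h.toLp ψ) : Lp ℂ 2 volume) (s.im / (2 * Real.pi)) else 0

theorem halfPlaneTransform_of_re {ψ : ℝ → ℂ} {s : ℂ} (hs : -(1 / 2 : ℝ) < s.re) :
    halfPlaneTransform ψ s = ∫ t, laplaceKernel s t * ψ t := if_pos hs

theorem two_pi_pos : 0 < 2 * Real.pi := by positivity

theorem damp_zero (ψ : ℝ → ℂ) : damp 0 ψ = ψ := by ext t; simp [damp]

/-- On the boundary line this is the definition. Inside, the damped function is in `L¹ ∩ L²`, so the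
Fourier integral represents the Plancherel transform, almost everywhere. -/
theorem vertical_halfPlaneTransform_ae {ψ : ℝ → ℂ} (hψ : MemLp ψ 2 volume) (h0 : ∀ t ≤ 0, ψ t = 0)
    {σ : ℝ} (hσ : -(1 / 2 : ℝ) ≤ σ) (hc : 0 ≤ σ + 1 / 2) :
    vertical (halfPlaneTransform ψ) σ =ᵐ[volume] fun ν =>
      (𝓕 ((MemLp.damp hψ h0 hc).toLp (damp (σ + 1 / 2) ψ)) : Lp ℂ 2 volume) (ν / (2 * Real.pi)) := by
  rcases hσ.eq_or_lt with rfl | hlt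
  · refine Eventually.of_forall fun ν => ?_
    have e : damp (-(1 / 2 : ℝ) + 1 / 2) ψ = ψ := by rw [neg_add_cancel, damp_zero]
    simp only [vertical, halfPlaneTransform]
    rw [if_neg (by simp), dif_pos hψ]
    simp only [e]
    simp
  · have h1 := fourier_toLp_ae_eq (MemLp.damp hψ h0 hc) (integrable_damp hψ h0 (by linarith))
    filter_upwards [(quasiMeasurePreserving_div two_pi_pos).ae_eq_comp h1] with ν hν
    simp only [Function.comp_apply] at hν
    rw [hν, fourier_damp, vertical, halfPlaneTransform_of_re (by simpa using hlt), add_sub_cancel_right]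

theorem memLp_vertical_halfPlaneTransform {ψ : ℝ → ℂ} (hψ : MemLp ψ 2 volume) (h0 : ∀ t ≤ 0, ψ t = 0)
    {σ : ℝ} (hσ : -(1 / 2 : ℝ) ≤ σ) :
    MemLp (vertical (halfPlaneTransform ψ) σ) 2 volume :=
  (memLp_congr_ae (vertical_halfPlaneTransform_ae hψ h0 hσ (by linarith))).2
    (MemLp.comp_div_const two_pi_pos (Lp.memLp _))


theorem norm_Lp_two_sq (g : Lp ℂ 2 (volume : Measure ℝ)) : ‖g‖ ^ 2 = ∫ x, ‖g x‖ ^ 2 := by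
  rw [← norm_toLp_two_sq (Lp.memLp g), Lp.toLp_coeFn]

/-- The Mellin–Plancherel identity on vertical lines. -/
theorem integral_norm_sq_vertical_halfPlaneTransform {ψ : ℝ → ℂ} (hψ : MemLp ψ 2 volume)
    (h0 : ∀ t ≤ 0, ψ t = 0) {σ : ℝ} (hσ : -(1 / 2 : ℝ) ≤ σ) :
    ∫ ν, ‖vertical (halfPlaneTransform ψ) σ ν‖ ^ 2 =
      2 * Real.pi * ∫ t, ‖damp (σ + 1 / 2) ψ t‖ ^ 2 := by
  have hc : 0 ≤ σ + 1 / 2 := by linarith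
  have h1 : ∫ ν, ‖vertical (halfPlaneTransform ψ) σ ν‖ ^ 2 = ∫ ν : ℝ,
      (fun x => ‖(𝓕 ((MemLp.damp hψ h0 hc).toLp (damp (σ + 1 / 2) ψ)) : Lp ℂ 2 volume) x‖ ^ 2)
        (ν / (2 * Real.pi)) := by
    refine integral_congr_ae ?_
    filter_upwards [vertical_halfPlaneTransform_ae hψ h0 hσ hc] with ν hν
    rw [hν]
  rw [h1, Measure.integral_comp_div (fun x => ‖(𝓕 ((MemLp.damp hψ h0 hc).toLp
    (damp (σ + 1 / 2) ψ)) : Lp ℂ 2 volume) x‖ ^ 2), ← norm_Lp_two_sq, Lp.norm_fourier_eq,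
    norm_toLp_two_sq, abs_of_pos two_pi_pos, smul_eq_mul]

theorem tendsto_toLp_damp {ψ : ℝ → ℂ} (hψ : MemLp ψ 2 volume) (h0 : ∀ t ≤ 0, ψ t = 0) :
    Tendsto (fun c : ℝ => ∫ t, ‖damp c ψ t - ψ t‖ ^ 2) (𝓝[>] 0) (𝓝 0) := by
  have hm : ∀ c, AEStronglyMeasurable (fun t => ‖damp c ψ t - ψ t‖ ^ 2) volume := fun c =>
    ((((by fun_prop : Continuous fun t : ℝ =>
      ((Real.exp (-(c * t)) : ℝ) : ℂ)).aestronglyMeasurable.mul hψ.1).sub hψ.1).norm.pow 2)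
  have := tendsto_integral_filter_of_dominated_convergence (μ := (volume : Measure ℝ))
    (l := 𝓝[>] (0 : ℝ)) (F := fun c t => ‖damp c ψ t - ψ t‖ ^ 2) (f := fun _ => (0 : ℝ))
    (fun t => 4 * ‖ψ t‖ ^ 2) (Eventually.of_forall hm) ?_
    (((memLp_two_iff_integrable_sq_norm hψ.1).1 hψ).const_mul 4)
    (Eventually.of_forall fun t => ?_)
  · simpa using this
  · filter_upwards [self_mem_nhdsWithin] with c hc
    refine Eventually.of_forall fun t => ?_
    rw [Real.norm_of_nonneg (by positivity)]
    have h1 := norm_sub_le (damp c ψ t) (ψ t)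
    have h2 := norm_damp_le (mem_Ioi.1 hc).le h0 t
    nlinarith [norm_nonneg (damp c ψ t - ψ t), norm_nonneg (ψ t)]
  · have : Continuous fun c : ℝ => ‖damp c ψ t - ψ t‖ ^ 2 := by unfold damp; fun_prop
    have h := (this.tendsto 0).mono_left (nhdsWithin_le_nhds (s := Ioi 0))
    simpa [damp_zero] using h

/-- The easy half of the Paley–Wiener theorem: by Plancherel the norm on each line is that of a
damped `ψ`, damping decreases it, and convergence to the boundary values is the `L²` convergence of
the damped functions to `ψ`. -/
theorem isHardyTwo_halfPlaneTransform {ψ : ℝ → ℂ} (hψ : MemLp ψ 2 volume)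
    (h0 : ∀ t ≤ 0, ψ t = 0) : IsHardyTwo (halfPlaneTransform ψ) where
  holomorphic := by
    intro s hs
    have hs' : -(1 / 2 : ℝ) < s.re := hs
    have ho : IsOpen {s : ℂ | -(1 / 2 : ℝ) < s.re} := isOpen_lt continuous_const Complex.continuous_re
    refine ((differentiableAt_laplace hψ h0 hs').congr_of_eventuallyEq ?_).differentiableWithinAt
    filter_upwards [ho.mem_nhds hs] with w hw
    exact halfPlaneTransform_of_re hw
  bounded := by
    refine ⟨(2 * Real.pi * ∫ t, ‖ψ t‖ ^ 2).toNNReal, fun σ hσ => ?_⟩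
    have hm := memLp_vertical_halfPlaneTransform hψ h0 hσ.le
    have hi := (memLp_two_iff_integrable_sq_norm hm.1).1 hm
    have e := ofReal_integral_eq_lintegral_ofReal hi (Eventually.of_forall fun _ => by positivity)
    have e2 : ∫⁻ ν, ‖vertical (halfPlaneTransform ψ) σ ν‖ₑ ^ 2 =
        ∫⁻ ν, ENNReal.ofReal (‖vertical (halfPlaneTransform ψ) σ ν‖ ^ 2) := by
      refine lintegral_congr fun ν => ?_
      rw [ENNReal.ofReal_pow (norm_nonneg _), ofReal_norm]
    rw [e2, ← e, integral_norm_sq_vertical_halfPlaneTransform hψ h0 hσ.le]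
    refine ENNReal.ofReal_le_ofReal (mul_le_mul_of_nonneg_left ?_ two_pi_pos.le)
    have hd := MemLp.damp hψ h0 (show 0 ≤ σ + 1 / 2 by linarith)
    refine integral_mono ((memLp_two_iff_integrable_sq_norm hd.1).1 hd)
      ((memLp_two_iff_integrable_sq_norm hψ.1).1 hψ) fun t => ?_
    exact pow_le_pow_left₀ (norm_nonneg _) (norm_damp_le (by linarith) h0 t) 2
  boundary_memLp := memLp_vertical_halfPlaneTransform hψ h0 le_rfl
  boundary_limit := by
    have h1 : Tendsto (fun σ : ℝ => σ + 1 / 2) (𝓝[>] (-(1 / 2 : ℝ))) (𝓝[>] 0) := by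
      refine tendsto_nhdsWithin_iff.2 ⟨?_, ?_⟩
      · have : Tendsto (fun σ : ℝ => σ + 1 / 2) (𝓝 (-(1 / 2 : ℝ))) (𝓝 (-(1 / 2 : ℝ) + 1 / 2)) :=
          (by fun_prop : Continuous fun σ : ℝ => σ + 1 / 2).tendsto _
        rw [neg_add_cancel] at this
        exact this.mono_left nhdsWithin_le_nhds
      · filter_upwards [self_mem_nhdsWithin] with σ hσ
        have := mem_Ioi.1 hσ
        simp only [mem_Ioi]; linarith
    have h2 := (tendsto_toLp_damp hψ h0).comp h1
    have h3 := (ENNReal.tendsto_ofReal (Real.continuous_sqrt.tendsto _ |>.comp h2))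
    have h4 := ENNReal.Tendsto.const_mul (a := ENNReal.ofReal (2 * Real.pi) ^ (1 / 2 : ℝ)) h3
      (Or.inr (ENNReal.rpow_ne_top_of_nonneg (by norm_num) ENNReal.ofReal_ne_top))
    simp only [Real.sqrt_zero, ENNReal.ofReal_zero, mul_zero] at h4
    refine h4.congr' ?_
    filter_upwards [self_mem_nhdsWithin] with σ hσ
    have hσ' : -(1 / 2 : ℝ) < σ := hσ
    have hc : 0 ≤ σ + 1 / 2 := by linarith
    have hd := MemLp.damp hψ h0 hc
    have hv0 : vertical (halfPlaneTransform ψ) (-(1 / 2 : ℝ)) =ᵐ[volume] fun ν =>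
        (𝓕 (hψ.toLp ψ) : Lp ℂ 2 volume) (ν / (2 * Real.pi)) := by
      refine Eventually.of_forall fun ν => ?_
      simp only [vertical, halfPlaneTransform]
      rw [if_neg (by simp), dif_pos hψ]
      simp
    have e1 := eLpNorm_congr_ae (p := 2)
      ((vertical_halfPlaneTransform_ae hψ h0 hσ'.le hc).sub hv0)
    rw [e1]
    have e2 : (fun ν : ℝ => (𝓕 (hd.toLp (damp (σ + 1 / 2) ψ)) : Lp ℂ 2 volume) (ν / (2 * Real.pi))) -
        (fun ν : ℝ => (𝓕 (hψ.toLp ψ) : Lp ℂ 2 volume) (ν / (2 * Real.pi))) =ᵐ[volume]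
        fun ν => (𝓕 (hd.toLp (damp (σ + 1 / 2) ψ)) - 𝓕 (hψ.toLp ψ) : Lp ℂ 2 volume)
          (ν / (2 * Real.pi)) := by
      filter_upwards [(quasiMeasurePreserving_div two_pi_pos).ae_eq_comp
        (Lp.coeFn_sub (𝓕 (hd.toLp (damp (σ + 1 / 2) ψ)) : Lp ℂ 2 volume) (𝓕 (hψ.toLp ψ)))] with ν hν
      exact hν.symm
    rw [eLpNorm_congr_ae e2, eLpNorm_comp_div two_pi_pos, ← Lp.enorm_def]
    have e3 : (𝓕 (hd.toLp (damp (σ + 1 / 2) ψ)) - 𝓕 (hψ.toLp ψ) : Lp ℂ 2 volume) =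
        𝓕 ((hd.sub hψ).toLp (damp (σ + 1 / 2) ψ - ψ)) := by
      rw [MemLp.toLp_sub]
      exact ((Lp.fourierTransformₗᵢ ℝ ℂ).map_sub _ _).symm
    rw [e3, ← ofReal_norm, Lp.norm_fourier_eq]
    congr 2
    have e4 := norm_toLp_two_sq (hd.sub hψ)
    simp only [Pi.sub_apply] at e4
    simp only [Function.comp_apply]
    rw [← e4, Real.sqrt_sq (norm_nonneg _)]

/-- Fourier inversion on a vertical line on which the transform is integrable. -/
theorem damp_ae_eq_integral_vertical {ψ : ℝ → ℂ} (hψ : MemLp ψ 2 volume) (h0 : ∀ t ≤ 0, ψ t = 0)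
    {σ : ℝ} (hσ : -(1 / 2 : ℝ) ≤ σ) (hi : Integrable (vertical (halfPlaneTransform ψ) σ)) :
    damp (σ + 1 / 2) ψ =ᵐ[volume] fun t => (1 / (2 * (Real.pi : ℂ))) *
      ∫ ν : ℝ, vertical (halfPlaneTransform ψ) σ ν * Complex.exp ((ν : ℂ) * t * Complex.I) := by
  have hc : 0 ≤ σ + 1 / 2 := by linarith
  set A := vertical (halfPlaneTransform ψ) σ with hA
  have hae : (𝓕 ((MemLp.damp hψ h0 hc).toLp (damp (σ + 1 / 2) ψ)) : Lp ℂ 2 volume) =ᵐ[volume]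
      fun w => A (w * (2 * Real.pi)) := by
    have hq : Measure.QuasiMeasurePreserving (fun w : ℝ => w / (2 * Real.pi)⁻¹) volume volume :=
      quasiMeasurePreserving_div (inv_pos.2 two_pi_pos)
    filter_upwards [hq.ae_eq_comp (vertical_halfPlaneTransform_ae hψ h0 hσ hc)] with w hw
    simp only [Function.comp_apply, div_inv_eq_mul] at hw
    rw [hA, hw, mul_div_cancel_right₀ _ two_pi_pos.ne']
  refine (ae_eq_fourierInv_of_integrable _ hae (hi.comp_mul_right' two_pi_pos.ne')).trans
    (Eventually.of_forall fun t => ?_)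
  simp only
  rw [Real.fourierInv_eq']
  have h2 := Measure.integral_comp_mul_right
    (fun ν : ℝ => A ν * Complex.exp ((ν : ℂ) * t * Complex.I)) (2 * Real.pi)
  rw [abs_of_pos (inv_pos.2 two_pi_pos)] at h2
  have h3 : (1 / (2 * (Real.pi : ℂ))) * ∫ ν : ℝ, A ν * Complex.exp ((ν : ℂ) * t * Complex.I) =
      (2 * Real.pi)⁻¹ • ∫ ν : ℝ, A ν * Complex.exp ((ν : ℂ) * t * Complex.I) := by
    rw [Complex.real_smul]; push_cast; ring
  rw [h3, ← h2]
  refine integral_congr_ae (Eventually.of_forall fun w => ?_)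
  simp only [smul_eq_mul]
  rw [mul_comm]
  congr 2
  simp only [RCLike.inner_apply, conj_trivial]
  push_cast; ring

/-! ### Local boundedness of Hardy functions -/

theorem enorm_mul_le_integral_circle {f : ℂ → ℂ} {s : ℂ} {ρ : ℝ} (hρ : 0 < ρ)
    (hf : DiffContOnCl ℂ f (Metric.ball s ρ)) :
    ‖f s‖ₑ * ENNReal.ofReal (2 * Real.pi) ≤
      ∫⁻ θ in Ioo (-Real.pi) Real.pi, ‖f (s + ρ * (Real.cos θ + Real.sin θ * Complex.I))‖ₑ := by
  have h1 := (show DiffContOnCl ℂ f (Metric.ball s |ρ|) by rwa [abs_of_pos hρ]).circleAverage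
  rw [Real.circleAverage_eq_integral_add (η := -Real.pi)] at h1
  have h2 : ∫ θ in (0 : ℝ)..2 * Real.pi, f (circleMap s ρ (θ + -Real.pi)) =
      ∫ θ in Ioo (-Real.pi) Real.pi, f (s + ρ * (Real.cos θ + Real.sin θ * Complex.I)) := by
    rw [intervalIntegral.integral_comp_add_right (fun θ => f (circleMap s ρ θ)), zero_add,
      show 2 * Real.pi + -Real.pi = Real.pi by ring,
      intervalIntegral.integral_of_le (by linarith [Real.pi_pos]), integral_Ioc_eq_integral_Ioo]
    refine integral_congr_ae (Eventually.of_forall fun θ => ?_)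
    simp only [circleMap, Complex.exp_mul_I, Complex.ofReal_cos, Complex.ofReal_sin]
  rw [h2] at h1
  have h3 : ENNReal.ofReal (2 * Real.pi) = ‖(2 * Real.pi : ℝ)‖ₑ := by
    rw [← ofReal_norm, Real.norm_of_nonneg two_pi_pos.le]
  rw [← h1, h3, enorm_smul, mul_comm, ← mul_assoc, ← enorm_mul, mul_inv_cancel₀ two_pi_pos.ne',
    enorm_one, one_mul]
  exact enorm_integral_le_lintegral_enorm _

/-- A sub-mean-value property on discs. -/
theorem enorm_mul_le_lintegral_ball {f : ℂ → ℂ} {s : ℂ} {r : ℝ} (hr : 0 < r)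
    (hf : DifferentiableOn ℂ f (Metric.ball s r)) :
    ‖f s‖ₑ * ENNReal.ofReal (2 * Real.pi) * (ENNReal.ofReal (r / 2) * ENNReal.ofReal (r / 2)) ≤
      ∫⁻ z in Metric.ball s r, ‖f z‖ₑ := by
  let g : ℂ → ℝ≥0∞ := (Metric.ball s r).indicator fun z => ‖f z‖ₑ
  have hg : Measurable g := by
    classical
    have : g = (Metric.ball s r).piecewise (fun z => ‖f z‖ₑ) 0 := (Set.piecewise_eq_indicator).symm
    rw [this]
    exact (hf.continuousOn.enorm).measurable_piecewise continuousOn_const measurableSet_ball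
  have h1 : ∫⁻ z in Metric.ball s r, ‖f z‖ₑ = ∫⁻ z, g (s + z) := by
    rw [lintegral_add_left_eq_self g s, lintegral_indicator measurableSet_ball]
  rw [h1, ← Complex.lintegral_comp_polarCoord_symm, polarCoord_target, Measure.volume_eq_prod,
    ← Measure.prod_restrict, lintegral_prod]
  swap
  · refine Measurable.aemeasurable ?_
    have hm : Measurable fun p : ℝ × ℝ => g (s + Complex.polarCoord.symm p) := by
      refine hg.comp (measurable_const.add ?_)
      have : (fun p : ℝ × ℝ => Complex.polarCoord.symm p) = fun p : ℝ × ℝ =>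
          (p.1 : ℂ) * (Real.cos p.2 + Real.sin p.2 * Complex.I) :=
        funext fun p => Complex.polarCoord_symm_apply p
      change Measurable fun p : ℝ × ℝ => Complex.polarCoord.symm p
      rw [this]
      fun_prop
    exact (ENNReal.measurable_ofReal.comp measurable_fst).mul hm
  -- Only radii in `(r/2, r)` are kept: an interval of length `r/2` on which the polar Jacobian is
  -- at least `r/2`.
  calc ‖f s‖ₑ * ENNReal.ofReal (2 * Real.pi) * (ENNReal.ofReal (r / 2) * ENNReal.ofReal (r / 2))
      = ∫⁻ _ρ in Ioo (r / 2) r,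
          ENNReal.ofReal (r / 2) * (‖f s‖ₑ * ENNReal.ofReal (2 * Real.pi)) := by
        rw [setLIntegral_const, Real.volume_Ioo, show r - r / 2 = r / 2 by ring]; ring
    _ ≤ ∫⁻ ρ in Ioo (r / 2) r, ∫⁻ θ in Ioo (-Real.pi) Real.pi,
          ENNReal.ofReal ρ • g (s + Complex.polarCoord.symm (ρ, θ)) := by
        refine setLIntegral_mono' measurableSet_Ioo fun ρ hρ => ?_
        have hρ0 : 0 < ρ := by have := hρ.1; linarith
        simp only [smul_eq_mul]
        rw [lintegral_const_mul' _ _ ENNReal.ofReal_ne_top]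
        refine mul_le_mul' (ENNReal.ofReal_le_ofReal hρ.1.le) ?_
        refine (enorm_mul_le_integral_circle hρ0 ?_).trans
          (lintegral_mono fun θ => ?_)
        · refine DifferentiableOn.diffContOnCl (hf.mono ?_)
          exact Metric.closure_ball_subset_closedBall.trans (Metric.closedBall_subset_ball hρ.2)
        · rw [Complex.polarCoord_symm_apply]
          have : s + (ρ : ℂ) * (Real.cos θ + Real.sin θ * Complex.I) ∈ Metric.ball s r := by
            rw [Metric.mem_ball, dist_eq_norm, add_sub_cancel_left, norm_mul, Complex.norm_real,
              Real.norm_of_nonneg hρ0.le, Complex.ofReal_cos, Complex.ofReal_sin,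
              Complex.norm_cos_add_sin_mul_I, mul_one]
            exact hρ.2
          simp only [g, indicator_of_mem this]
          exact le_rfl
    _ ≤ _ := by
        refine lintegral_mono_set fun ρ hρ => ?_
        have := hρ.1
        simp only [mem_Ioi]; linarith

/-- Fubini: the disc lies in a vertical strip of width `2r`. -/
theorem lintegral_ball_le_of_vertical {f : ℂ → ℂ} {s : ℂ} {r : ℝ}
    (hf : ContinuousOn f (Metric.ball s r)) {K : ℝ≥0∞}
    (hK : ∀ σ ∈ Ioo (s.re - r) (s.re + r), ∫⁻ ν : ℝ, ‖vertical f σ ν‖ₑ ≤ K) :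
    ∫⁻ z in Metric.ball s r, ‖f z‖ₑ ≤ K * ENNReal.ofReal (2 * r) := by
  let g : ℂ → ℝ≥0∞ := (Metric.ball s r).indicator fun z => ‖f z‖ₑ
  have hg : Measurable g := by
    classical
    have : g = (Metric.ball s r).piecewise (fun z => ‖f z‖ₑ) 0 := (Set.piecewise_eq_indicator).symm
    rw [this]
    exact (hf.enorm).measurable_piecewise continuousOn_const measurableSet_ball
  rw [← lintegral_indicator measurableSet_ball,
    ← (Complex.volume_preserving_equiv_real_prod.symm).lintegral_comp_emb
      Complex.measurableEquivRealProd.symm.measurableEmbedding, Measure.volume_eq_prod,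
    lintegral_prod (fun p => g (Complex.measurableEquivRealProd.symm p))
      (hg.comp Complex.measurableEquivRealProd.symm.measurable).aemeasurable]
  have h1 : ∀ σ : ℝ, (∫⁻ ν : ℝ, g (Complex.measurableEquivRealProd.symm (σ, ν))) ≤
      (Ioo (s.re - r) (s.re + r)).indicator (fun _ => K) σ := by
    intro σ
    by_cases hσ : σ ∈ Ioo (s.re - r) (s.re + r)
    · rw [indicator_of_mem hσ]
      refine le_trans (lintegral_mono fun ν => ?_) (hK σ hσ)
      refine (indicator_le_self _ _ _).trans (le_of_eq ?_)
      simp only [vertical, Complex.measurableEquivRealProd_symm_apply]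
      congr 2
      apply Complex.ext <;> simp
    · rw [indicator_of_notMem hσ, nonpos_iff_eq_zero]
      refine (lintegral_congr fun ν => ?_).trans lintegral_zero
      refine indicator_of_notMem (fun hmem => hσ ?_) _
      rw [Metric.mem_ball, dist_eq_norm] at hmem
      have := (Complex.abs_re_le_norm _).trans_lt hmem
      rw [Complex.sub_re, abs_lt] at this
      simp only [Complex.measurableEquivRealProd_symm_apply] at this
      constructor <;> linarith [this.1, this.2]
  refine (lintegral_mono h1).trans (le_of_eq ?_)
  rw [lintegral_indicator measurableSet_Ioo, setLIntegral_const, Real.volume_Ioo]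
  congr 2; ring

/-- A Hardy function is bounded on smaller half-planes. -/
theorem IsHardyTwo.bounded_of_lt {g : ℂ → ℂ} (hg : IsHardyTwo g) {c : ℝ} (hc : -(1 / 2 : ℝ) < c) :
    ∃ K : ℝ, ∀ s : ℂ, c < s.re → ‖g s‖ ≤ K := by
  obtain ⟨C, hC⟩ := hg.bounded
  set r := c + 1 / 2 with hr
  have hr0 : 0 < r := by rw [hr]; linarith
  set D : ℝ := 2 * Real.pi * (r / 2 * (r / 2)) with hD
  have hD0 : 0 < D := by rw [hD]; positivity
  refine ⟨√((C : ℝ) * (2 * r) / D), fun s hs => Real.le_sqrt_of_sq_le ?_⟩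
  have hsub : Metric.ball s r ⊆ {s : ℂ | -(1 / 2 : ℝ) < s.re} := by
    intro w hw
    rw [Metric.mem_ball, dist_eq_norm] at hw
    have := (Complex.abs_re_le_norm _).trans_lt hw
    rw [Complex.sub_re, abs_lt] at this
    have := this.1
    simp only [mem_ofPred_eq]
    linarith
  -- Passing to the holomorphic function `g²` turns the `L²` bound on lines into the `L¹` bound
  -- required by the sub-mean-value property.
  have hd : DifferentiableOn ℂ (fun z => g z ^ 2) (Metric.ball s r) := (hg.holomorphic.mono hsub).pow 2
  have h1 := (enorm_mul_le_lintegral_ball hr0 hd).trans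
    (lintegral_ball_le_of_vertical (K := C) hd.continuousOn fun σ hσ => by
      refine le_trans (le_of_eq (lintegral_congr fun ν => ?_)) (hC σ ?_)
      · simp only [vertical, enorm_pow]
      · have := hσ.1; linarith)
  have e1 : ‖g s ^ 2‖ₑ * ENNReal.ofReal (2 * Real.pi) *
      (ENNReal.ofReal (r / 2) * ENNReal.ofReal (r / 2)) = ENNReal.ofReal (‖g s‖ ^ 2 * D) := by
    rw [← ofReal_norm, ← ENNReal.ofReal_mul (by positivity), ← ENNReal.ofReal_mul (by positivity),
      ← ENNReal.ofReal_mul (by positivity), norm_pow, hD]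
    congr 1; ring
  have e2 : (C : ℝ≥0∞) * ENNReal.ofReal (2 * r) = ENNReal.ofReal ((C : ℝ) * (2 * r)) := by
    rw [ENNReal.ofReal_mul (p := (C : ℝ)) (by positivity), ENNReal.ofReal_coe_nnreal]
  rw [e1, e2, ENNReal.ofReal_le_ofReal_iff (by positivity)] at h1
  rwa [le_div_iff₀ hD0]

/-! ### Zeros of bounded functions in a half-plane -/

/-- Dividing out a Blaschke factor of the right half-plane. -/
theorem exists_div_blaschke {g : ℂ → ℂ} {δ K b : ℝ} (hδ : 0 < δ)
    (hd : DifferentiableOn ℂ g {z | -δ < z.re}) (hb : ∀ z : ℂ, 0 ≤ z.re → ‖g z‖ ≤ K)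
    (hb0 : 0 < b) (hz : g b = 0) :
    ∃ h : ℂ → ℂ, DifferentiableOn ℂ h {z | -δ < z.re} ∧ (∀ z : ℂ, 0 ≤ z.re → ‖h z‖ ≤ K) ∧
      ∀ z : ℂ, g z * (z + b) = h z * (z - b) := by
  have ho : IsOpen {z : ℂ | -δ < z.re} := isOpen_lt continuous_const Complex.continuous_re
  have hmem : {z : ℂ | -δ < z.re} ∈ 𝓝 (b : ℂ) := ho.mem_nhds (by simp; linarith)
  have hdd : DifferentiableOn ℂ (fun z => dslope g b z * (z + b)) {z | -δ < z.re} :=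
    ((Complex.differentiableOn_dslope hmem).2 hd).mul (by fun_prop)
  have hid : ∀ z : ℂ, g z * (z + b) = (dslope g b z * (z + b)) * (z - b) := by
    intro z
    have := sub_smul_dslope g (b : ℂ) z
    rw [hz, sub_zero, smul_eq_mul] at this
    rw [← this]; ring
  have hK : 0 ≤ K := (norm_nonneg _).trans (hb 0 le_rfl)
  have hfar : ∀ z : ℂ, 0 ≤ z.re → 2 * b ≤ ‖z‖ → ‖dslope g b z * (z + b)‖ ≤ 3 * K := by
    intro z hz0 hzb
    have hbn : ‖(b : ℂ)‖ = b := by rw [Complex.norm_real, Real.norm_of_nonneg hb0.le]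
    have h1 : ‖z‖ - b ≤ ‖z - b‖ := by
      have := norm_sub_norm_le z (b : ℂ)
      rwa [hbn] at this
    have h2 : ‖z + b‖ ≤ ‖z‖ + b := by
      have := norm_add_le z (b : ℂ)
      rwa [hbn] at this
    have h3 : 0 < ‖z - b‖ := by linarith
    have h4 := congrArg norm (hid z)
    rw [norm_mul, norm_mul _ (z - b)] at h4
    have h5 : ‖g z‖ * ‖z + b‖ ≤ K * (3 * ‖z - b‖) :=
      mul_le_mul (hb z hz0) (by linarith) (norm_nonneg _) hK
    rw [h4] at h5
    exact le_of_mul_le_mul_right (by linarith) h3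
  refine ⟨fun z => dslope g b z * (z + b), hdd, fun z hz0 => ?_, hid⟩
  -- The quotient is bounded by `3K` far from `b`, which supplies the growth conditions. On the
  -- imaginary axis `|z - b| = |z + b|`, so the bound `K` of `g` is kept there and propagates
  -- inside.
  refine PhragmenLindelof.right_half_plane_of_bounded_on_real (C := K)
    (f := fun z => dslope g b z * (z + b)) ?_ ⟨1, one_lt_two, 0, ?_⟩ ?_ ?_ hz0
  · refine DifferentiableOn.diffContOnCl (hdd.mono ?_)
    refine (closure_lt_subset_le continuous_const Complex.continuous_re).trans fun w hw => ?_
    have : 0 ≤ w.re := hw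
    simp only [mem_ofPred_eq]; linarith
  · refine Asymptotics.IsBigO.of_bound (3 * K) ?_
    have : ∀ᶠ z : ℂ in Bornology.cobounded ℂ, 2 * b ≤ ‖z‖ :=
      tendsto_norm_cobounded_atTop.eventually_ge_atTop _
    filter_upwards [this.filter_mono inf_le_left, mem_inf_of_right (mem_principal_self _)] with z h1 h2
    simpa using hfar z (le_of_lt h2) h1
  · refine isBoundedUnder_of_eventually_le (a := 3 * K) ?_
    filter_upwards [eventually_ge_atTop (2 * b)] with x hx
    have hx0 : 0 ≤ x := by linarith
    exact hfar x (by simpa using hx0) (by rwa [Complex.norm_real, Real.norm_of_nonneg hx0])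
  · intro y
    have h4 := congrArg norm (hid (y * Complex.I))
    rw [norm_mul, norm_mul _ ((y : ℂ) * Complex.I - b)] at h4
    have h5 : ‖(y : ℂ) * Complex.I - b‖ = ‖(y : ℂ) * Complex.I + b‖ := by
      rw [← sq_eq_sq₀ (norm_nonneg _) (norm_nonneg _), Complex.sq_norm, Complex.sq_norm,
        Complex.normSq_apply, Complex.normSq_apply]
      simp
    have h6 : 0 < ‖(y : ℂ) * Complex.I + b‖ := by
      rw [norm_pos_iff]
      intro h
      have := congrArg Complex.re h
      simp at this; linarith
    rw [h5] at h4
    rw [← mul_right_cancel₀ h6.ne' h4]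
    exact hb _ (by simp)

theorem exists_div_blaschke_prod {g : ℂ → ℂ} {δ K : ℝ} {b : ℕ → ℝ} (hδ : 0 < δ)
    (hd : DifferentiableOn ℂ g {z | -δ < z.re}) (hb : ∀ z : ℂ, 0 ≤ z.re → ‖g z‖ ≤ K)
    (hb0 : ∀ k, 0 < b k) (hinj : Function.Injective b) (hz : ∀ k, g (b k) = 0) (N : ℕ) :
    ∃ h : ℂ → ℂ, DifferentiableOn ℂ h {z | -δ < z.re} ∧ (∀ z : ℂ, 0 ≤ z.re → ‖h z‖ ≤ K) ∧
      (∀ k, N ≤ k → h (b k) = 0) ∧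
      ∀ z : ℂ, g z * ∏ k ∈ Finset.range N, (z + b k) = h z * ∏ k ∈ Finset.range N, (z - b k) := by
  induction N with
  | zero => exact ⟨g, hd, hb, fun k _ => hz k, fun z => by simp⟩
  | succ N ih =>
    obtain ⟨h, h1, h2, h3, h4⟩ := ih
    obtain ⟨h', h1', h2', h3'⟩ := exists_div_blaschke hδ h1 h2 (hb0 N) (h3 N le_rfl)
    refine ⟨h', h1', h2', fun k hk => ?_, fun z => ?_⟩
    · have := h3' (b k)
      rw [h3 k (by omega), zero_mul] at this
      refine (mul_eq_zero.1 this.symm).resolve_right (sub_ne_zero.2 ?_)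
      exact fun e => absurd (hinj (Complex.ofReal_injective e)) (by omega)
    · rw [Finset.prod_range_succ, Finset.prod_range_succ, ← mul_assoc, h4 z, mul_right_comm, h3' z]
      ring

/-- With `N` zeros divided out, `|g(x)| ≤ K ∏ |x - b_k| / (x + b_k)` for `x > 0` and `b_k = k + β`.
The product tends to zero because the harmonic series diverges, and the identity theorem extends `g
= 0` from the positive axis. -/
theorem eq_zero_of_zeros_progression {g : ℂ → ℂ} {δ K β : ℝ} (hδ : 0 < δ) (hβ : 0 < β)
    (hd : DifferentiableOn ℂ g {z | -δ < z.re}) (hb : ∀ z : ℂ, 0 ≤ z.re → ‖g z‖ ≤ K)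
    (hz : ∀ k : ℕ, g ((k + β : ℝ) : ℂ) = 0) : EqOn g 0 {z | -δ < z.re} := by
  have hK : 0 ≤ K := (norm_nonneg _).trans (hb 0 le_rfl)
  have hreal : ∀ x : ℝ, 0 < x → g x = 0 := by
    intro x hx
    set μ := min x β with hμ
    have hμ0 : 0 < μ := lt_min hx hβ
    -- Chosen so that `|x - b_k| / (x + b_k) ≤ 1 - μ / (x + b_k) ≤ 1 - η / (k+1)`, using `x + k + β
    -- ≤ (x + β + 1)(k + 1)`.
    set η := μ / (x + β + 1) with hη
    have hη0 : 0 < η := by positivity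
    have hbound : ∀ N : ℕ, ‖g x‖ ≤
        K * Real.exp (-(η * ∑ k ∈ Finset.range N, 1 / ((k : ℝ) + 1))) := by
      intro N
      obtain ⟨h, -, h2, -, h4⟩ := exists_div_blaschke_prod (b := fun k : ℕ => (k + β : ℝ)) hδ hd hb
        (fun k => by positivity) (fun m n hmn => by simpa using hmn) hz N
      have h5 := congrArg norm (h4 x)
      rw [norm_mul, norm_mul, norm_prod, norm_prod] at h5
      have hP : ∀ k : ℕ, ‖(x : ℂ) + ((k + β : ℝ) : ℂ)‖ = x + (k + β) := by
        intro k
        rw [← Complex.ofReal_add, Complex.norm_real, Real.norm_of_nonneg (by positivity)]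
      have hQ : ∀ k : ℕ, ‖(x : ℂ) - ((k + β : ℝ) : ℂ)‖ ≤
          (x + (k + β)) * Real.exp (-(η * (1 / ((k : ℝ) + 1)))) := by
        intro k
        have hk0 : (0 : ℝ) ≤ k := Nat.cast_nonneg k
        rw [← Complex.ofReal_sub, Complex.norm_real, Real.norm_eq_abs]
        have e1 : η * (1 / ((k : ℝ) + 1)) ≤ μ / (x + (k + β)) := by
          rw [hη, div_mul_div_comm, mul_one]
          refine div_le_div_of_nonneg_left hμ0.le (by positivity) ?_
          nlinarith [mul_nonneg hk0 hx.le, mul_nonneg hk0 hβ.le]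
        have e2 := Real.add_one_le_exp (-(η * (1 / ((k : ℝ) + 1))))
        have e3 : |x - (k + β)| ≤ (x + (k + β)) - μ := by
          rw [abs_le]
          constructor <;> linarith [min_le_left x β, min_le_right x β]
        have hpos : 0 < x + ((k : ℝ) + β) := by positivity
        calc |x - (k + β)| ≤ (x + (k + β)) - μ := e3
          _ = (x + (k + β)) * (1 - μ / (x + (k + β))) := by field_simp
          _ ≤ _ := mul_le_mul_of_nonneg_left (by linarith) hpos.le
      have hPpos : 0 < ∏ k ∈ Finset.range N, (x + ((k : ℝ) + β)) :=
        Finset.prod_pos fun k _ => by positivity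
      simp only [hP] at h5
      have h6 : ∏ k ∈ Finset.range N, ‖(x : ℂ) - ((k + β : ℝ) : ℂ)‖ ≤
          (∏ k ∈ Finset.range N, (x + ((k : ℝ) + β))) *
            Real.exp (-(η * ∑ k ∈ Finset.range N, 1 / ((k : ℝ) + 1))) := by
        refine (Finset.prod_le_prod (fun _ _ => norm_nonneg _) fun k _ => hQ k).trans (le_of_eq ?_)
        rw [Finset.prod_mul_distrib, ← Real.exp_sum, Finset.mul_sum, Finset.sum_neg_distrib]
      have h7 : ‖g x‖ * ∏ k ∈ Finset.range N, (x + ((k : ℝ) + β)) ≤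
          (K * Real.exp (-(η * ∑ k ∈ Finset.range N, 1 / ((k : ℝ) + 1)))) *
            ∏ k ∈ Finset.range N, (x + ((k : ℝ) + β)) := by
        rw [h5]
        refine (mul_le_mul (h2 x (by simpa using hx.le)) h6
          (Finset.prod_nonneg fun _ _ => norm_nonneg _) hK).trans (le_of_eq ?_)
        ring
      exact le_of_mul_le_mul_right h7 hPpos
    have hlim : Tendsto (fun N : ℕ => K * Real.exp
        (-(η * ∑ k ∈ Finset.range N, 1 / ((k : ℝ) + 1)))) atTop (𝓝 (K * 0)) := by
      refine Tendsto.const_mul _ (Real.tendsto_exp_atBot.comp (tendsto_neg_atTop_atBot.comp ?_))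
      exact Real.tendsto_sum_range_one_div_nat_succ_atTop.const_mul_atTop hη0
    rw [mul_zero] at hlim
    exact norm_le_zero_iff.1 (ge_of_tendsto' hlim hbound)
  have ho : IsOpen {z : ℂ | -δ < z.re} := isOpen_lt continuous_const Complex.continuous_re
  have hpc : IsPreconnected {z : ℂ | -δ < z.re} := (convex_halfSpace_re_gt (-δ)).isPreconnected
  refine (hd.analyticOnNhd ho).eqOn_zero_of_preconnected_of_frequently_eq_zero hpc (z₀ := 1)
    (by simp only [mem_ofPred_eq, Complex.one_re]; linarith) ?_
  have ht : Tendsto (fun x : ℝ => (x : ℂ)) (𝓝[>] 1) (𝓝[≠] 1) := by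
    refine tendsto_nhdsWithin_iff.2 ⟨?_, ?_⟩
    · exact (Complex.continuous_ofReal.tendsto' 1 1 (by simp)).mono_left nhdsWithin_le_nhds
    · filter_upwards [self_mem_nhdsWithin] with x hx
      have := (mem_Ioi.1 hx).ne'
      exact fun e => this (Complex.ofReal_injective (by simpa using e))
  refine ht.frequently (Eventually.frequently ?_)
  filter_upwards [self_mem_nhdsWithin] with x hx
  exact hreal x (zero_lt_one.trans hx)

/-- A bounded holomorphic function on a right half-plane which vanishes at the positive integers
is zero. -/
theorem eq_zero_of_zeros_nat {h : ℂ → ℂ} {c K : ℝ} (hc : c < 1)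
    (hd : DifferentiableOn ℂ h {z | c < z.re}) (hb : ∀ z : ℂ, c < z.re → ‖h z‖ ≤ K)
    (hz : ∀ n : ℕ, h ((n : ℂ) + 1) = 0) : EqOn h 0 {z | c < z.re} := by
  -- Translating by a point strictly between `c` and `1` leaves room to the left of the imaginary
  -- axis and moves the zeros `n + 1` to `n + β` with `β = 1 - c' > 0`.
  set c' := (c + 1) / 2 with hc'
  have h1 : c < c' := by rw [hc']; linarith
  have h2 : c' < 1 := by rw [hc']; linarith
  have key := eq_zero_of_zeros_progression (g := fun z => h (z + c')) (δ := c' - c) (β := 1 - c')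
    (K := K) (by linarith) (by linarith) (hd.comp (by fun_prop) fun z hz => by
      have : -(c' - c) < z.re := hz
      simp only [mem_ofPred_eq, Complex.add_re, Complex.ofReal_re]; linarith)
    (fun z hz => hb _ (by simp only [Complex.add_re, Complex.ofReal_re]; linarith))
    (fun k => by
      have := hz k
      convert this using 2
      push_cast; ring)
  intro z hz
  have := key (x := z - c') (by
    have : c < z.re := hz
    simp only [mem_ofPred_eq, Complex.sub_re, Complex.ofReal_re]; linarith)
  simpa using this

/-! ### Uniqueness of the interpolation -/

/-- Carlson's theorem for the Hardy space. -/
theorem IsHardyTwo.eqOn_of_nat {A B : ℂ → ℂ} (hA : IsHardyTwo A) (hB : IsHardyTwo B)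
    (h : ∀ n : ℕ, B n = A n) : EqOn B A {s : ℂ | -(1 / 2 : ℝ) < s.re} := by
  intro s hs
  have hs' : -(1 / 2 : ℝ) < s.re := hs
  set c := min ((s.re - 1 / 2) / 2) 0 with hcdef
  have hc : -(1 / 2 : ℝ) < c := lt_min (by linarith) (by norm_num)
  have hcs : c < s.re := by
    have := min_le_left ((s.re - 1 / 2) / 2) 0
    linarith
  obtain ⟨K, hK⟩ := hA.bounded_of_lt hc
  obtain ⟨L, hL⟩ := hB.bounded_of_lt hc
  have hsub : {z : ℂ | c < z.re} ⊆ {s : ℂ | -(1 / 2 : ℝ) < s.re} := fun z hz => hc.trans hz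
  have := eq_zero_of_zeros_nat (h := fun z => B z - A z) (K := L + K)
    (by have := min_le_right ((s.re - 1 / 2) / 2) 0; linarith)
    ((hB.holomorphic.mono hsub).sub (hA.holomorphic.mono hsub))
    (fun z hz => (norm_sub_le _ _).trans (add_le_add (hL z hz) (hK z hz)))
    (fun n => by
      have := h (n + 1)
      push_cast at this
      rw [this, sub_self]) hcs
  exact sub_eq_zero.1 this

/-- Both boundary functions are the `L²` limit of the same functions on interior lines; the triangle
inequality makes their distance zero. -/
theorem IsHardyTwo.boundary_ae_eq {A B : ℂ → ℂ} (hA : IsHardyTwo A) (hB : IsHardyTwo B)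
    (h : EqOn B A {s : ℂ | -(1 / 2 : ℝ) < s.re}) :
    vertical B (-(1 / 2 : ℝ)) =ᵐ[volume] vertical A (-(1 / 2 : ℝ)) := by
  have hmeas : ∀ {G : ℂ → ℂ}, IsHardyTwo G → ∀ σ : ℝ, -(1 / 2 : ℝ) < σ →
      AEStronglyMeasurable (vertical G σ) volume := by
    intro G hG σ hσ
    refine Continuous.aestronglyMeasurable ?_
    refine hG.holomorphic.continuousOn.comp_continuous (by fun_prop) fun ν => ?_
    simpa using hσ
  have hlim := (hB.boundary_limit.add hA.boundary_limit)
  rw [add_zero] at hlim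
  have hzero : eLpNorm (vertical B (-(1 / 2 : ℝ)) - vertical A (-(1 / 2 : ℝ))) 2 volume ≤ 0 := by
    refine ge_of_tendsto hlim ?_
    filter_upwards [self_mem_nhdsWithin] with σ hσ
    have hσ' : -(1 / 2 : ℝ) < σ := hσ
    have e : vertical B σ = vertical A σ := by
      ext ν
      exact h (by simpa using hσ')
    have e2 : vertical B (-(1 / 2 : ℝ)) - vertical A (-(1 / 2 : ℝ)) =
        -(vertical B σ - vertical B (-(1 / 2 : ℝ))) + (vertical A σ - vertical A (-(1 / 2 : ℝ))) := by
      rw [e]; ring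
    rw [e2]
    refine (eLpNorm_add_le ?_ ?_ (by norm_num)).trans (le_of_eq ?_)
    · exact ((hmeas hB σ hσ').sub hB.boundary_memLp.1).neg
    · exact (hmeas hA σ hσ').sub hA.boundary_memLp.1
    · rw [eLpNorm_neg]
  have := (eLpNorm_eq_zero_iff (hB.boundary_memLp.1.sub hA.boundary_memLp.1) (by norm_num)).1
    (nonpos_iff_eq_zero.1 hzero)
  filter_upwards [this] with ν hν
  exact sub_eq_zero.1 hν

/-! ### Cauchy integrals in the exponential variable -/

theorem exists_pos_le_norm_ofReal_sub {r : ℝ} {z : ℂ}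
    (hz : z ∉ (fun x : ℝ => (x : ℂ)) '' Ici r) :
    ∃ d : ℝ, 0 < d ∧ ∀ x : ℝ, r ≤ x → d ≤ ‖(x : ℂ) - z‖ := by
  have hcl : IsClosed ((fun x : ℝ => (x : ℂ)) '' Ici r) :=
    Complex.isometry_ofReal.isClosedEmbedding.isClosedMap _ isClosed_Ici
  have hpos := (hcl.notMem_iff_infDist_pos ⟨_, mem_image_of_mem _ self_mem_Ici⟩).1 hz
  refine ⟨_, hpos, fun x hx => ?_⟩
  have := Metric.infDist_le_dist_of_mem (x := z) (mem_image_of_mem (fun x : ℝ => (x : ℂ)) hx)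
  rwa [dist_comm, dist_eq_norm] at this

/-- Where `φ ≠ 0`, the quantity `1 + e^t` is at most a constant times `|e^t - w|`, uniformly for `w`
near `z`; so the weight `1/(1 + e^t)` dominates the kernel and, up to a factor, its derivative. -/
theorem differentiableAt_cauchy {φ : ℝ → ℂ} (hm : AEStronglyMeasurable φ volume)
    (hφ : Integrable (fun t => ‖φ t‖ / (1 + Real.exp t))) {z : ℂ} {d : ℝ} (hd : 0 < d)
    (h : ∀ t, φ t ≠ 0 → d ≤ ‖((Real.exp t : ℝ) : ℂ) - z‖) :
    Integrable (fun t => φ t / (((Real.exp t : ℝ) : ℂ) - z)) ∧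
    DifferentiableAt ℂ (fun w => ∫ t, φ t / (((Real.exp t : ℝ) : ℂ) - w)) z := by
  -- From `1 + e^t ≤ 1 + ‖z‖ + |e^t - z|` and `d ≤ |e^t - z|`; the factor `2` is for replacing `z`
  -- by `w` within distance `d/2`.
  set M : ℝ := 2 * ((1 + ‖z‖) / d + 1) with hM
  have hlow : ∀ w ∈ Metric.ball z (d / 2), ∀ t, φ t ≠ 0 → d / 2 ≤ ‖((Real.exp t : ℝ) : ℂ) - w‖ ∧
      1 + Real.exp t ≤ M * ‖((Real.exp t : ℝ) : ℂ) - w‖ := by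
    intro w hw t ht
    have h1 := h t ht
    have h2 : ‖w - z‖ < d / 2 := by simpa [dist_eq_norm] using hw
    have h3 : ‖((Real.exp t : ℝ) : ℂ) - z‖ ≤ ‖((Real.exp t : ℝ) : ℂ) - w‖ + ‖w - z‖ := by
      simpa using norm_add_le (((Real.exp t : ℝ) : ℂ) - w) (w - z)
    have h4 : Real.exp t ≤ ‖((Real.exp t : ℝ) : ℂ) - z‖ + ‖z‖ := by
      have := norm_add_le (((Real.exp t : ℝ) : ℂ) - z) z
      rwa [sub_add_cancel, Complex.norm_real, Real.norm_of_nonneg (Real.exp_pos t).le] at this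
    refine ⟨by linarith, ?_⟩
    have h5 : 1 + ‖z‖ ≤ (1 + ‖z‖) / d * ‖((Real.exp t : ℝ) : ℂ) - z‖ := by
      calc 1 + ‖z‖ = (1 + ‖z‖) / d * d := by field_simp
        _ ≤ _ := mul_le_mul_of_nonneg_left h1 (by positivity)
    calc 1 + Real.exp t ≤ ((1 + ‖z‖) / d + 1) * ‖((Real.exp t : ℝ) : ℂ) - z‖ := by
          rw [add_mul, one_mul]; linarith
      _ ≤ ((1 + ‖z‖) / d + 1) * (2 * ‖((Real.exp t : ℝ) : ℂ) - w‖) :=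
          mul_le_mul_of_nonneg_left (by linarith) (by positivity)
      _ = _ := by rw [hM]; ring
  have hden : ∀ w, Continuous fun t : ℝ => ((Real.exp t : ℝ) : ℂ) - w := fun w => by fun_prop
  have hmeas : ∀ w, AEStronglyMeasurable (fun t => φ t / (((Real.exp t : ℝ) : ℂ) - w)) volume :=
    fun w => (hm.aemeasurable.div (hden w).measurable.aemeasurable).aestronglyMeasurable
  have hbd : ∀ w ∈ Metric.ball z (d / 2), ∀ t,
      ‖φ t / (((Real.exp t : ℝ) : ℂ) - w)‖ ≤ M * (‖φ t‖ / (1 + Real.exp t)) := by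
    intro w hw t
    by_cases ht : φ t = 0
    · simp [ht]
    obtain ⟨h1, h2⟩ := hlow w hw t ht
    have h3 : 0 < ‖((Real.exp t : ℝ) : ℂ) - w‖ := by linarith
    rw [norm_div, mul_div_assoc', div_le_div_iff₀ h3 (by positivity)]
    calc ‖φ t‖ * (1 + Real.exp t) ≤ ‖φ t‖ * (M * ‖((Real.exp t : ℝ) : ℂ) - w‖) :=
          mul_le_mul_of_nonneg_left h2 (norm_nonneg _)
      _ = _ := by ring
  have hz : z ∈ Metric.ball z (d / 2) := Metric.mem_ball_self (by positivity)
  have hint : Integrable (fun t => φ t / (((Real.exp t : ℝ) : ℂ) - z)) :=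
    (hφ.const_mul M).mono' (hmeas z) (Eventually.of_forall (hbd z hz))
  refine ⟨hint, (hasDerivAt_integral_of_dominated_loc_of_deriv_le
    (Metric.ball_mem_nhds z (half_pos hd))
    (F := fun w t => φ t / (((Real.exp t : ℝ) : ℂ) - w))
    (F' := fun w t => φ t / (((Real.exp t : ℝ) : ℂ) - w) / (((Real.exp t : ℝ) : ℂ) - w))
    (bound := fun t => M * (‖φ t‖ / (1 + Real.exp t)) * (2 / d))
    (Eventually.of_forall hmeas) hint
    ((hmeas z).aemeasurable.div (hden z).measurable.aemeasurable).aestronglyMeasurable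
    (Eventually.of_forall fun t w hw => ?_) ((hφ.const_mul M).mul_const _)
    (Eventually.of_forall fun t w hw => ?_)).2.differentiableAt⟩
  · by_cases ht : φ t = 0
    · simp [ht]
    obtain ⟨h1, -⟩ := hlow w hw t ht
    have h3 : 0 < ‖((Real.exp t : ℝ) : ℂ) - w‖ := by linarith
    rw [norm_div, div_eq_mul_inv]
    refine mul_le_mul (hbd w hw t) ?_ (by positivity) ((norm_nonneg _).trans (hbd w hw t))
    rw [show 2 / d = (d / 2)⁻¹ by rw [inv_div]]
    exact inv_anti₀ (by positivity) h1
  · by_cases ht : φ t = 0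
    · simp only [ht, zero_div]; exact hasDerivAt_const _ _
    obtain ⟨h1, -⟩ := hlow w hw t ht
    have h3 : ((Real.exp t : ℝ) : ℂ) - w ≠ 0 := by
      rw [← norm_pos_iff]; linarith
    have := ((hasDerivAt_const w (φ t)).div ((hasDerivAt_id w).const_sub ((Real.exp t : ℝ) : ℂ)) h3)
    refine this.congr_deriv ?_
    simp only [id]
    field_simp
    ring

/-! ### The Mellin transform of the Cauchy kernel -/

/-- The substitution `x = e^t/(1 + e^t)`, the sigmoid, identifies the integral with the Beta
integral `B(s, 1-s) = Γ(s) Γ(1-s)`; the reflection formula evaluates it. -/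
theorem integral_exp_mul_div_one_add_exp {s : ℂ} (hs0 : 0 < s.re) (hs1 : s.re < 1) :
    ∫ t : ℝ, Complex.exp (s * t) / (((Real.exp t : ℝ) : ℂ) + 1) =
      Real.pi / Complex.sin (Real.pi * s) := by
  have h1 : 0 < (1 - s).re := by simp; linarith
  have hB := Complex.Gamma_mul_Gamma_eq_betaIntegral hs0 h1
  rw [add_sub_cancel, Complex.Gamma_one, one_mul, Complex.Gamma_mul_Gamma_one_sub] at hB
  rw [hB, Complex.betaIntegral, intervalIntegral.integral_of_le zero_le_one,
    integral_Ioc_eq_integral_Ioo, ← Real.range_sigmoid, ← image_univ,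
    integral_image_eq_integral_abs_deriv_smul MeasurableSet.univ
      (fun t _ => (Real.hasDerivAt_sigmoid t).hasDerivWithinAt) Real.sigmoid_injective.injOn,
    setIntegral_univ]
  refine integral_congr_ae (Eventually.of_forall fun t => ?_)
  have hp := Real.sigmoid_pos t
  have hq : 0 < 1 - Real.sigmoid t := by have := Real.sigmoid_lt_one t; linarith
  have e0 : Real.exp t * (1 - Real.sigmoid t) = Real.sigmoid t := by
    rw [Real.sigmoid_def, Real.exp_neg]
    have := Real.exp_pos t
    field_simp
    ring
  have e1 : (1 - Real.sigmoid t) * (Real.exp t + 1) = 1 := by linarith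
  simp only
  rw [abs_of_pos (mul_pos hp hq), Complex.real_smul]
  have c1 : (1 - (Real.sigmoid t : ℂ)) = ((1 - Real.sigmoid t : ℝ) : ℂ) := by push_cast; ring
  have hpc : (Real.sigmoid t : ℂ) ≠ 0 := by exact_mod_cast hp.ne'
  have hqc : ((1 - Real.sigmoid t : ℝ) : ℂ) ≠ 0 := by exact_mod_cast hq.ne'
  have hlog : Real.log (Real.sigmoid t) = t + Real.log (1 - Real.sigmoid t) := by
    conv_lhs => rw [← e0]
    rw [Real.log_mul (Real.exp_pos t).ne' hq.ne', Real.log_exp]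
  have e2 : (Real.sigmoid t : ℂ) ^ (s - 1) * ((1 - Real.sigmoid t : ℝ) : ℂ) ^ (1 - s - 1) *
      ((Real.sigmoid t : ℂ) * ((1 - Real.sigmoid t : ℝ) : ℂ)) =
      Complex.exp (s * t) * ((1 - Real.sigmoid t : ℝ) : ℂ) := by
    have a1 : (Real.sigmoid t : ℂ) ^ (s - 1) * (Real.sigmoid t : ℂ) =
        Complex.exp (s * (Real.log (Real.sigmoid t) : ℝ)) := by
      rw [Complex.cpow_sub _ _ hpc, Complex.cpow_one, div_mul_cancel₀ _ hpc,
        Complex.cpow_def_of_ne_zero hpc, ← Complex.ofReal_log hp.le, mul_comm]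
    have a2 : ((1 - Real.sigmoid t : ℝ) : ℂ) ^ (1 - s - 1) =
        Complex.exp (-s * (Real.log (1 - Real.sigmoid t) : ℝ)) := by
      rw [Complex.cpow_def_of_ne_zero hqc, ← Complex.ofReal_log hq.le, mul_comm]
      congr 1; ring
    calc _ = ((Real.sigmoid t : ℂ) ^ (s - 1) * (Real.sigmoid t : ℂ)) *
          ((1 - Real.sigmoid t : ℝ) : ℂ) ^ (1 - s - 1) * ((1 - Real.sigmoid t : ℝ) : ℂ) := by ring
      _ = _ := by
        rw [a1, a2, ← Complex.exp_add, hlog]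
        congr 2
        push_cast; ring
  rw [c1, Complex.ofReal_mul, mul_comm ((Real.sigmoid t : ℂ) * _), e2]
  have e3 : ((1 - Real.sigmoid t : ℝ) : ℂ) * (((Real.exp t : ℝ) : ℂ) + 1) = 1 := by exact_mod_cast e1
  have e4 : (((Real.exp t : ℝ) : ℂ) + 1) ≠ 0 := right_ne_zero_of_mul_eq_one e3
  rw [div_eq_iff e4, mul_assoc, e3, mul_one]

theorem integrable_exp_half_div : Integrable (fun t : ℝ => Real.exp (t / 2) / (1 + Real.exp t)) := by
  have hc : Continuous fun t : ℝ => Real.exp (t / 2) / (1 + Real.exp t) :=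
    (by fun_prop : Continuous fun t : ℝ => Real.exp (t / 2)).div (by fun_prop)
      fun t => by positivity
  rw [← integrableOn_univ, ← Iic_union_Ioi (a := (0 : ℝ)), integrableOn_union]
  have hpos := fun t => Real.exp_pos t
  constructor
  · refine Integrable.mono' (integrableOn_exp_mul_Iic (a := 1 / 2) (by norm_num) 0)
      hc.aestronglyMeasurable (Eventually.of_forall fun t => ?_)
    rw [Real.norm_of_nonneg (by positivity), show (1 / 2 : ℝ) * t = t / 2 by ring]
    exact div_le_self (hpos _).le (by linarith [hpos t])
  · refine Integrable.mono' (integrableOn_exp_mul_Ioi (a := -(1 / 2)) (by norm_num) 0)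
      hc.aestronglyMeasurable (Eventually.of_forall fun t => ?_)
    rw [Real.norm_of_nonneg (by positivity), div_le_iff₀ (by positivity), mul_add, ← Real.exp_add,
      show -(1 / 2 : ℝ) * t + t = t / 2 by ring]
    linarith [hpos (-(1 / 2 : ℝ) * t)]

/-- The kernel `e^{(1/2+iν)t}`. -/
noncomputable def mellinKernel (ν t : ℝ) : ℂ := Complex.exp ((1 / 2 + (ν : ℂ) * Complex.I) * t)

theorem norm_mellinKernel (ν t : ℝ) : ‖mellinKernel ν t‖ = Real.exp (t / 2) := by
  rw [mellinKernel, Complex.norm_exp]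
  congr 1
  simp
  ring

theorem neg_notMem_of_mem_slitPlane {w : ℂ} (hw : w ∈ Complex.slitPlane) :
    -w ∉ (fun x : ℝ => (x : ℂ)) '' Ici 0 := by
  rintro ⟨x, hx, hxw⟩
  have e : w = ((-x : ℝ) : ℂ) := by
    have : (x : ℂ) = -w := hxw
    push_cast; rw [this, neg_neg]
  rw [e, Complex.ofReal_mem_slitPlane] at hw
  have := mem_Ici.1 hx
  linarith

theorem differentiableAt_integral_mellinKernel (ν : ℝ) {w : ℂ} (hw : w ∈ Complex.slitPlane) :
    Integrable (fun t => mellinKernel ν t / (((Real.exp t : ℝ) : ℂ) - -w)) ∧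
    DifferentiableAt ℂ (fun z => ∫ t, mellinKernel ν t / (((Real.exp t : ℝ) : ℂ) - z)) (-w) := by
  obtain ⟨d, hd, h⟩ := exists_pos_le_norm_ofReal_sub (neg_notMem_of_mem_slitPlane hw)
  refine differentiableAt_cauchy ?_ ?_ hd fun t _ => h _ (Real.exp_pos t).le
  · exact (by unfold mellinKernel; fun_prop : Continuous (mellinKernel ν)).aestronglyMeasurable
  · simp only [norm_mellinKernel]
    exact integrable_exp_half_div

/-- For real `w > 0` a translation of `t` by `log w` reduces to the sine integral at `s = 1/2 + iν`,
where `sin πs = cosh πν`. Both sides are analytic on the slit plane, so the identity persists there.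
-/
theorem integral_mellinKernel_div (ν : ℝ) {w : ℂ} (hw : w ∈ Complex.slitPlane) :
    ∫ t, mellinKernel ν t / (((Real.exp t : ℝ) : ℂ) + w) =
      Complex.exp ((-(1 / 2) + (ν : ℂ) * Complex.I) * Complex.log w) *
        (Real.pi / Complex.cosh (Real.pi * ν)) := by
  have hreal : ∀ x : ℝ, 0 < x → ∫ t, mellinKernel ν t / (((Real.exp t : ℝ) : ℂ) + (x : ℂ)) =
      Complex.exp ((-(1 / 2) + (ν : ℂ) * Complex.I) * Complex.log (x : ℂ)) *
        (Real.pi / Complex.cosh (Real.pi * ν)) := by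
    intro x hx
    have hb := integral_exp_mul_div_one_add_exp (s := 1 / 2 + (ν : ℂ) * Complex.I)
      (by simp) (by simp; norm_num)
    have hsin : Complex.sin (Real.pi * (1 / 2 + (ν : ℂ) * Complex.I)) =
        Complex.cosh (Real.pi * ν) := by
      rw [mul_add, show (Real.pi : ℂ) * (1 / 2) = Real.pi / 2 by ring, add_comm,
        Complex.sin_add_pi_div_two, ← mul_assoc, Complex.cos_mul_I]
    rw [hsin] at hb
    rw [← hb, ← integral_add_right_eq_self _ (Real.log x), ← integral_const_mul]
    refine integral_congr_ae (Eventually.of_forall fun t => ?_)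
    simp only [mellinKernel]
    have hxc : (x : ℂ) ≠ 0 := by exact_mod_cast hx.ne'
    have hne : (((Real.exp t : ℝ) : ℂ) + 1) ≠ 0 := by
      have : Real.exp t + 1 ≠ 0 := by positivity
      exact_mod_cast this
    rw [Real.exp_add, Real.exp_log hx, ← Complex.ofReal_log hx.le]
    have e1 : Complex.exp ((1 / 2 + (ν : ℂ) * Complex.I) * ((t + Real.log x : ℝ) : ℂ)) =
        Complex.exp ((-(1 / 2) + (ν : ℂ) * Complex.I) * (Real.log x : ℂ)) * x *
          Complex.exp ((1 / 2 + (ν : ℂ) * Complex.I) * t) := by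
      have : (x : ℂ) = Complex.exp (Real.log x : ℂ) := by
        rw [← Complex.ofReal_exp, Real.exp_log hx]
      conv_rhs => rw [this, ← Complex.exp_add, ← Complex.exp_add]
      congr 1
      push_cast; ring
    rw [e1, Complex.ofReal_mul]
    field_simp
  have hL : AnalyticOnNhd ℂ (fun w => ∫ t, mellinKernel ν t / (((Real.exp t : ℝ) : ℂ) + w))
      Complex.slitPlane := by
    refine DifferentiableOn.analyticOnNhd (fun w hw => ?_) Complex.isOpen_slitPlane
    have h1 := (differentiableAt_integral_mellinKernel ν hw).2
    have h2 : DifferentiableAt ℂ (fun w : ℂ => -w) w := by fun_prop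
    have h3 := DifferentiableAt.comp w h1 h2
    simp only [Function.comp_def, sub_neg_eq_add] at h3
    exact h3.differentiableWithinAt
  have hR : AnalyticOnNhd ℂ (fun w =>
      Complex.exp ((-(1 / 2) + (ν : ℂ) * Complex.I) * Complex.log w) *
        (Real.pi / Complex.cosh (Real.pi * ν))) Complex.slitPlane := by
    refine DifferentiableOn.analyticOnNhd (fun w hw => ?_) Complex.isOpen_slitPlane
    exact (((DifferentiableAt.const_mul (Complex.differentiableAt_log hw) _).cexp).mul_const
      _).differentiableWithinAt
  refine hL.eqOn_of_preconnected_of_frequently_eq hR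
    (Complex.starConvex_one_slitPlane.isPathConnected
      Complex.one_mem_slitPlane).isConnected.isPreconnected Complex.one_mem_slitPlane ?_ hw
  have ht : Tendsto (fun x : ℝ => (x : ℂ)) (𝓝[>] 1) (𝓝[≠] 1) := by
    refine tendsto_nhdsWithin_iff.2 ⟨?_, ?_⟩
    · exact (Complex.continuous_ofReal.tendsto' 1 1 (by simp)).mono_left nhdsWithin_le_nhds
    · filter_upwards [self_mem_nhdsWithin] with x hx
      have := (mem_Ioi.1 hx).ne'
      exact fun e => this (Complex.ofReal_injective (by simpa using e))
  refine ht.frequently (Eventually.frequently ?_)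
  filter_upwards [self_mem_nhdsWithin] with x hx
  exact hreal x (zero_lt_one.trans hx)

/-! ### The boundary values of the Cauchy integral -/

/-- The Fourier integral `(1/2π) ∫ A(ν) e^{iνt} dν`. -/
noncomputable def invFourier (A : ℝ → ℂ) (t : ℝ) : ℂ :=
  (1 / (2 * (Real.pi : ℂ))) * ∫ ν : ℝ, A ν * Complex.exp ((ν : ℂ) * t * Complex.I)

theorem norm_cexp_mul_I (ν t : ℝ) : ‖Complex.exp ((ν : ℂ) * t * Complex.I)‖ = 1 := by
  rw [← Complex.ofReal_mul, Complex.norm_exp_ofReal_mul_I]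

theorem continuous_invFourier {A : ℝ → ℂ} (hA : Integrable A) : Continuous (invFourier A) := by
  refine continuous_const.mul ?_
  refine continuous_of_dominated (bound := fun ν => ‖A ν‖) (fun t => ?_) (fun t => ?_) hA.norm ?_
  · exact hA.1.mul (by fun_prop : Continuous fun ν : ℝ =>
      Complex.exp ((ν : ℂ) * t * Complex.I)).aestronglyMeasurable
  · exact Eventually.of_forall fun ν => by rw [norm_mul, norm_cexp_mul_I, mul_one]
  · exact Eventually.of_forall fun ν => by fun_prop

theorem norm_invFourier_le (A : ℝ → ℂ) (t : ℝ) :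
    ‖invFourier A t‖ ≤ 1 / (2 * Real.pi) * ∫ ν, ‖A ν‖ := by
  rw [invFourier, norm_mul]
  have h1 : ‖(1 / (2 * (Real.pi : ℂ)))‖ = 1 / (2 * Real.pi) := by
    rw [show (1 / (2 * (Real.pi : ℂ))) = ((1 / (2 * Real.pi) : ℝ) : ℂ) by push_cast; rfl,
      Complex.norm_real, Real.norm_of_nonneg (by positivity)]
  rw [h1]
  refine mul_le_mul_of_nonneg_left ((norm_integral_le_integral_norm _).trans (le_of_eq ?_))
    (by positivity)
  refine integral_congr_ae (Eventually.of_forall fun ν => ?_)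
  simp only [norm_mul, norm_cexp_mul_I, mul_one]

/-- The Cauchy integral `∫ Φ(t) e^{t/2} / (e^t - z) dt`, that is `∫ F(x) / (x - z) dx` for
`F(x) = Φ(log x) x^{-1/2}`. -/
noncomputable def cauchyExp (Φ : ℝ → ℂ) (z : ℂ) : ℂ :=
  ∫ t : ℝ, Φ t * ((Real.exp (t / 2) : ℝ) : ℂ) / (((Real.exp t : ℝ) : ℂ) - z)

/-- Fubini and the Mellin transform of the Cauchy kernel. The gain is that `z` now enters only
through `log (-z)`, whose behaviour at the cut is explicit. The constant is `(1/2π) · π`. -/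
theorem cauchyExp_invFourier {A : ℝ → ℂ} (hA : Integrable A) {z : ℂ}
    (hz : -z ∈ Complex.slitPlane) :
    cauchyExp (invFourier A) z = (1 / 2 : ℂ) * ∫ ν : ℝ, A ν *
      (Complex.exp ((-(1 / 2) + (ν : ℂ) * Complex.I) * Complex.log (-z)) /
        Complex.cosh (Real.pi * ν)) := by
  have hpi : (Real.pi : ℂ) ≠ 0 := by exact_mod_cast Real.pi_ne_zero
  have hint0 := (differentiableAt_integral_mellinKernel 0 hz).1
  rw [neg_neg] at hint0
  have hk : ∀ ν t : ℝ, mellinKernel ν t =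
      mellinKernel 0 t * Complex.exp ((ν : ℂ) * t * Complex.I) := by
    intro ν t
    rw [mellinKernel, mellinKernel, ← Complex.exp_add]
    congr 1; push_cast; ring
  have h0 : ∀ t : ℝ, ((Real.exp (t / 2) : ℝ) : ℂ) = mellinKernel 0 t := by
    intro t
    rw [mellinKernel, Complex.ofReal_exp]
    congr 1; push_cast; ring
  have hprod : Integrable (Function.uncurry fun (t ν : ℝ) =>
      (mellinKernel 0 t / (((Real.exp t : ℝ) : ℂ) - z)) *
        (A ν * Complex.exp ((ν : ℂ) * t * Complex.I))) (volume.prod volume) := by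
    have h1 := hint0.mul_prod hA
    have h2 : Continuous fun p : ℝ × ℝ => Complex.exp ((p.2 : ℂ) * p.1 * Complex.I) := by fun_prop
    refine (h1.norm).mono' ?_ (Eventually.of_forall fun p => ?_)
    · refine (h1.1.mul h2.aestronglyMeasurable).congr (Eventually.of_forall fun p => ?_)
      simp only [Function.uncurry, Pi.mul_apply]; ring
    · simp only [Function.uncurry]
      rw [norm_mul, norm_mul (A p.2), norm_cexp_mul_I, mul_one, norm_mul]
  have hswap := integral_integral_swap hprod
  have e1 : cauchyExp (invFourier A) z = (1 / (2 * (Real.pi : ℂ))) * ∫ t : ℝ, ∫ ν : ℝ,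
      (mellinKernel 0 t / (((Real.exp t : ℝ) : ℂ) - z)) *
        (A ν * Complex.exp ((ν : ℂ) * t * Complex.I)) := by
    rw [cauchyExp, ← integral_const_mul]
    refine integral_congr_ae (Eventually.of_forall fun t => ?_)
    simp only
    rw [integral_const_mul, invFourier, h0]
    ring
  rw [e1, hswap, ← integral_const_mul, ← integral_const_mul]
  refine integral_congr_ae (Eventually.of_forall fun ν => ?_)
  simp only
  have e2 : ∫ t : ℝ, (mellinKernel 0 t / (((Real.exp t : ℝ) : ℂ) - z)) *
        (A ν * Complex.exp ((ν : ℂ) * t * Complex.I)) =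
      A ν * ∫ t : ℝ, mellinKernel ν t / (((Real.exp t : ℝ) : ℂ) + -z) := by
    rw [← integral_const_mul]
    refine integral_congr_ae (Eventually.of_forall fun t => ?_)
    simp only
    rw [hk ν t, ← sub_eq_add_neg]; ring
  rw [e2, integral_mellinKernel_div ν hz]
  field_simp

theorem cosh_pi_mul_ne_zero (ν : ℝ) : Complex.cosh (Real.pi * ν) ≠ 0 := by
  have := (Real.cosh_pos (Real.pi * ν)).ne'
  rw [show Complex.cosh (Real.pi * ν) = ((Real.cosh (Real.pi * ν) : ℝ) : ℂ) by push_cast; rfl]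
  exact_mod_cast this

/-- The exponential grows at most like `e^{|ν| |Im L|}`, hence at most like `e^{π|ν|} ≤ 2 cosh(πν)`.
At the cut `|Im L| = π`: this bound then leaves no decay in `ν`, and domination rests on the
integrability of `A`. -/
theorem norm_watson_le (ν : ℝ) {L : ℂ} (hL : |L.im| ≤ Real.pi) :
    ‖Complex.exp ((-(1 / 2) + (ν : ℂ) * Complex.I) * L) / Complex.cosh (Real.pi * ν)‖ ≤
      2 * Real.exp (L.re * (-(1 / 2))) := by
  have hc : Complex.cosh (Real.pi * ν) = ((Real.cosh (Real.pi * ν) : ℝ) : ℂ) := by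
    push_cast; rfl
  rw [norm_div, Complex.norm_exp, hc, Complex.norm_real,
    Real.norm_of_nonneg (Real.cosh_pos _).le, div_le_iff₀ (Real.cosh_pos _)]
  have e1 : ((-(1 / 2) + (ν : ℂ) * Complex.I) * L).re = -(1 / 2) * L.re - ν * L.im := by
    rw [Complex.mul_re]
    simp
  have e2 : -(1 / 2) * L.re - ν * L.im ≤ L.re * (-(1 / 2)) + |Real.pi * ν| := by
    have h1 : |ν * L.im| ≤ |Real.pi * ν| := by
      rw [abs_mul, abs_mul, abs_of_pos Real.pi_pos, mul_comm]
      exact mul_le_mul_of_nonneg_right hL (abs_nonneg _)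
    have := neg_abs_le (ν * L.im)
    linarith
  have e3 : Real.exp |Real.pi * ν| ≤ 2 * Real.cosh (Real.pi * ν) := by
    rw [← Real.cosh_abs, Real.cosh_eq]
    linarith [Real.exp_pos (-|Real.pi * ν|)]
  rw [e1]
  calc Real.exp (-(1 / 2) * L.re - ν * L.im)
      ≤ Real.exp (L.re * (-(1 / 2)) + |Real.pi * ν|) := Real.exp_le_exp.2 e2
    _ = Real.exp (L.re * (-(1 / 2))) * Real.exp |Real.pi * ν| := Real.exp_add _ _
    _ ≤ Real.exp (L.re * (-(1 / 2))) * (2 * Real.cosh (Real.pi * ν)) :=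
        mul_le_mul_of_nonneg_left e3 (Real.exp_pos _).le
    _ = _ := by ring

/-- Boundary limits of the Cauchy integral along a filter on which `log (-z)` converges. -/
theorem tendsto_cauchyExp_invFourier {A : ℝ → ℂ} (hA : Integrable A) {x : ℝ} (hx : 0 < x)
    {l : Filter ℂ} [l.IsCountablyGenerated] (hl : l ≤ 𝓝 (x : ℂ))
    (him : ∀ᶠ z in l, -z ∈ Complex.slitPlane) {L : ℂ}
    (hL : Tendsto (fun z => Complex.log (-z)) l (𝓝 L)) :
    Tendsto (cauchyExp (invFourier A)) l (𝓝 ((1 / 2 : ℂ) * ∫ ν : ℝ, A ν *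
      (Complex.exp ((-(1 / 2) + (ν : ℂ) * Complex.I) * L) / Complex.cosh (Real.pi * ν)))) := by
  have hev : (fun z => (1 / 2 : ℂ) * ∫ ν : ℝ, A ν *
      (Complex.exp ((-(1 / 2) + (ν : ℂ) * Complex.I) * Complex.log (-z)) /
        Complex.cosh (Real.pi * ν))) =ᶠ[l] cauchyExp (invFourier A) := by
    filter_upwards [him] with z hz
    exact (cauchyExp_invFourier hA hz).symm
  refine Tendsto.congr' hev (Tendsto.const_mul _ ?_)
  refine tendsto_integral_filter_of_dominated_convergence
    (fun ν => ‖A ν‖ * (2 * Real.exp (Real.log (x / 2) * (-(1 / 2))))) ?_ ?_ (hA.norm.mul_const _) ?_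
  · refine Eventually.of_forall fun z => hA.1.mul (Continuous.aestronglyMeasurable ?_)
    exact (by fun_prop : Continuous fun ν : ℝ =>
      Complex.exp ((-(1 / 2) + (ν : ℂ) * Complex.I) * Complex.log (-z))).div (by fun_prop) cosh_pi_mul_ne_zero
  · have hnear : ∀ᶠ z in l, x / 2 < ‖z‖ := by
      have : Tendsto (fun z : ℂ => ‖z‖) l (𝓝 ‖(x : ℂ)‖) := (continuous_norm.tendsto _).mono_left hl
      rw [Complex.norm_real, Real.norm_of_nonneg hx.le] at this
      exact this.eventually_const_lt (by linarith)
    filter_upwards [hnear] with z hz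
    refine Eventually.of_forall fun ν => ?_
    rw [norm_mul]
    refine mul_le_mul_of_nonneg_left ?_ (norm_nonneg _)
    refine (norm_watson_le ν (by rw [Complex.log_im]; exact Complex.abs_arg_le_pi _)).trans ?_
    rw [Complex.log_re, norm_neg]
    refine mul_le_mul_of_nonneg_left (Real.exp_le_exp.2 ?_) (by norm_num)
    have := Real.log_le_log (by positivity) hz.le
    linarith
  · refine Eventually.of_forall fun ν => Tendsto.const_mul _ (Tendsto.div_const ?_ _)
    exact (Complex.continuous_exp.tendsto _).comp (hL.const_mul _)

/-- The Cauchy integral has limits from both sides of the cut, and its jump is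
`2πi Φ(log x) x^{-1/2}`. -/
theorem exists_tendsto_cauchyExp_invFourier {A : ℝ → ℂ} (hA : Integrable A) {x : ℝ} (hx : 0 < x) :
    ∃ gp gm : ℂ, Tendsto (cauchyExp (invFourier A)) (𝓝[{z : ℂ | 0 < z.im}] (x : ℂ)) (𝓝 gp) ∧
      Tendsto (cauchyExp (invFourier A)) (𝓝[{z : ℂ | z.im < 0}] (x : ℂ)) (𝓝 gm) ∧
      gp - gm = 2 * Real.pi * Complex.I *
        (invFourier A (Real.log x) * ((Real.exp (-(Real.log x / 2)) : ℝ) : ℂ)) := by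
  have hre : (-(x : ℂ)).re < 0 := by simpa using hx
  have him0 : (-(x : ℂ)).im = 0 := by simp
  have hnorm : ‖-(x : ℂ)‖ = x := by rw [norm_neg, Complex.norm_real, Real.norm_of_nonneg hx.le]
  have hneg : Tendsto (fun z : ℂ => -z) (𝓝 (x : ℂ)) (𝓝 (-(x : ℂ))) := continuous_neg.tendsto _
  -- As `z` approaches `x` from above, `-z` approaches `-x` from below, which gives the argument
  -- `-π`.
  have hLp : Tendsto (fun z : ℂ => Complex.log (-z)) (𝓝[{z : ℂ | 0 < z.im}] (x : ℂ))
      (𝓝 (Real.log x - Real.pi * Complex.I)) := by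
    have h1 := Complex.tendsto_log_nhdsWithin_im_neg_of_re_neg_of_im_zero hre him0
    rw [hnorm] at h1
    refine h1.comp (tendsto_nhdsWithin_iff.2 ⟨hneg.mono_left nhdsWithin_le_nhds, ?_⟩)
    filter_upwards [self_mem_nhdsWithin] with z hz
    have : 0 < z.im := hz
    simpa using this
  have hLm : Tendsto (fun z : ℂ => Complex.log (-z)) (𝓝[{z : ℂ | z.im < 0}] (x : ℂ))
      (𝓝 (Real.log x + Real.pi * Complex.I)) := by
    have h1 := Complex.tendsto_log_nhdsWithin_im_nonneg_of_re_neg_of_im_zero hre him0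
    rw [hnorm] at h1
    refine h1.comp (tendsto_nhdsWithin_iff.2 ⟨hneg.mono_left nhdsWithin_le_nhds, ?_⟩)
    filter_upwards [self_mem_nhdsWithin] with z hz
    have : z.im < 0 := hz
    simpa using this.le
  have hsp : ∀ᶠ z in 𝓝[{z : ℂ | 0 < z.im}] (x : ℂ), -z ∈ Complex.slitPlane := by
    filter_upwards [self_mem_nhdsWithin] with z hz
    have : 0 < z.im := hz
    exact Or.inr (by simpa using this.ne')
  have hsm : ∀ᶠ z in 𝓝[{z : ℂ | z.im < 0}] (x : ℂ), -z ∈ Complex.slitPlane := by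
    filter_upwards [self_mem_nhdsWithin] with z hz
    have : z.im < 0 := hz
    exact Or.inr (by simpa using this.ne)
  refine ⟨_, _, tendsto_cauchyExp_invFourier hA hx nhdsWithin_le_nhds hsp hLp,
    tendsto_cauchyExp_invFourier hA hx nhdsWithin_le_nhds hsm hLm, ?_⟩
  have hI : ∀ L : ℂ, |L.im| ≤ Real.pi → Integrable (fun ν : ℝ => A ν *
      (Complex.exp ((-(1 / 2) + (ν : ℂ) * Complex.I) * L) / Complex.cosh (Real.pi * ν))) := by
    intro L hL
    refine (hA.norm.mul_const (2 * Real.exp (L.re * (-(1 / 2))))).mono' (hA.1.mul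
      (Continuous.aestronglyMeasurable ((by fun_prop : Continuous fun ν : ℝ =>
        Complex.exp ((-(1 / 2) + (ν : ℂ) * Complex.I) * L)).div (by fun_prop) cosh_pi_mul_ne_zero)))
      (Eventually.of_forall fun ν => ?_)
    rw [norm_mul]
    exact mul_le_mul_of_nonneg_left (norm_watson_le ν hL) (norm_nonneg _)
  have hIp := hI (Real.log x - Real.pi * Complex.I) (by simp [abs_of_pos Real.pi_pos])
  have hIm := hI (Real.log x + Real.pi * Complex.I) (by simp [abs_of_pos Real.pi_pos])
  rw [← mul_sub, ← integral_sub hIp hIm, invFourier]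
  have hpi : (Real.pi : ℂ) ≠ 0 := by exact_mod_cast Real.pi_ne_zero
  -- The two arguments `∓π` produce the factors `i e^{πν}` and `-i e^{-πν}`. Their difference is `2i
  -- cosh(πν)`, which cancels the denominator and leaves the inverse Fourier integrand.
  have e : ∀ ν : ℝ, A ν * (Complex.exp ((-(1 / 2) + (ν : ℂ) * Complex.I) *
        (Real.log x - Real.pi * Complex.I)) / Complex.cosh (Real.pi * ν)) -
      A ν * (Complex.exp ((-(1 / 2) + (ν : ℂ) * Complex.I) *
        (Real.log x + Real.pi * Complex.I)) / Complex.cosh (Real.pi * ν)) =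
      (2 * Complex.I * ((Real.exp (-(Real.log x / 2)) : ℝ) : ℂ)) *
        (A ν * Complex.exp ((ν : ℂ) * (Real.log x : ℝ) * Complex.I)) := by
    intro ν
    have h1 : Complex.exp ((-(1 / 2) + (ν : ℂ) * Complex.I) * (Real.log x - Real.pi * Complex.I)) =
        ((Real.exp (-(Real.log x / 2)) : ℝ) : ℂ) *
          Complex.exp ((ν : ℂ) * (Real.log x : ℝ) * Complex.I) *
          (Complex.I * Complex.exp (Real.pi * ν)) := by
      have hI1 : Complex.I * Complex.exp (Real.pi * ν) =
          Complex.exp (Real.pi / 2 * Complex.I + Real.pi * ν) := by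
        rw [Complex.exp_add, Complex.exp_pi_div_two_mul_I]
      rw [hI1, Complex.ofReal_exp, ← Complex.exp_add, ← Complex.exp_add]
      congr 1
      push_cast
      linear_combination (-(ν : ℂ) * Real.pi) * Complex.I_sq
    have h2 : Complex.exp ((-(1 / 2) + (ν : ℂ) * Complex.I) * (Real.log x + Real.pi * Complex.I)) =
        ((Real.exp (-(Real.log x / 2)) : ℝ) : ℂ) *
          Complex.exp ((ν : ℂ) * (Real.log x : ℝ) * Complex.I) *
          (-Complex.I * Complex.exp (-(Real.pi * ν))) := by
      have hI2 : -Complex.I * Complex.exp (-(Real.pi * ν)) =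
          Complex.exp (-Real.pi / 2 * Complex.I + -(Real.pi * ν)) := by
        rw [Complex.exp_add, Complex.exp_neg_pi_div_two_mul_I]
      rw [hI2, Complex.ofReal_exp, ← Complex.exp_add, ← Complex.exp_add]
      congr 1
      push_cast
      linear_combination ((ν : ℂ) * Real.pi) * Complex.I_sq
    have h3 : Complex.exp (Real.pi * ν) + Complex.exp (-(Real.pi * ν)) =
        2 * Complex.cosh (Real.pi * ν) := by rw [Complex.cosh]; ring
    rw [h1, h2, ← mul_sub, ← sub_div, mul_div_assoc', div_eq_iff (cosh_pi_mul_ne_zero ν)]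
    linear_combination (A ν * ((Real.exp (-(Real.log x / 2)) : ℝ) : ℂ) *
      Complex.exp ((ν : ℂ) * (Real.log x : ℝ) * Complex.I) * Complex.I) * h3
  simp only [e]
  rw [integral_const_mul]
  generalize (∫ ν : ℝ, A ν * Complex.exp ((ν : ℂ) * (Real.log x : ℝ) * Complex.I)) = J
  field_simp

/-! ### Exponential changes of variables -/

theorem image_exp_neg_Ioi : (fun t : ℝ => Real.exp (-t)) '' Ioi 0 = Ioo 0 1 := by
  ext x
  constructor
  · rintro ⟨t, ht, rfl⟩
    exact ⟨Real.exp_pos _, by simpa using ht⟩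
  · rintro ⟨h0, h1⟩
    exact ⟨-Real.log x, by simpa using Real.log_neg h0 h1, by simp [Real.exp_log h0]⟩

theorem image_exp_Ioi_zero : Real.exp '' Ioi 0 = Ioi 1 := by
  ext x
  constructor
  · rintro ⟨t, ht, rfl⟩
    simpa using ht
  · intro (h1 : 1 < x)
    exact ⟨Real.log x, Real.log_pos h1, Real.exp_log (by linarith)⟩

section ChangeOfVariables

variable {E : Type*} [NormedAddCommGroup E] [NormedSpace ℝ E] (g : ℝ → E)

theorem hasDerivWithinAt_exp_neg (t : ℝ) (s : Set ℝ) :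
    HasDerivWithinAt (fun t : ℝ => Real.exp (-t)) (-Real.exp (-t)) s t := by
  simpa using ((hasDerivAt_neg t).exp).hasDerivWithinAt

theorem injOn_exp_neg (s : Set ℝ) : InjOn (fun t : ℝ => Real.exp (-t)) s :=
  fun _ _ _ _ h => neg_injective (Real.exp_injective h)

theorem integral_Ioo_zero_one_eq_exp_neg :
    ∫ x in Ioo (0 : ℝ) 1, g x = ∫ t in Ioi (0 : ℝ), Real.exp (-t) • g (Real.exp (-t)) := by
  rw [← image_exp_neg_Ioi, integral_image_eq_integral_abs_deriv_smul measurableSet_Ioi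
    (fun t _ => hasDerivWithinAt_exp_neg t _) (injOn_exp_neg _)]
  simp [abs_of_pos (Real.exp_pos _)]

theorem integrableOn_Ioo_zero_one_iff_exp_neg :
    IntegrableOn g (Ioo (0 : ℝ) 1) ↔
      IntegrableOn (fun t => Real.exp (-t) • g (Real.exp (-t))) (Ioi (0 : ℝ)) := by
  rw [← image_exp_neg_Ioi, integrableOn_image_iff_integrableOn_abs_deriv_smul measurableSet_Ioi
    (fun t _ => hasDerivWithinAt_exp_neg t _) (injOn_exp_neg _)]
  simp [abs_of_pos (Real.exp_pos _)]

theorem integral_Ioi_one_eq_exp :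
    ∫ x in Ioi (1 : ℝ), g x = ∫ t in Ioi (0 : ℝ), Real.exp t • g (Real.exp t) := by
  rw [← image_exp_Ioi_zero, integral_image_eq_integral_abs_deriv_smul measurableSet_Ioi
    (fun t _ => (Real.hasDerivAt_exp t).hasDerivWithinAt) Real.exp_injective.injOn]
  simp [abs_of_pos (Real.exp_pos _)]

theorem integrableOn_Ioi_one_iff_exp :
    IntegrableOn g (Ioi (1 : ℝ)) ↔
      IntegrableOn (fun t => Real.exp t • g (Real.exp t)) (Ioi (0 : ℝ)) := by
  rw [← image_exp_Ioi_zero, integrableOn_image_iff_integrableOn_abs_deriv_smul measurableSet_Ioi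
    (fun t _ => (Real.hasDerivAt_exp t).hasDerivWithinAt) Real.exp_injective.injOn]
  simp [abs_of_pos (Real.exp_pos _)]

end ChangeOfVariables

/-! ### The interpolating function and its continuous density -/

/-- A sequence with the Hausdorff property is interpolated by the Laplace transform of a function
in `L²(0, ∞)`. -/
theorem HausdorffCondition.exists_halfPlaneTransform {f : ℕ → ℂ} (hf : HausdorffCondition f) :
    ∃ ψ : ℝ → ℂ, MemLp ψ 2 volume ∧ (∀ t ≤ 0, ψ t = 0) ∧
      ∀ n : ℕ, halfPlaneTransform ψ n = f n := by
  obtain ⟨u₀, hu₀, hmom₀⟩ := hf.exists_memLp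
  -- A strongly measurable representative is taken so that composition with `e^{-t}` is measurable.
  obtain ⟨u, hus, hae⟩ := hu₀.1
  rw [restrict_Ioo_eq_restrict_Ioc.symm] at hae hu₀
  have hu : MemLp u 2 (volume.restrict (Ioo (0 : ℝ) 1)) := hu₀.ae_eq hae
  have hmom : ∀ j : ℕ, ∫ x in Ioo (0 : ℝ) 1, (x : ℂ) ^ j * u x = f j := by
    intro j
    rw [← hmom₀ j, ← restrict_Ioo_eq_restrict_Ioc]
    refine integral_congr_ae ?_
    filter_upwards [hae] with x hx
    rw [hx]
  -- Of the Jacobian `e^{-t}`, half goes into `ψ`, making `u ↦ ψ` isometric for `L²`; the other half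
  -- is the shift `s + 1/2` in the Laplace kernel.
  set ψ : ℝ → ℂ := (Ioi (0 : ℝ)).indicator
    fun t => ((Real.exp (-t / 2) : ℝ) : ℂ) * u (Real.exp (-t)) with hψ
  have hψm : StronglyMeasurable ψ := by
    refine StronglyMeasurable.indicator (StronglyMeasurable.mul ?_ ?_) measurableSet_Ioi
    · exact (by fun_prop : Continuous fun t : ℝ => ((Real.exp (-t / 2) : ℝ) : ℂ)).stronglyMeasurable
    · exact hus.comp_measurable (by fun_prop)
  refine ⟨ψ, ?_, ?_, ?_⟩
  · rw [memLp_two_iff_integrable_sq_norm hψm.aestronglyMeasurable]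
    have h1 := (integrableOn_Ioo_zero_one_iff_exp_neg _).1
      ((memLp_two_iff_integrable_sq_norm hu.1).1 hu)
    rw [← integrable_indicator_iff measurableSet_Ioi] at h1
    refine h1.congr (Eventually.of_forall fun t => ?_)
    by_cases ht : t ∈ Ioi (0 : ℝ)
    · simp only [hψ, indicator_of_mem ht, norm_mul, mul_pow, smul_eq_mul, Complex.norm_real,
        Real.norm_eq_abs, sq_abs]
      rw [← Real.exp_nat_mul]
      congr 2
      push_cast
      ring
    · simp [hψ, indicator_of_notMem ht]
  · intro t ht
    exact indicator_of_notMem (by simpa using ht) _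
  · intro n
    rw [halfPlaneTransform, if_pos (by simp; linarith [(Nat.cast_nonneg n : (0 : ℝ) ≤ n)]),
      ← hmom n, integral_Ioo_zero_one_eq_exp_neg, ← integral_indicator measurableSet_Ioi]
    refine integral_congr_ae (Eventually.of_forall fun t => ?_)
    by_cases ht : t ∈ Ioi (0 : ℝ)
    · simp only [hψ, indicator_of_mem ht, laplaceKernel, Complex.real_smul, Complex.ofReal_exp]
      rw [← Complex.exp_nat_mul, ← mul_assoc, ← mul_assoc, ← Complex.exp_add, ← Complex.exp_add]
      congr 2
      push_cast
      ring
    · simp [hψ, indicator_of_notMem ht]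

/-- Carlson's theorem for `(V - s^p A)/(s + 1)^p`. The difference alone need not be bounded;
division by `(s+1)^p` repairs this, since `|s| ≤ |s + 1|` and `|s + 1| ≥ 1/2` when `Re s > -1/2`. -/
theorem IsHardyTwo.eqOn_pow_mul {A V : ℂ → ℂ} (hA : IsHardyTwo A) (hV : IsHardyTwo V) (p : ℕ)
    (h : ∀ n : ℕ, V n = (n : ℂ) ^ p * A n) :
    EqOn V (fun s => s ^ p * A s) {s : ℂ | -(1 / 2 : ℝ) < s.re} := by
  intro s (hs : -(1 / 2 : ℝ) < s.re)
  obtain ⟨c, hc, hcs⟩ : ∃ c : ℝ, -(1 / 2) < c ∧ c < min s.re 1 :=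
    exists_between (lt_min hs (by norm_num))
  obtain ⟨hcs, hc1⟩ := lt_min_iff.1 hcs
  obtain ⟨K, hK⟩ := hA.bounded_of_lt hc
  obtain ⟨K', hK'⟩ := hV.bounded_of_lt hc
  have hsub : {z : ℂ | c < z.re} ⊆ {s : ℂ | -(1 / 2 : ℝ) < s.re} := fun z hz => hc.trans hz
  have hne : ∀ z : ℂ, c < z.re → 1 / 2 ≤ ‖z + 1‖ := by
    intro z hz
    refine le_trans ?_ ((le_abs_self _).trans (Complex.abs_re_le_norm _))
    simp only [Complex.add_re, Complex.one_re]; linarith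
  have hne' : ∀ z : ℂ, c < z.re → z + 1 ≠ 0 := fun z hz => by
    rw [← norm_pos_iff]; linarith [hne z hz]
  have hle : ∀ z : ℂ, c < z.re → ‖z‖ ≤ ‖z + 1‖ := by
    intro z hz
    refine abs_le_of_sq_le_sq' ?_ (norm_nonneg _) |>.2
    rw [← Complex.normSq_eq_norm_sq, ← Complex.normSq_eq_norm_sq, Complex.normSq_apply,
      Complex.normSq_apply]
    simp only [Complex.add_re, Complex.one_re, Complex.add_im, Complex.one_im]
    nlinarith
  have key := eq_zero_of_zeros_nat (h := fun z => (V z - z ^ p * A z) / (z + 1) ^ p)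
    (K := K' * 2 ^ p + K) hc1 ?_ ?_ ?_
  · have := key hcs
    simp only [Pi.zero_apply, div_eq_zero_iff, pow_eq_zero_iff', hne' s hcs, false_and, or_false,
      sub_eq_zero] at this
    exact this
  · refine DifferentiableOn.div ((hV.holomorphic.mono hsub).sub
      ((by fun_prop : Differentiable ℂ fun z : ℂ => z ^ p).differentiableOn.mul
        (hA.holomorphic.mono hsub))) (by fun_prop) fun z hz => pow_ne_zero _ (hne' z hz)
  · intro z hz
    have hpos : 0 < ‖z + 1‖ := by linarith [hne z hz]
    rw [sub_div, mul_div_right_comm]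
    refine (norm_sub_le _ _).trans (add_le_add ?_ ?_)
    · rw [norm_div, norm_pow, div_eq_mul_inv, ← inv_pow]
      have : ‖z + 1‖⁻¹ ≤ 2 := by
        rw [inv_le_comm₀ hpos two_pos]; linarith [hne z hz]
      exact mul_le_mul (hK' z hz) (pow_le_pow_left₀ (by positivity) this p) (by positivity)
        ((norm_nonneg _).trans (hK' z hz))
    · rw [norm_mul, norm_div, norm_pow, norm_pow, ← div_pow]
      refine (mul_le_of_le_one_left (norm_nonneg _) ?_).trans (hK z hz)
      exact pow_le_one₀ (by positivity) ((div_le_one hpos).2 (hle z hz))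
  · intro n
    have := h (n + 1)
    push_cast at this
    simp only [this, sub_self, zero_div]

theorem IsHardyTwo.continuous_vertical {A : ℂ → ℂ} (hA : IsHardyTwo A) {σ : ℝ}
    (hσ : -(1 / 2 : ℝ) < σ) : Continuous (vertical A σ) := by
  have hopen : IsOpen {s : ℂ | -(1 / 2 : ℝ) < s.re} := isOpen_lt continuous_const Complex.continuous_re
  refine hA.holomorphic.continuousOn.comp_continuous (by fun_prop) fun ν => ?_
  simpa using hσ

/-- `L²` convergence gives almost everywhere convergence along a subsequence; extracting twice
yields one sequence of abscissas serving both functions, along which a pointwise identity passes to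
the boundary. -/
theorem IsHardyTwo.exists_seq_tendsto_ae {A V : ℂ → ℂ} (hA : IsHardyTwo A) (hV : IsHardyTwo V) :
    ∃ r : ℕ → ℝ, (∀ k, -(1 / 2 : ℝ) < r k) ∧ Tendsto r atTop (𝓝 (-(1 / 2))) ∧
      ∀ᵐ ν : ℝ, Tendsto (fun k => vertical A (r k) ν) atTop (𝓝 (vertical A (-(1 / 2)) ν)) ∧
        Tendsto (fun k => vertical V (r k) ν) atTop (𝓝 (vertical V (-(1 / 2)) ν)) := by
  let r₀ : ℕ → ℝ := fun k => -(1 / 2) + 1 / ((k : ℝ) + 1)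
  have hr₀ : ∀ k, -(1 / 2 : ℝ) < r₀ k := fun k => by
    have : (0 : ℝ) < 1 / ((k : ℝ) + 1) := by positivity
    simp only [r₀]; linarith
  have hlim : Tendsto r₀ atTop (𝓝[>] (-(1 / 2))) := by
    refine tendsto_nhdsWithin_iff.2 ⟨?_, Eventually.of_forall hr₀⟩
    have := (tendsto_one_div_add_atTop_nhds_zero_nat (𝕜 := ℝ)).const_add (-(1 / 2))
    rwa [add_zero] at this
  have key : ∀ {g : ℂ → ℂ}, IsHardyTwo g → ∀ {n : ℕ → ℕ}, Tendsto n atTop atTop →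
      ∃ ns : ℕ → ℕ, StrictMono ns ∧ ∀ᵐ ν : ℝ, Tendsto (fun k => vertical g (r₀ (n (ns k))) ν)
        atTop (𝓝 (vertical g (-(1 / 2)) ν)) := by
    intro g hg n hn
    exact (tendstoInMeasure_of_tendsto_eLpNorm two_ne_zero
      (fun k => (hg.continuous_vertical (hr₀ (n k))).aestronglyMeasurable)
      hg.boundary_memLp.1 (hg.boundary_limit.comp (hlim.comp hn))).exists_seq_tendsto_ae
  obtain ⟨n₁, hn₁, h₁⟩ := key hA tendsto_id
  obtain ⟨n₂, hn₂, h₂⟩ := key hV hn₁.tendsto_atTop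
  refine ⟨fun k => r₀ (n₁ (n₂ k)), fun k => hr₀ _, ((tendsto_nhdsWithin_iff.1 hlim).1.comp
    (hn₁.tendsto_atTop.comp hn₂.tendsto_atTop)), ?_⟩
  filter_upwards [h₁, h₂] with ν e₁ e₂
  exact ⟨e₁.comp hn₂.tendsto_atTop, e₂⟩

theorem IsHardyTwo.vertical_pow_mul {A V : ℂ → ℂ} (hA : IsHardyTwo A) (hV : IsHardyTwo V) {p : ℕ}
    (h : ∀ n : ℕ, V n = (n : ℂ) ^ p * A n) {σ : ℝ} (hσ : -(1 / 2 : ℝ) ≤ σ) :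
    ∀ᵐ ν : ℝ, vertical V σ ν = ((σ : ℂ) + (ν : ℂ) * Complex.I) ^ p * vertical A σ ν := by
  have hEq := hA.eqOn_pow_mul hV p h
  have hgt : ∀ {τ : ℝ}, -(1 / 2 : ℝ) < τ → ∀ ν : ℝ,
      vertical V τ ν = ((τ : ℂ) + (ν : ℂ) * Complex.I) ^ p * vertical A τ ν := by
    intro τ hτ ν
    exact hEq (show -(1 / 2 : ℝ) < ((τ : ℂ) + (ν : ℂ) * Complex.I).re by simpa using hτ)
  rcases hσ.lt_or_eq with hlt | rfl
  · exact Eventually.of_forall (hgt hlt)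
  · obtain ⟨r, hr, hlim, hae⟩ := hA.exists_seq_tendsto_ae hV
    filter_upwards [hae] with ν hν
    refine tendsto_nhds_unique hν.2 ?_
    simp only [hgt (hr _)]
    refine Tendsto.mul (Tendsto.pow (Tendsto.add_const _ ?_) _) hν.1
    exact (Complex.continuous_ofReal.tendsto _).comp hlim

/-- If `s^p A(s)` is of class `H²` too then `(1 + |ν|) A(σ + iν)` is square integrable. -/
theorem IsHardyTwo.ae_one_add_abs_mul_le {A V : ℂ → ℂ} (hA : IsHardyTwo A) (hV : IsHardyTwo V)
    {p : ℕ} (hp : 1 ≤ p) (h : ∀ n : ℕ, V n = (n : ℂ) ^ p * A n) {σ : ℝ} (hσ : -(1 / 2 : ℝ) ≤ σ) :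
    ∀ᵐ ν : ℝ, (1 + |ν|) * ‖vertical A σ ν‖ ≤ 2 * ‖vertical A σ ν‖ + ‖vertical V σ ν‖ := by
  filter_upwards [hA.vertical_pow_mul hV h hσ] with ν hν
  have hs : |ν| ≤ ‖(σ : ℂ) + (ν : ℂ) * Complex.I‖ := by
    simpa using Complex.abs_im_le_norm ((σ : ℂ) + (ν : ℂ) * Complex.I)
  have h1 : |ν| ≤ 1 + |ν| ^ p := by
    rcases le_total |ν| 1 with h | h
    · linarith [pow_nonneg (abs_nonneg ν) p]
    · linarith [le_self_pow₀ h (by omega : p ≠ 0)]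
  have h2 : |ν| ^ p * ‖vertical A σ ν‖ ≤ ‖vertical V σ ν‖ := by
    rw [hν, norm_mul, norm_pow]
    gcongr
  nlinarith [mul_le_mul_of_nonneg_right h1 (norm_nonneg (vertical A σ ν))]

/-- Cauchy–Schwarz with `(1 + |ν|)⁻¹`, which is square integrable. -/
theorem integrable_of_memLp_one_add_abs_mul {g : ℝ → ℂ}
    (hg : MemLp (fun ν : ℝ => ((1 + |ν| : ℝ) : ℂ) * g ν) 2 volume) : Integrable g := by
  have hk : MemLp (fun ν : ℝ => (((1 + |ν|)⁻¹ : ℝ) : ℂ)) 2 volume := by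
    have hc : Continuous fun ν : ℝ => (((1 + |ν|)⁻¹ : ℝ) : ℂ) :=
      Complex.continuous_ofReal.comp (Continuous.inv₀ (by fun_prop) fun ν => by positivity)
    rw [memLp_two_iff_integrable_sq_norm hc.aestronglyMeasurable]
    have := integrable_one_add_norm (E := ℝ) (μ := volume) (r := 2) (by simp)
    refine this.congr (Eventually.of_forall fun ν => ?_)
    have hpos : 0 < 1 + |ν| := by positivity
    simp only [Complex.norm_real, Real.norm_eq_abs]
    rw [sq_abs, inv_pow, Real.rpow_neg (by positivity)]
    norm_num
  refine (hk.integrable_mul hg).congr (Eventually.of_forall fun ν => ?_)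
  have hpos : ((1 + |ν| : ℝ) : ℂ) ≠ 0 := by
    exact_mod_cast (by positivity : (1 + |ν|) ≠ 0)
  simp only [Pi.mul_apply, Complex.ofReal_inv]
  rw [← mul_assoc, inv_mul_cancel₀ hpos, one_mul]

theorem halfPlaneTransform_congr {φ ψ : ℝ → ℂ} (h : φ =ᵐ[volume] ψ) :
    halfPlaneTransform φ = halfPlaneTransform ψ := by
  ext s
  rw [halfPlaneTransform, halfPlaneTransform]
  split_ifs with hs hφ hψ hψ
  · exact integral_congr_ae (h.mono fun t ht => by simp only [ht])
  · rw [MemLp.toLp_congr hφ hψ h]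
  · exact absurd (hφ.ae_eq h) hψ
  · exact absurd (hψ.ae_eq h.symm) hφ
  · rfl

/-- If `a_n` and `n^p a_n` both have the Hausdorff property then `a_n` is interpolated by the
Laplace transform of a continuous function, with good decay on vertical lines. -/
theorem HausdorffCondition.exists_continuous_halfPlaneTransform {f : ℕ → ℂ} {p : ℕ} (hp : 1 ≤ p)
    (hf : HausdorffCondition f) (hfp : HausdorffCondition fun n => (n : ℂ) ^ p * f n) :
    ∃ Φ : ℝ → ℂ, Continuous Φ ∧ MemLp Φ 2 volume ∧ (∀ t ≤ 0, Φ t = 0) ∧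
      (∀ n : ℕ, halfPlaneTransform Φ n = f n) ∧
      ∀ σ : ℝ, -(1 / 2 : ℝ) ≤ σ →
        MemLp (fun ν : ℝ => ((1 + |ν| : ℝ) : ℂ) * vertical (halfPlaneTransform Φ) σ ν) 2 volume ∧
        Integrable (vertical (halfPlaneTransform Φ) σ) ∧
        damp (σ + 1 / 2) Φ = invFourier (vertical (halfPlaneTransform Φ) σ) := by
  obtain ⟨ψ, hψ, h0, hn⟩ := hf.exists_halfPlaneTransform
  obtain ⟨χ, hχ, hχ0, hχn⟩ := hfp.exists_halfPlaneTransform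
  have hA := isHardyTwo_halfPlaneTransform hψ h0
  have hV := isHardyTwo_halfPlaneTransform hχ hχ0
  have hAV : ∀ n : ℕ, halfPlaneTransform χ n = (n : ℂ) ^ p * halfPlaneTransform ψ n := fun n => by
    rw [hχn, hn]
  have hmem : ∀ σ : ℝ, -(1 / 2 : ℝ) ≤ σ → MemLp
      (fun ν : ℝ => ((1 + |ν| : ℝ) : ℂ) * vertical (halfPlaneTransform ψ) σ ν) 2 volume := by
    intro σ hσ
    have h1 := memLp_vertical_halfPlaneTransform hψ h0 hσ
    have h2 := memLp_vertical_halfPlaneTransform hχ hχ0 hσ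
    refine ((h1.norm.const_mul 2).add h2.norm).mono ?_ ?_
    · exact (by fun_prop : Continuous fun ν : ℝ => ((1 + |ν| : ℝ) : ℂ)).aestronglyMeasurable.mul h1.1
    · filter_upwards [hA.ae_one_add_abs_mul_le hV hp hAV hσ] with ν hν
      rw [norm_mul, Complex.norm_real, Real.norm_of_nonneg (by positivity)]
      exact hν.trans (le_abs_self _)
  have hint : ∀ σ : ℝ, -(1 / 2 : ℝ) ≤ σ → Integrable (vertical (halfPlaneTransform ψ) σ) :=
    fun σ hσ => integrable_of_memLp_one_add_abs_mul (hmem σ hσ)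
  -- The boundary line, where there is no damping, defines the continuous representative. Identities
  -- with `ψ` that hold almost everywhere then become pointwise for `Φ`.
  set Φ := invFourier (vertical (halfPlaneTransform ψ) (-(1 / 2))) with hΦ
  have hdamp : ∀ σ : ℝ, -(1 / 2 : ℝ) ≤ σ →
      damp (σ + 1 / 2) ψ =ᵐ[volume] invFourier (vertical (halfPlaneTransform ψ) σ) :=
    fun σ hσ => damp_ae_eq_integral_vertical hψ h0 hσ (hint σ hσ)
  have hψΦ : ψ =ᵐ[volume] Φ := by
    have := hdamp (-(1 / 2)) le_rfl
    rwa [neg_add_cancel, damp_zero] at this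
  have hc : Continuous Φ := continuous_invFourier (hint _ le_rfl)
  have heq : halfPlaneTransform Φ = halfPlaneTransform ψ := halfPlaneTransform_congr hψΦ.symm
  refine ⟨Φ, hc, hψ.ae_eq hψΦ, ?_, fun n => by rw [heq, hn], fun σ hσ => ?_⟩
  · have h1 : EqOn Φ 0 (Iio 0) := by
      refine Measure.eqOn_open_of_ae_eq (μ := volume) ?_ isOpen_Iio hc.continuousOn
        continuousOn_const
      rw [EventuallyEq, ae_restrict_iff' measurableSet_Iio]
      filter_upwards [hψΦ] with t ht hlt
      rw [← ht, h0 t (le_of_lt hlt)]; rfl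
    have h2 := h1.closure hc continuous_const
    rw [closure_Iio] at h2
    exact fun t ht => h2 ht
  · rw [heq]
    refine ⟨hmem σ hσ, hint σ hσ, ?_⟩
    refine (Continuous.ae_eq_iff_eq volume ?_ (continuous_invFourier (hint σ hσ))).1 ?_
    · unfold damp; fun_prop
    · refine EventuallyEq.trans ?_ (hdamp σ hσ)
      filter_upwards [hψΦ] with t ht
      simp only [damp, ht]

/-! ### Taylor coefficients of the Cauchy integral and support of the density -/

section CauchyIntegralL2

variable {Φ : ℝ → ℂ}

/-- The weighted density is dominated by the Laplace integrand at `s = 0`, because `e^{t/2}/(1 +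
e^t) ≤ e^{-t/2}`. -/
theorem differentiableAt_cauchyExp (hΦ : MemLp Φ 2 volume) {ξ : ℝ} (h0 : ∀ t ≤ ξ, Φ t = 0) {z : ℂ}
    (hz : z ∉ (fun x : ℝ => (x : ℂ)) '' Ici (Real.exp ξ)) :
    DifferentiableAt ℂ (cauchyExp Φ) z := by
  obtain ⟨d, hd, hdist⟩ := exists_pos_le_norm_ofReal_sub hz
  have hlap := (integrable_laplace hΦ h0 (s := 0) (by norm_num)).1
  have hm : AEStronglyMeasurable (fun t : ℝ => Φ t * ((Real.exp (t / 2) : ℝ) : ℂ)) volume :=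
    hΦ.1.mul (by fun_prop : Continuous fun t : ℝ => ((Real.exp (t / 2) : ℝ) : ℂ)).aestronglyMeasurable
  refine (differentiableAt_cauchy hm (hlap.norm.mono' ?_ (Eventually.of_forall fun t => ?_)) hd
    fun t ht => hdist _ (Real.exp_le_exp.2 ?_)).2
  · exact (hm.norm.aemeasurable.div
      (by fun_prop : Continuous fun t : ℝ => 1 + Real.exp t).measurable.aemeasurable).aestronglyMeasurable
  · rw [Real.norm_of_nonneg (by positivity), norm_mul, norm_mul, norm_laplaceKernel,
      Complex.norm_real, Real.norm_of_nonneg (Real.exp_pos _).le, mul_comm ‖Φ t‖, mul_div_right_comm]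
    refine mul_le_mul_of_nonneg_right ?_ (norm_nonneg _)
    rw [div_le_iff₀ (by positivity), mul_add, ← Real.exp_add]
    simp only [Complex.zero_re]
    rw [show -((0 + 1 / 2) * t) + t = t / 2 by ring]
    have := Real.exp_pos (-((0 + 1 / 2) * t))
    linarith
  · by_contra hlt
    exact ht (by rw [h0 t (not_le.1 hlt).le, zero_mul])

/-- The Taylor coefficients of the Cauchy integral are values of the Laplace transform. -/
theorem hasSum_cauchyExp (hΦ : MemLp Φ 2 volume) {ξ : ℝ} (h0 : ∀ t ≤ ξ, Φ t = 0) {z : ℂ}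
    (hz : ‖z‖ < Real.exp ξ) :
    HasSum (fun n : ℕ => halfPlaneTransform Φ n * z ^ n) (cauchyExp Φ z) := by
  have hre : ∀ n : ℕ, -(1 / 2 : ℝ) < (n : ℂ).re := fun n => by
    rw [Complex.natCast_re]; linarith [(Nat.cast_nonneg n : (0 : ℝ) ≤ n)]
  have hlap := fun n : ℕ => (integrable_laplace hΦ h0 (hre n)).1
  have hk : ∀ (n : ℕ) (t : ℝ), laplaceKernel n t * z ^ n =
      laplaceKernel 0 t * (z / ((Real.exp t : ℝ) : ℂ)) ^ n := by
    intro n t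
    rw [div_pow, Complex.ofReal_exp, ← Complex.exp_nat_mul, mul_div_assoc',
      eq_div_iff (Complex.exp_ne_zero _), mul_right_comm, laplaceKernel, laplaceKernel,
      ← Complex.exp_add]
    congr 2
    ring
  have hint : ∀ n : ℕ, Integrable fun t => laplaceKernel n t * Φ t * z ^ n :=
    fun n => (hlap n).mul_const _
  have hnorm : ∀ t, ξ < t → ‖z / ((Real.exp t : ℝ) : ℂ)‖ ≤ ‖z‖ / Real.exp ξ := by
    intro t ht
    rw [norm_div, Complex.norm_real, Real.norm_of_nonneg (Real.exp_pos _).le]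
    exact div_le_div_of_nonneg_left (norm_nonneg _) (Real.exp_pos _) (Real.exp_le_exp.2 ht.le)
  have hlt1 : ‖z‖ / Real.exp ξ < 1 := (div_lt_one (Real.exp_pos _)).2 hz
  have hlap0 := hlap 0
  rw [Nat.cast_zero] at hlap0
  have hbound : ∀ (n : ℕ) (t : ℝ), ‖laplaceKernel n t * Φ t * z ^ n‖ ≤
      (‖z‖ / Real.exp ξ) ^ n * ‖laplaceKernel 0 t * Φ t‖ := by
    intro n t
    rcases le_or_gt t ξ with ht | ht
    · simp [h0 t ht]
    · rw [mul_right_comm, hk, mul_right_comm, norm_mul, norm_pow, mul_comm]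
      exact mul_le_mul_of_nonneg_right (pow_le_pow_left₀ (norm_nonneg _) (hnorm t ht) n)
        (norm_nonneg _)
  -- The kernel is expanded as a geometric series in `z/e^t`, whose ratio is at most `‖z‖/e^ξ < 1`
  -- where the density lives.
  have hsum := hasSum_integral_of_summable_integral_norm hint
    (((summable_geometric_of_lt_one (by positivity) hlt1).mul_right
      (∫ t, ‖laplaceKernel 0 t * Φ t‖)).of_nonneg_of_le
      (fun n => integral_nonneg fun t => norm_nonneg _) fun n => by
        rw [← integral_const_mul]
        exact integral_mono (hint n).norm (hlap0.norm.const_mul _) (hbound n))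
  have hcoe : ∀ n : ℕ, halfPlaneTransform Φ n * z ^ n =
      ∫ t, laplaceKernel n t * Φ t * z ^ n := fun n => by
    rw [halfPlaneTransform_of_re (hre n), integral_mul_const]
  simp only [hcoe]
  suffices h : cauchyExp Φ z = ∫ t, ∑' n : ℕ, laplaceKernel n t * Φ t * z ^ n by
    rwa [h]
  unfold cauchyExp
  refine integral_congr_ae (Eventually.of_forall fun t => ?_)
  rcases le_or_gt t ξ with ht | ht
  · simp [h0 t ht]
  · have hlt : ‖z / ((Real.exp t : ℝ) : ℂ)‖ < 1 := (hnorm t ht).trans_lt hlt1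
    have he : ((Real.exp t : ℝ) : ℂ) ≠ 0 := by exact_mod_cast (Real.exp_pos t).ne'
    have hs := ((hasSum_geometric_of_norm_lt_one hlt).mul_left (laplaceKernel 0 t * Φ t)).tsum_eq
    have e : ∀ n : ℕ, laplaceKernel n t * Φ t * z ^ n =
        laplaceKernel 0 t * Φ t * (z / ((Real.exp t : ℝ) : ℂ)) ^ n := fun n => by
      rw [mul_right_comm, hk, mul_right_comm]
    simp only [e, hs]
    have hne : ((Real.exp t : ℝ) : ℂ) - z ≠ 0 := by
      intro h
      rw [sub_eq_zero] at h
      rw [← h, div_self he] at hlt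
      simp at hlt
    have hk0 : ((Real.exp (t / 2) : ℝ) : ℂ) = laplaceKernel 0 t * ((Real.exp t : ℝ) : ℂ) := by
      rw [laplaceKernel, Complex.ofReal_exp, Complex.ofReal_exp, ← Complex.exp_add]
      congr 1; push_cast; ring
    rw [hk0, one_sub_div he, inv_div]
    field_simp

/-- If the coefficients decay like `e^{-nξ}` then the density vanishes on `(-∞, ξ]`. -/
theorem eq_zero_of_norm_halfPlaneTransform_nat_le {A : ℝ → ℂ} (hA : Integrable A)
    (hΦA : Φ = invFourier A) (hΦ : MemLp Φ 2 volume) (h0 : ∀ t ≤ 0, Φ t = 0) {ξ K : ℝ}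
    (hdecay : ∀ᶠ n : ℕ in atTop, ‖halfPlaneTransform Φ n‖ ≤ K * Real.exp (-(n * ξ))) :
    ∀ t ≤ ξ, Φ t = 0 := by
  have hcont : Continuous Φ := hΦA ▸ continuous_invFourier hA
  suffices h : EqOn Φ 0 (Iio ξ) by
    have h2 := h.closure hcont continuous_const
    rw [closure_Iio] at h2
    exact fun t ht => h2 ht
  intro t (ht : t < ξ)
  rcases le_or_gt t 0 with ht0 | ht0
  · exact h0 t ht0
  -- The decay makes the Taylor series converge on a disc containing `e^t`. It continues the Cauchy
  -- integral across the cut there, so both one-sided limits agree and the jump formula gives `Φ t =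
  -- 0`.
  set S : ℂ → ℂ := fun z => ∑' n : ℕ, halfPlaneTransform Φ n * z ^ n with hS
  obtain ⟨ρ, htρ, hρξ⟩ := exists_between ht
  set R := Real.exp ρ with hR
  have hR1 : 1 < R := Real.one_lt_exp_iff.2 (ht0.trans htρ)
  have hsumm : Summable fun n : ℕ => ‖halfPlaneTransform Φ n‖ * R ^ n := by
    refine Summable.of_norm_bounded_eventually_nat (g := fun n => K * Real.exp (ρ - ξ) ^ n)
      ((summable_geometric_of_lt_one (Real.exp_pos _).le
        (Real.exp_lt_one_iff.2 (by linarith))).mul_left K) ?_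
    filter_upwards [hdecay] with n hn
    rw [Real.norm_of_nonneg (by positivity)]
    refine (mul_le_mul_of_nonneg_right hn (by positivity)).trans (le_of_eq ?_)
    rw [hR, ← Real.exp_nat_mul, ← Real.exp_nat_mul, mul_assoc, ← Real.exp_add]
    congr 2; ring
  have hSd : DifferentiableOn ℂ S (Metric.ball 0 R) := by
    refine Complex.differentiableOn_tsum_of_summable_norm hsumm (fun n => by fun_prop)
      Metric.isOpen_ball fun n w hw => ?_
    rw [norm_mul, norm_pow]
    have : ‖w‖ ≤ R := by simpa using (mem_ball_zero_iff.1 hw).le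
    gcongr
  -- The disc minus the cut is star-shaped about `0`, hence connected, as the identity theorem
  -- requires.
  set D : Set ℂ := Metric.ball 0 R ∩ ((fun x : ℝ => (x : ℂ)) '' Ici 1)ᶜ with hD
  have hcl : IsClosed ((fun x : ℝ => (x : ℂ)) '' Ici 1) :=
    Complex.isometry_ofReal.isClosedEmbedding.isClosedMap _ isClosed_Ici
  have hDo : IsOpen D := Metric.isOpen_ball.inter hcl.isOpen_compl
  have h0D : (0 : ℂ) ∈ D := by
    refine ⟨Metric.mem_ball_self (by linarith), ?_⟩
    rintro ⟨x, hx, hx0⟩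
    have : x = 0 := by simpa using hx0
    rw [this] at hx
    exact absurd hx (by simp)
  have hstar : StarConvex ℝ 0 D := by
    rw [starConvex_zero_iff]
    intro z hz r hr0 hr1
    refine ⟨?_, ?_⟩
    · have h1 : ‖z‖ < R := by simpa using hz.1
      rw [mem_ball_zero_iff, norm_smul, Real.norm_of_nonneg hr0]
      exact (mul_le_of_le_one_left (norm_nonneg _) hr1).trans_lt h1
    · rintro ⟨x, hx, hxz⟩
      have hx1 : 1 ≤ x := hx
      have hr : 0 < r := by
        refine hr0.lt_of_ne ?_
        rintro rfl
        have : x = 0 := by simpa using hxz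
        linarith
      refine hz.2 ⟨x / r, ?_, ?_⟩
      · exact (one_le_div hr).2 (hr1.trans hx1)
      · have hrc : (r : ℂ) ≠ 0 := by exact_mod_cast hr.ne'
        simp only [Complex.real_smul] at hxz
        push_cast
        rw [hxz, mul_div_cancel_left₀ _ hrc]
  have hcd : DifferentiableOn ℂ (cauchyExp Φ) D := fun z hz =>
    (differentiableAt_cauchyExp hΦ h0 (by simpa using hz.2)).differentiableWithinAt
  have heq : EqOn (cauchyExp Φ) S D := by
    refine (hcd.analyticOnNhd hDo).eqOn_of_preconnected_of_eventuallyEq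
      ((hSd.mono inter_subset_left).analyticOnNhd hDo)
      (hstar.isPathConnected h0D).isConnected.isPreconnected h0D ?_
    filter_upwards [Metric.ball_mem_nhds (0 : ℂ) one_pos] with z hz
    exact (hasSum_cauchyExp hΦ h0 (by simpa using hz)).tsum_eq.symm
  have hx : ((Real.exp t : ℝ) : ℂ) ∈ Metric.ball (0 : ℂ) R := by
    rw [mem_ball_zero_iff, Complex.norm_real, Real.norm_of_nonneg (Real.exp_pos _).le]
    exact Real.exp_lt_exp.2 htρ
  have hSc : Tendsto S (𝓝 ((Real.exp t : ℝ) : ℂ)) (𝓝 (S ((Real.exp t : ℝ) : ℂ))) :=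
    (hSd.differentiableAt (Metric.isOpen_ball.mem_nhds hx)).continuousAt
  have hside : ∀ U : Set ℂ, (∀ z ∈ U, z.im ≠ 0) →
      Tendsto (cauchyExp Φ) (𝓝[U] ((Real.exp t : ℝ) : ℂ)) (𝓝 (S ((Real.exp t : ℝ) : ℂ))) := by
    intro U hU
    refine (hSc.mono_left nhdsWithin_le_nhds).congr' ?_
    filter_upwards [self_mem_nhdsWithin, mem_nhdsWithin_of_mem_nhds
      (Metric.isOpen_ball.mem_nhds hx)] with z hz hzb
    refine (heq ⟨hzb, ?_⟩).symm
    rintro ⟨x, -, rfl⟩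
    exact hU _ hz (Complex.ofReal_im x)
  obtain ⟨gp, gm, hp, hm, hj⟩ := exists_tendsto_cauchyExp_invFourier hA (Real.exp_pos t)
  rw [← hΦA] at hp hm hj
  have hpn : (𝓝[{z : ℂ | 0 < z.im}] ((Real.exp t : ℝ) : ℂ)).NeBot := by
    rw [← mem_closure_iff_nhdsWithin_neBot, Complex.closure_setOfPred_lt_im]
    simp
  have hmn : (𝓝[{z : ℂ | z.im < 0}] ((Real.exp t : ℝ) : ℂ)).NeBot := by
    rw [← mem_closure_iff_nhdsWithin_neBot, Complex.closure_setOfPred_im_lt]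
    simp
  rw [tendsto_nhds_unique hp (hside _ fun z hz => (show 0 < z.im from hz).ne'),
    tendsto_nhds_unique hm (hside _ fun z hz => (show z.im < 0 from hz).ne), sub_self,
    Real.log_exp] at hj
  have hpi : (Real.pi : ℂ) ≠ 0 := by exact_mod_cast Real.pi_ne_zero
  have he : ((Real.exp (-(t / 2)) : ℝ) : ℂ) ≠ 0 := by exact_mod_cast (Real.exp_pos _).ne'
  simpa [hpi, Complex.I_ne_zero] using hj.symm

end CauchyIntegralL2

/-! ### Decay of the coefficients -/

/-- The Laplace transform of a difference of translates. -/
theorem halfPlaneTransform_sub_translate {Φ : ℝ → ℂ} (hΦ : MemLp Φ 2 volume)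
    (h0 : ∀ t ≤ 0, Φ t = 0) (δ : ℝ) {s : ℂ} (hs : -(1 / 2 : ℝ) < s.re) :
    halfPlaneTransform (fun t => Φ t - Complex.exp (δ / 2) * Φ (t - δ)) s =
      (1 - Complex.exp (-(s * δ))) * halfPlaneTransform Φ s := by
  have hi := (integrable_laplace hΦ h0 hs).1
  have hk : ∀ t : ℝ, laplaceKernel s t * (Complex.exp (δ / 2) * Φ (t - δ)) =
      Complex.exp (-(s * δ)) * (laplaceKernel s (t - δ) * Φ (t - δ)) := by
    intro t
    rw [← mul_assoc, ← mul_assoc, laplaceKernel, laplaceKernel, ← Complex.exp_add,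
      ← Complex.exp_add]
    congr 2
    push_cast
    ring
  rw [halfPlaneTransform_of_re hs, halfPlaneTransform_of_re hs]
  simp only [mul_sub, hk]
  rw [integral_sub hi ((hi.comp_sub_right δ).const_mul _), integral_const_mul,
    integral_sub_right_eq_self (fun t => laplaceKernel s t * Φ t), sub_mul, one_mul]

/-- If `ν A(iν)` is square integrable and the density vanishes on `(-∞, ξ]` then
`A(n) = O(n^{-3/2} e^{-nξ})`. -/
theorem exists_norm_halfPlaneTransform_nat_le {Φ : ℝ → ℂ} (hΦ : MemLp Φ 2 volume) {ξ : ℝ}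
    (hξ : 0 ≤ ξ) (h0 : ∀ t ≤ ξ, Φ t = 0)
    (hB : MemLp (fun ν : ℝ => ((1 + |ν| : ℝ) : ℂ) * vertical (halfPlaneTransform Φ) 0 ν) 2 volume) :
    ∃ K : ℝ, ∀ n : ℕ, 1 ≤ n →
      ‖halfPlaneTransform Φ n‖ * Real.exp (n * ξ) ≤ K * ((n : ℝ) ^ (3 / 2 : ℝ))⁻¹ := by
  have h00 : ∀ t ≤ 0, Φ t = 0 := fun t ht => h0 t (ht.trans hξ)
  set B := ∫ ν : ℝ, ‖((1 + |ν| : ℝ) : ℂ) * vertical (halfPlaneTransform Φ) 0 ν‖ ^ 2 with hBdef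
  have hBint := (memLp_two_iff_integrable_sq_norm hB.1).1 hB
  have hB0 : 0 ≤ B := integral_nonneg fun ν => by positivity
  set c : ℝ := 1 - Real.exp (-1) with hc
  have hc0 : 0 < c := by
    have : Real.exp (-1) < 1 := Real.exp_lt_one_iff.2 (by norm_num)
    linarith
  refine ⟨c⁻¹ * √B, fun n hn => ?_⟩
  have hn0 : (0 : ℝ) < n := by exact_mod_cast hn
  -- With `δ = 1/n` the translation factor `1 - e^{-sδ}` is the constant `1 - e^{-1}` at `s = n`,
  -- while on `Re s = 0` it is at most `δ|ν|`: the weight in `hB` thus buys a factor `1/n`.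
  set δ : ℝ := (n : ℝ)⁻¹ with hδ
  have hδ0 : 0 < δ := inv_pos.2 hn0
  set Ψ : ℝ → ℂ := fun t => Φ t - Complex.exp (δ / 2) * Φ (t - δ) with hΨ
  have hΨ0 : ∀ t ≤ ξ, Ψ t = 0 := fun t ht => by
    simp only [hΨ, h0 t ht, h0 (t - δ) (by linarith), mul_zero, sub_zero]
  have hΨ00 : ∀ t ≤ 0, Ψ t = 0 := fun t ht => hΨ0 t (ht.trans hξ)
  have hΨm : MemLp Ψ 2 volume := hΦ.sub
    ((hΦ.comp_measurePreserving (measurePreserving_sub_right volume δ)).const_mul _)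
  have hpl := integral_norm_sq_vertical_halfPlaneTransform hΨm hΨ00 (σ := 0) (by norm_num)
  rw [zero_add] at hpl
  have hbd : ∀ ν : ℝ, ‖vertical (halfPlaneTransform Ψ) 0 ν‖ ^ 2 ≤
      δ ^ 2 * ‖((1 + |ν| : ℝ) : ℂ) * vertical (halfPlaneTransform Φ) 0 ν‖ ^ 2 := by
    intro ν
    have e : vertical (halfPlaneTransform Ψ) 0 ν =
        (1 - Complex.exp (-(((0 : ℝ) + (ν : ℂ) * Complex.I) * δ))) *
          vertical (halfPlaneTransform Φ) 0 ν :=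
      halfPlaneTransform_sub_translate hΦ h00 δ (by simp)
    rw [← mul_pow, e, norm_mul, norm_mul, ← mul_assoc]
    refine pow_le_pow_left₀ (by positivity) (mul_le_mul_of_nonneg_right ?_ (norm_nonneg _)) 2
    have h1 := Real.norm_exp_I_mul_ofReal_sub_one_le (x := -(ν * δ))
    rw [norm_sub_rev]
    rw [show -((((0 : ℝ) : ℂ) + (ν : ℂ) * Complex.I) * δ) =
      Complex.I * ((-(ν * δ) : ℝ) : ℂ) by push_cast; ring]
    refine h1.trans ?_
    rw [Complex.norm_real, norm_neg, norm_mul, Real.norm_eq_abs, Real.norm_of_nonneg hδ0.le,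
      Real.norm_of_nonneg (by positivity), mul_comm]
    exact mul_le_mul_of_nonneg_left (by linarith) hδ0.le
  have hle : ∫ t, ‖damp (1 / 2) Ψ t‖ ^ 2 ≤ δ ^ 2 * B := by
    have h1 : ∫ ν, ‖vertical (halfPlaneTransform Ψ) 0 ν‖ ^ 2 ≤ δ ^ 2 * B := by
      rw [hBdef, ← integral_const_mul]
      exact integral_mono_of_nonneg (Eventually.of_forall fun ν => by positivity)
        (hBint.const_mul _) (Eventually.of_forall hbd)
    rw [hpl] at h1
    have h2 : 0 ≤ ∫ t, ‖damp (1 / 2) Ψ t‖ ^ 2 := integral_nonneg fun t => by positivity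
    have h3 := Real.pi_gt_three
    nlinarith
  have hdm : MemLp (damp (1 / 2) Ψ) 2 volume := MemLp.damp hΨm hΨ00 (by norm_num)
  have hd0 : ∀ t ≤ ξ, damp (1 / 2) Ψ t = 0 := fun t ht => by rw [damp, hΨ0 t ht, mul_zero]
  -- The density is damped by `e^{-t/2}`, to use the `L²` bound from the line `Re s = 0`; evaluation
  -- at `n - 1/2` compensates. Cauchy–Schwarz then contributes `e^{-nξ}/√(2n)`, the missing
  -- `n^{-1/2}`.
  have hre : -(1 / 2 : ℝ) < ((n : ℂ) - 1 / 2).re := by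
    simp only [Complex.sub_re, Complex.natCast_re]
    norm_num
    exact hn
  have hlap := (integrable_laplace hdm hd0 hre).2
  have heq : ∫ t, laplaceKernel ((n : ℂ) - 1 / 2) t * damp (1 / 2) Ψ t =
      (c : ℂ) * halfPlaneTransform Φ n := by
    have hnre : -(1 / 2 : ℝ) < (n : ℂ).re := by simp; linarith
    have h1 := halfPlaneTransform_sub_translate hΦ h00 δ hnre
    rw [halfPlaneTransform_of_re hnre] at h1
    have h2 : (n : ℂ) * (δ : ℂ) = 1 := by
      rw [hδ]; push_cast; exact mul_inv_cancel₀ (by exact_mod_cast hn0.ne')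
    rw [h2] at h1
    rw [hc]
    push_cast
    rw [← h1]
    refine integral_congr_ae (Eventually.of_forall fun t => ?_)
    simp only [damp, laplaceKernel]
    rw [← mul_assoc, Complex.ofReal_exp, ← Complex.exp_add]
    congr 2
    push_cast
    ring
  rw [heq, norm_mul, Complex.norm_real, Real.norm_of_nonneg hc0.le] at hlap
  have hre2 : ((n : ℂ) - 1 / 2).re + 1 / 2 = n := by
    simp
  rw [hre2] at hlap
  have hsq : √(∫ t, ‖damp (1 / 2) Ψ t‖ ^ 2) ≤ δ * √B := by
    refine (Real.sqrt_le_sqrt hle).trans (le_of_eq ?_)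
    rw [Real.sqrt_mul (by positivity), Real.sqrt_sq hδ0.le]
  have hpow : (n : ℝ) ^ (3 / 2 : ℝ) = n * √n := by
    rw [Real.sqrt_eq_rpow, ← Real.rpow_one_add' hn0.le (by norm_num)]
    norm_num
  have hs2 : √(n : ℝ) ≤ √(2 * n) := Real.sqrt_le_sqrt (by linarith)
  have hsn : 0 < √(n : ℝ) := Real.sqrt_pos.2 hn0
  have hfin : c * ‖halfPlaneTransform Φ n‖ ≤ Real.exp (-(n * ξ)) / √n * (δ * √B) := by
    refine hlap.trans (mul_le_mul ?_ hsq (Real.sqrt_nonneg _) (by positivity))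
    exact div_le_div_of_nonneg_left (Real.exp_pos _).le hsn hs2
  rw [hpow, mul_inv]
  calc ‖halfPlaneTransform Φ n‖ * Real.exp (n * ξ)
      = c⁻¹ * (c * ‖halfPlaneTransform Φ n‖) * Real.exp (n * ξ) := by
        rw [inv_mul_cancel_left₀ hc0.ne']
    _ ≤ c⁻¹ * (Real.exp (-(n * ξ)) / √n * (δ * √B)) * Real.exp (n * ξ) := by gcongr
    _ = c⁻¹ * √B * (δ * (√n)⁻¹) * (Real.exp (-(n * ξ)) * Real.exp (n * ξ)) := by ring
    _ = _ := by rw [← Real.exp_add, neg_add_cancel, Real.exp_zero, mul_one]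

/-- A bound `O(e^{-nξ})` would give uniform convergence only on compact parts of the annulus; the
summable factor `n^{-3/2}` gives it on the whole. -/
theorem summable_norm_halfPlaneTransform_nat_mul_exp {Φ : ℝ → ℂ} (hΦ : MemLp Φ 2 volume) {ξ : ℝ}
    (hξ : 0 ≤ ξ) (h0 : ∀ t ≤ ξ, Φ t = 0)
    (hB : MemLp (fun ν : ℝ => ((1 + |ν| : ℝ) : ℂ) * vertical (halfPlaneTransform Φ) 0 ν) 2 volume) :
    Summable fun n : ℕ => ‖halfPlaneTransform Φ n‖ * Real.exp (n * ξ) := by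
  obtain ⟨K, hK⟩ := exists_norm_halfPlaneTransform_nat_le hΦ hξ h0 hB
  refine Summable.of_norm_bounded_eventually_nat
    ((Real.summable_nat_rpow_inv.2 (by norm_num : (1 : ℝ) < 3 / 2)).mul_left K) ?_
  filter_upwards [eventually_ge_atTop 1] with n hn
  rw [Real.norm_of_nonneg (by positivity)]
  exact hK n hn

/-! ### The jump function -/

/-- The function `x^{-1/2} Φ(log x) - x^{1/2} Φ(-log x)` of `x > 0`. -/
noncomputable def jumpFunction (Φ : ℝ → ℂ) (x : ℝ) : ℂ :=
  damp (1 / 2) Φ (Real.log x) - damp (1 / 2) Φ (-Real.log x)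

theorem jumpFunction_one_div (Φ : ℝ → ℂ) (x : ℝ) :
    jumpFunction Φ (1 / x) = -jumpFunction Φ x := by
  simp [jumpFunction]

theorem jumpFunction_exp {Φ : ℝ → ℂ} (h0 : ∀ t ≤ 0, Φ t = 0) {t : ℝ} (ht : 0 < t) :
    jumpFunction Φ (Real.exp t) = damp (1 / 2) Φ t := by
  rw [jumpFunction, Real.log_exp, damp, damp, h0 (-t) (by linarith), mul_zero, sub_zero]

theorem jumpFunction_one_div_exp_neg {Φ : ℝ → ℂ} (h0 : ∀ t ≤ 0, Φ t = 0) {t : ℝ} (ht : 0 < t) :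
    jumpFunction Φ (1 / Real.exp (-t)) = damp (1 / 2) Φ t := by
  rw [Real.exp_neg, one_div, inv_inv, jumpFunction_exp h0 ht]

/-- The symmetrized Cauchy integral. -/
noncomputable def symCauchy (Φ : ℝ → ℂ) (c z : ℂ) : ℂ :=
  (1 / (2 * (Real.pi : ℂ))) * (cauchyExp Φ z + cauchyExp Φ z⁻¹ - c)

/-- Inversion exchanges the upper and lower half-planes, so `G(1/z)` contributes the jump of `G` at
`1/x` with the opposite sign. -/
theorem hasJumpAt_symCauchy {A : ℝ → ℂ} (hA : Integrable A) (c : ℂ) {x : ℝ} (hx : 0 < x) :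
    HasJumpAt (symCauchy (invFourier A) c) x (jumpFunction (invFourier A) x) := by
  obtain ⟨gp, gm, hp, hm, hj⟩ := exists_tendsto_cauchyExp_invFourier hA hx
  obtain ⟨gp', gm', hp', hm', hj'⟩ := exists_tendsto_cauchyExp_invFourier hA (inv_pos.2 hx)
  have hxc : (x : ℂ) ≠ 0 := by exact_mod_cast hx.ne'
  have hinv : Tendsto (fun z : ℂ => z⁻¹) (𝓝 (x : ℂ)) (𝓝 ((x⁻¹ : ℝ) : ℂ)) := by
    rw [Complex.ofReal_inv]; exact tendsto_inv₀ hxc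
  have hup : Tendsto (fun ε : ℝ => (x : ℂ) + (ε : ℂ) * Complex.I) (𝓝[>] 0)
      (𝓝[{z : ℂ | 0 < z.im}] (x : ℂ)) := by
    refine tendsto_nhdsWithin_iff.2 ⟨?_, ?_⟩
    · exact ((by fun_prop : Continuous fun ε : ℝ => (x : ℂ) + (ε : ℂ) * Complex.I).tendsto' 0 x
        (by simp)).mono_left nhdsWithin_le_nhds
    · filter_upwards [self_mem_nhdsWithin] with ε hε
      simpa using hε
  have hdown : Tendsto (fun ε : ℝ => (x : ℂ) - (ε : ℂ) * Complex.I) (𝓝[>] 0)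
      (𝓝[{z : ℂ | z.im < 0}] (x : ℂ)) := by
    refine tendsto_nhdsWithin_iff.2 ⟨?_, ?_⟩
    · exact ((by fun_prop : Continuous fun ε : ℝ => (x : ℂ) - (ε : ℂ) * Complex.I).tendsto' 0 x
        (by simp)).mono_left nhdsWithin_le_nhds
    · filter_upwards [self_mem_nhdsWithin] with ε hε
      simpa using hε
  have hinvp : Tendsto (fun z : ℂ => z⁻¹) (𝓝[{z : ℂ | 0 < z.im}] (x : ℂ))
      (𝓝[{z : ℂ | z.im < 0}] ((x⁻¹ : ℝ) : ℂ)) := by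
    refine tendsto_nhdsWithin_iff.2 ⟨hinv.mono_left nhdsWithin_le_nhds, ?_⟩
    filter_upwards [self_mem_nhdsWithin] with z hz
    have hz : 0 < z.im := hz
    have hz0 : z ≠ 0 := by rintro rfl; simp at hz
    rw [Complex.inv_im]
    exact div_neg_of_neg_of_pos (by linarith) (Complex.normSq_pos.2 hz0)
  have hinvm : Tendsto (fun z : ℂ => z⁻¹) (𝓝[{z : ℂ | z.im < 0}] (x : ℂ))
      (𝓝[{z : ℂ | 0 < z.im}] ((x⁻¹ : ℝ) : ℂ)) := by
    refine tendsto_nhdsWithin_iff.2 ⟨hinv.mono_left nhdsWithin_le_nhds, ?_⟩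
    filter_upwards [self_mem_nhdsWithin] with z hz
    have hz : z.im < 0 := hz
    have hz0 : z ≠ 0 := by rintro rfl; simp at hz
    rw [Complex.inv_im]
    exact div_pos (by linarith) (Complex.normSq_pos.2 hz0)
  refine ⟨_, _, ((((hp.comp hup).add (hm'.comp (hinvp.comp hup))).sub_const c).const_mul _),
    ((((hm.comp hdown).add (hp'.comp (hinvm.comp hdown))).sub_const c).const_mul _), ?_⟩
  rw [Real.log_inv] at hj'
  have hdiff : (1 / (2 * (Real.pi : ℂ))) * (gp + gm' - c) - (1 / (2 * (Real.pi : ℂ))) *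
      (gm + gp' - c) = (1 / (2 * (Real.pi : ℂ))) * ((gp - gm) - (gp' - gm')) := by ring
  have hpi : (Real.pi : ℂ) ≠ 0 := by exact_mod_cast Real.pi_ne_zero
  have hd : ∀ t : ℝ, invFourier A t * ((Real.exp (-(t / 2)) : ℝ) : ℂ) =
      damp (1 / 2) (invFourier A) t := fun t => by
    rw [damp, mul_comm, show 1 / 2 * t = t / 2 by ring]
  rw [hdiff, hj, hj', hd, hd, jumpFunction, ← mul_sub]
  field_simp
  rw [Complex.I_sq]
  ring

/-! ### The two Mellin transforms -/

section Mellin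

variable {Φ : ℝ → ℂ}

theorem cpow_exp (t : ℝ) (w : ℂ) : ((Real.exp t : ℝ) : ℂ) ^ w = Complex.exp (t * w) := by
  rw [Complex.cpow_def_of_ne_zero (by exact_mod_cast (Real.exp_pos t).ne'),
    ← Complex.ofReal_log (Real.exp_pos t).le, Real.log_exp]

/-- Under `x = e^t`, `t > 0`, only the first term of the jump function survives, and the Mellin
integrand becomes the Laplace integrand. -/
theorem mellin_Ioi_one (hΦ : MemLp Φ 2 volume) (h0 : ∀ t ≤ 0, Φ t = 0) {s : ℂ}
    (hs : -(1 / 2 : ℝ) < s.re) :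
    IntegrableOn (fun x : ℝ => jumpFunction Φ x * (x : ℂ) ^ (-s - 1)) (Ioi 1) ∧
      halfPlaneTransform Φ s = ∫ x in Ioi (1 : ℝ), jumpFunction Φ x * (x : ℂ) ^ (-s - 1) := by
  have hi := (integrable_laplace hΦ h0 hs).1
  have e : EqOn (fun t : ℝ => Real.exp t • (jumpFunction Φ (Real.exp t) *
      ((Real.exp t : ℝ) : ℂ) ^ (-s - 1))) (fun t => laplaceKernel s t * Φ t) (Ioi 0) := by
    intro t ht
    simp only [jumpFunction_exp h0 ht, cpow_exp, damp, laplaceKernel, Complex.real_smul]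
    simp only [Complex.ofReal_exp]
    rw [mul_right_comm, ← mul_assoc, ← mul_assoc, ← Complex.exp_add, ← Complex.exp_add]
    congr 2
    push_cast
    ring
  refine ⟨(integrableOn_Ioi_one_iff_exp _).2
    ((integrableOn_congr_fun e measurableSet_Ioi).2 hi.integrableOn), ?_⟩
  rw [integral_Ioi_one_eq_exp, setIntegral_congr_fun measurableSet_Ioi e,
    setIntegral_eq_integral_of_forall_compl_eq_zero, halfPlaneTransform_of_re hs]
  intro t ht
  rw [h0 t (by simpa using ht), mul_zero]

theorem mellin_Ioo_zero_one (hΦ : MemLp Φ 2 volume) (h0 : ∀ t ≤ 0, Φ t = 0) {s : ℂ}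
    (hs : -(1 / 2 : ℝ) < s.re) :
    IntegrableOn (fun x : ℝ => jumpFunction Φ (1 / x) * (x : ℂ) ^ (s - 1)) (Ioo 0 1) ∧
      halfPlaneTransform Φ s =
        ∫ x in Ioo (0 : ℝ) 1, jumpFunction Φ (1 / x) * (x : ℂ) ^ (s - 1) := by
  have hi := (integrable_laplace hΦ h0 hs).1
  have e : EqOn (fun t : ℝ => Real.exp (-t) • (jumpFunction Φ (1 / Real.exp (-t)) *
      ((Real.exp (-t) : ℝ) : ℂ) ^ (s - 1))) (fun t => laplaceKernel s t * Φ t) (Ioi 0) := by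
    intro t ht
    simp only [jumpFunction_one_div_exp_neg h0 ht, cpow_exp, damp, laplaceKernel,
      Complex.real_smul]
    simp only [Complex.ofReal_exp]
    rw [mul_right_comm, ← mul_assoc, ← mul_assoc, ← Complex.exp_add, ← Complex.exp_add]
    congr 2
    push_cast
    ring
  refine ⟨(integrableOn_Ioo_zero_one_iff_exp_neg _).2
    ((integrableOn_congr_fun e measurableSet_Ioi).2 hi.integrableOn), ?_⟩
  rw [integral_Ioo_zero_one_eq_exp_neg, setIntegral_congr_fun measurableSet_Ioi e,
    setIntegral_eq_integral_of_forall_compl_eq_zero, halfPlaneTransform_of_re hs]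
  intro t ht
  rw [h0 t (by simpa using ht), mul_zero]

theorem mellin_plancherel_Ioi_one (hΦ : MemLp Φ 2 volume) (h0 : ∀ t ≤ 0, Φ t = 0) {σ : ℝ}
    (hσ : -(1 / 2 : ℝ) ≤ σ) :
    IntegrableOn (fun x : ℝ => ‖jumpFunction Φ x‖ ^ 2 * x ^ (-2 * σ - 1)) (Ioi 1) ∧
      ∫ ν : ℝ, ‖vertical (halfPlaneTransform Φ) σ ν‖ ^ 2 =
        2 * Real.pi * ∫ x in Ioi (1 : ℝ), ‖jumpFunction Φ x‖ ^ 2 * x ^ (-2 * σ - 1) := by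
  have hd := MemLp.damp hΦ h0 (c := σ + 1 / 2) (by linarith)
  have hi := (memLp_two_iff_integrable_sq_norm hd.1).1 hd
  have e : EqOn (fun t : ℝ => Real.exp t • (‖jumpFunction Φ (Real.exp t)‖ ^ 2 *
      Real.exp t ^ (-2 * σ - 1))) (fun t => ‖damp (σ + 1 / 2) Φ t‖ ^ 2) (Ioi 0) := by
    intro t ht
    simp only [jumpFunction_exp h0 ht, norm_damp, smul_eq_mul, mul_pow, ← Real.exp_nat_mul,
      ← Real.exp_mul]
    rw [mul_right_comm, ← mul_assoc, ← mul_assoc, ← Real.exp_add, ← Real.exp_add]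
    congr 2
    push_cast
    ring
  refine ⟨(integrableOn_Ioi_one_iff_exp _).2
    ((integrableOn_congr_fun e measurableSet_Ioi).2 hi.integrableOn), ?_⟩
  rw [integral_Ioi_one_eq_exp, setIntegral_congr_fun measurableSet_Ioi e,
    setIntegral_eq_integral_of_forall_compl_eq_zero,
    integral_norm_sq_vertical_halfPlaneTransform hΦ h0 hσ]
  intro t ht
  rw [norm_damp, h0 t (by simpa using ht), norm_zero, mul_zero, sq, mul_zero]

theorem mellin_plancherel_Ioo_zero_one (hΦ : MemLp Φ 2 volume) (h0 : ∀ t ≤ 0, Φ t = 0) {σ : ℝ}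
    (hσ : -(1 / 2 : ℝ) ≤ σ) :
    IntegrableOn (fun x : ℝ => ‖jumpFunction Φ (1 / x)‖ ^ 2 * x ^ (2 * σ - 1)) (Ioo 0 1) ∧
      ∫ ν : ℝ, ‖vertical (halfPlaneTransform Φ) σ ν‖ ^ 2 =
        2 * Real.pi * ∫ x in Ioo (0 : ℝ) 1, ‖jumpFunction Φ (1 / x)‖ ^ 2 * x ^ (2 * σ - 1) := by
  have hd := MemLp.damp hΦ h0 (c := σ + 1 / 2) (by linarith)
  have hi := (memLp_two_iff_integrable_sq_norm hd.1).1 hd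
  have e : EqOn (fun t : ℝ => Real.exp (-t) • (‖jumpFunction Φ (1 / Real.exp (-t))‖ ^ 2 *
      Real.exp (-t) ^ (2 * σ - 1))) (fun t => ‖damp (σ + 1 / 2) Φ t‖ ^ 2) (Ioi 0) := by
    intro t ht
    simp only [jumpFunction_one_div_exp_neg h0 ht, norm_damp, smul_eq_mul, mul_pow,
      ← Real.exp_nat_mul, ← Real.exp_mul]
    rw [mul_right_comm, ← mul_assoc, ← mul_assoc, ← Real.exp_add, ← Real.exp_add]
    congr 2
    push_cast
    ring
  refine ⟨(integrableOn_Ioo_zero_one_iff_exp_neg _).2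
    ((integrableOn_congr_fun e measurableSet_Ioi).2 hi.integrableOn), ?_⟩
  rw [integral_Ioo_zero_one_eq_exp_neg, setIntegral_congr_fun measurableSet_Ioi e,
    setIntegral_eq_integral_of_forall_compl_eq_zero,
    integral_norm_sq_vertical_halfPlaneTransform hΦ h0 hσ]
  intro t ht
  rw [norm_damp, h0 t (by simpa using ht), norm_zero, mul_zero, sq, mul_zero]

/-- The density damped by `e^{-(σ+1/2)t}` is an inverse Fourier integral, hence bounded by the `L¹`
norm on the line; undoing the surplus damping at `t = log x` costs `x^σ`. -/
theorem norm_jumpFunction_le (h0 : ∀ t ≤ 0, Φ t = 0) {σ : ℝ} {A : ℂ → ℂ}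
    (h : damp (σ + 1 / 2) Φ = invFourier (vertical A σ)) {x : ℝ} (hx : 1 < x) :
    ‖jumpFunction Φ x‖ ≤ lineNormOne A σ * x ^ σ := by
  have hx0 : 0 < x := by linarith
  have h1 := norm_invFourier_le (vertical A σ) (Real.log x)
  rw [← h, norm_damp] at h1
  have h2 : jumpFunction Φ x = damp (1 / 2) Φ (Real.log x) := by
    conv_lhs => rw [← Real.exp_log hx0]
    exact jumpFunction_exp h0 (Real.log_pos hx)
  rw [h2, norm_damp, Real.rpow_def_of_pos hx0]
  calc Real.exp (-(1 / 2 * Real.log x)) * ‖Φ (Real.log x)‖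
      = Real.exp (-((σ + 1 / 2) * Real.log x)) * ‖Φ (Real.log x)‖ * Real.exp (Real.log x * σ) := by
        rw [mul_right_comm, ← Real.exp_add]
        congr 2; ring
    _ ≤ _ := mul_le_mul_of_nonneg_right h1 (Real.exp_pos _).le

end Mellin

/-! ### The Laurent series -/

theorem norm_zpow_le_of_mem_annulus {ξ : ℝ} {z : ℂ} (hz : z ∈ annulus ξ) (n : ℤ) :
    ‖z ^ n‖ ≤ Real.exp (n.natAbs * ξ) := by
  have hz0 : 0 < ‖z‖ := (Real.exp_pos _).trans hz.1
  obtain ⟨k, rfl | rfl⟩ := n.eq_nat_or_neg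
  · rw [zpow_natCast, norm_pow, Int.natAbs_natCast, Real.exp_nat_mul]
    exact pow_le_pow_left₀ (norm_nonneg _) hz.2.le k
  · rw [zpow_neg, zpow_natCast, ← inv_pow, norm_pow, norm_inv, Int.natAbs_neg, Int.natAbs_natCast,
      Real.exp_nat_mul]
    refine pow_le_pow_left₀ (by positivity) ?_ k
    rw [inv_le_comm₀ hz0 (Real.exp_pos _), ← Real.exp_neg]
    exact hz.1.le

theorem isOpen_annulus (ξ : ℝ) : IsOpen (annulus ξ) :=
  (isOpen_lt continuous_const continuous_norm).inter (isOpen_lt continuous_norm continuous_const)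

theorem annulus_subset_cutPlane (ξ : ℝ) : annulus ξ ⊆ cutPlane ξ := by
  rintro _ ⟨h1, h2⟩ ⟨x, hx | hx, rfl⟩
  · simp only [Complex.norm_real, Real.norm_of_nonneg hx.1] at h1
    linarith [hx.2]
  · have hx' : Real.exp ξ ≤ x := hx
    simp only [Complex.norm_real, Real.norm_of_nonneg ((Real.exp_pos ξ).le.trans hx')] at h2
    linarith

/-- Inversion carries `[e^ξ, ∞)` onto `(0, e^{-ξ}]`, and `0` is removed as well, so both Cauchy
integrals are holomorphic on the cut plane. -/
theorem differentiableOn_symCauchy {Φ : ℝ → ℂ} (hΦ : MemLp Φ 2 volume) {ξ : ℝ}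
    (h0 : ∀ t ≤ ξ, Φ t = 0) (c : ℂ) : DifferentiableOn ℂ (symCauchy Φ c) (cutPlane ξ) := by
  intro z hz
  have hz0 : z ≠ 0 := by
    rintro rfl
    exact hz ⟨0, Or.inl ⟨le_rfl, (Real.exp_pos _).le⟩, Complex.ofReal_zero⟩
  have h1 : z ∉ (fun x : ℝ => (x : ℂ)) '' Ici (Real.exp ξ) :=
    fun ⟨x, hx, e⟩ => hz ⟨x, Or.inr hx, e⟩
  have h2 : z⁻¹ ∉ (fun x : ℝ => (x : ℂ)) '' Ici (Real.exp ξ) := by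
    rintro ⟨x, hx, e⟩
    have hx' : Real.exp ξ ≤ x := hx
    have hx0 : 0 < x := (Real.exp_pos ξ).trans_le hx'
    refine hz ⟨x⁻¹, Or.inl ⟨(inv_pos.2 hx0).le, ?_⟩, ?_⟩
    · rw [Real.exp_neg]
      exact inv_anti₀ (Real.exp_pos _) hx'
    · simp only at e ⊢
      rw [Complex.ofReal_inv, e, inv_inv]
  exact ((((differentiableAt_cauchyExp hΦ h0 h1).add
    ((differentiableAt_cauchyExp hΦ h0 h2).comp z (differentiableAt_inv hz0))).sub_const
      c).const_mul _).differentiableWithinAt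

/-- The Weierstrass test with `‖z^n‖ ≤ e^{|n|ξ}`. Evenness of `a` makes the negative powers a series
in `1/z`; the index `0` is counted in both halves, whence the subtraction of `a 0`. -/
theorem hasSumUniformlyOn_symCauchy {Φ : ℝ → ℂ} (hΦ : MemLp Φ 2 volume) {ξ : ℝ}
    (h0 : ∀ t ≤ ξ, Φ t = 0) {a : ℤ → ℂ} (hsym : ∀ n : ℤ, a n = a (-n))
    (ha : ∀ n : ℕ, halfPlaneTransform Φ n = a n)
    (hsum : Summable fun n : ℕ => ‖halfPlaneTransform Φ n‖ * Real.exp (n * ξ)) :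
    HasSumUniformlyOn (fun (n : ℤ) (z : ℂ) => (1 / (2 * (Real.pi : ℂ))) * (a n * z ^ n))
      (symCauchy Φ (a 0)) (annulus ξ) := by
  set u : ℤ → ℝ := fun n => ‖(1 / (2 * (Real.pi : ℂ)))‖ * (‖a n‖ * Real.exp (n.natAbs * ξ)) with hu
  have hus : Summable u := by
    refine Summable.mul_left _ (Summable.of_nat_of_neg ?_ ?_)
    · refine hsum.congr fun n => ?_
      rw [ha, Int.natAbs_natCast]
    · refine hsum.congr fun n => ?_
      rw [ha, Int.natAbs_neg, Int.natAbs_natCast, ← hsym]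
  have hle : ∀ (n : ℤ) (z : ℂ), z ∈ annulus ξ →
      ‖(1 / (2 * (Real.pi : ℂ))) * (a n * z ^ n)‖ ≤ u n := by
    intro n z hz
    rw [norm_mul, norm_mul (a n)]
    exact mul_le_mul_of_nonneg_left (mul_le_mul_of_nonneg_left
      (norm_zpow_le_of_mem_annulus hz n) (norm_nonneg _)) (norm_nonneg _)
  refine (HasSumUniformlyOn.of_norm_le_summable hus hle).congr_right fun z hz => ?_
  have hz0 : 0 < ‖z‖ := (Real.exp_pos _).trans hz.1
  have hp := hasSum_cauchyExp hΦ h0 hz.2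
  have hm := hasSum_cauchyExp hΦ h0 (z := z⁻¹) (by
    rw [norm_inv, inv_lt_comm₀ hz0 (Real.exp_pos _), ← Real.exp_neg]
    exact hz.1)
  simp only [ha] at hp hm
  have hall : HasSum (fun n : ℤ => a n * z ^ n)
      (cauchyExp Φ z + cauchyExp Φ z⁻¹ - a 0 * z ^ (0 : ℤ)) := by
    refine HasSum.of_nat_of_neg (f := fun n : ℤ => a n * z ^ n) ?_ ?_
    · simpa only [zpow_natCast] using hp
    · simpa only [zpow_neg, zpow_natCast, ← hsym, inv_pow] using hm
  rw [zpow_zero, mul_one] at hall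
  exact (hall.mul_left _).tsum_eq

/-! ### The theorem -/

theorem proposition6
    (a : ℤ → ℂ) (hsym : ∀ n : ℤ, a n = a (-n))
    (p : ℕ) (hp : 1 ≤ p)
    (hHausdorff : HausdorffCondition (fun n : ℕ => (n : ℂ) ^ p * a n))
    (hHausdorff₀ : HausdorffCondition (fun n : ℕ => a n))
    (ξ₀ : ℝ) (hξ₀ : 0 < ξ₀) (C m : ℝ) (hm : 0 < m)
    (hdecay : ∀ n : ℕ, m < n → ‖a n‖ ≤ C * Real.exp (-((n : ℝ) - m) * ξ₀)) :
    ∃ (A : ℂ → ℂ) (f : ℂ → ℂ) (F : ℝ → ℂ),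
      -- `A` is the unique Carlsonian interpolation of the coefficients
      (IsCarlsonianInterpolation (fun n : ℕ => a n) A ∧
        ∀ B : ℂ → ℂ, IsCarlsonianInterpolation (fun n : ℕ => a n) B →
          EqOn B A {s : ℂ | -(1 / 2 : ℝ) < s.re} ∧
          vertical B (-(1 / 2 : ℝ)) =ᵐ[volume] vertical A (-(1 / 2 : ℝ))) ∧
      -- (1) uniform convergence in the annulus
      (HasSumUniformlyOn (fun (n : ℤ) (z : ℂ) => (1 / (2 * (Real.pi : ℂ))) * (a n * z ^ n)) f
          (annulus ξ₀) ∧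
        AnalyticOnNhd ℂ f (annulus ξ₀)) ∧
      -- (2) holomorphic extension to the cut plane
      DifferentiableOn ℂ f (cutPlane ξ₀) ∧
      -- (3) the jump function and its bounds on the two cuts
      (IsJumpFunction ξ₀ f F ∧
        (∀ x ∈ Ioo (0 : ℝ) (Real.exp (-ξ₀)), F x = -F (1 / x)) ∧
        ∀ σ : ℝ, -(1 / 2 : ℝ) ≤ σ →
          Integrable (vertical A σ) volume ∧
          (∀ x ∈ Ioi (Real.exp ξ₀), ‖F x‖ ≤ lineNormOne A σ * x ^ σ) ∧
          (∀ x ∈ Ioo (0 : ℝ) (Real.exp (-ξ₀)), ‖F (1 / x)‖ ≤ lineNormOne A σ * x ^ (-σ))) ∧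
      -- (4) the two forms of the Mellin transform
      (∀ σ ν : ℝ, -(1 / 2 : ℝ) < σ →
        (IntegrableOn
            (fun x : ℝ => F x * (x : ℂ) ^ (-((σ : ℂ) + (ν : ℂ) * Complex.I) - 1)) (Ioi 1) volume ∧
          A ((σ : ℂ) + (ν : ℂ) * Complex.I) =
            ∫ x in Ioi (1 : ℝ), F x * (x : ℂ) ^ (-((σ : ℂ) + (ν : ℂ) * Complex.I) - 1)) ∧
        (IntegrableOn
            (fun x : ℝ => F (1 / x) * (x : ℂ) ^ (((σ : ℂ) + (ν : ℂ) * Complex.I) - 1))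
            (Ioo 0 1) volume ∧
          A ((σ : ℂ) + (ν : ℂ) * Complex.I) =
            ∫ x in Ioo (0 : ℝ) 1,
              F (1 / x) * (x : ℂ) ^ (((σ : ℂ) + (ν : ℂ) * Complex.I) - 1))) ∧
      -- (5) the two Mellin-Plancherel identities
      (∀ σ : ℝ, -(1 / 2 : ℝ) ≤ σ →
        Integrable (fun ν : ℝ => ‖vertical A σ ν‖ ^ 2) volume ∧
        (IntegrableOn (fun x : ℝ => ‖F x‖ ^ 2 * x ^ (-2 * σ - 1)) (Ioi 1) volume ∧
          ∫ ν : ℝ, ‖vertical A σ ν‖ ^ 2 =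
            2 * Real.pi * ∫ x in Ioi (1 : ℝ), ‖F x‖ ^ 2 * x ^ (-2 * σ - 1)) ∧
        (IntegrableOn (fun x : ℝ => ‖F (1 / x)‖ ^ 2 * x ^ (2 * σ - 1)) (Ioo 0 1) volume ∧
          ∫ ν : ℝ, ‖vertical A σ ν‖ ^ 2 =
            2 * Real.pi * ∫ x in Ioo (0 : ℝ) 1, ‖F (1 / x)‖ ^ 2 * x ^ (2 * σ - 1))) := by
  obtain ⟨Φ, hcont, hΦ, h0, hn, hreg⟩ := hHausdorff₀.exists_continuous_halfPlaneTransform hp hHausdorff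
  have hboundary := (hreg (-(1 / 2)) le_rfl).2
  have hΦA : Φ = invFourier (vertical (halfPlaneTransform Φ) (-(1 / 2))) := by
    rw [← hboundary.2, neg_add_cancel, damp_zero]
  have hvanish : ∀ t ≤ ξ₀, Φ t = 0 := by
    -- The factor `e^{mξ₀}` absorbs the shift `n - m` in the assumed decay.
    refine eq_zero_of_norm_halfPlaneTransform_nat_le (K := C * Real.exp (m * ξ₀)) hboundary.1 hΦA
      hΦ h0 ?_
    filter_upwards [tendsto_natCast_atTop_atTop.eventually_gt_atTop m] with n hmn
    rw [hn, mul_assoc, ← Real.exp_add]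
    refine (hdecay n hmn).trans (le_of_eq ?_)
    congr 2
    ring
  have hsum := summable_norm_halfPlaneTransform_nat_mul_exp hΦ hξ₀.le hvanish
    (hreg 0 (by norm_num)).1
  have hA := isHardyTwo_halfPlaneTransform hΦ h0
  have hdiff := differentiableOn_symCauchy hΦ hvanish (a 0)
  have h1 : 1 < Real.exp ξ₀ := Real.one_lt_exp_iff.2 hξ₀
  refine ⟨halfPlaneTransform Φ, symCauchy Φ (a 0), jumpFunction Φ, ⟨⟨hA, hn⟩, fun B hB => ?_⟩,
    ⟨hasSumUniformlyOn_symCauchy hΦ hvanish hsym hn hsum,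
      (hdiff.mono (annulus_subset_cutPlane ξ₀)).analyticOnNhd (isOpen_annulus ξ₀)⟩, hdiff,
    ⟨fun x hx _ _ => ?_, fun x _ => ?_, fun σ hσ => ⟨(hreg σ hσ).2.1, fun x hx => ?_,
      fun x hx => ?_⟩⟩, fun σ ν hσ => ?_, fun σ hσ => ⟨?_, mellin_plancherel_Ioi_one hΦ h0 hσ,
      mellin_plancherel_Ioo_zero_one hΦ h0 hσ⟩⟩
  · have hEq := hA.eqOn_of_nat hB.hardy fun n => (hB.interpolates n).trans (hn n).symm
    exact ⟨hEq, hA.boundary_ae_eq hB.hardy hEq⟩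
  · have := hasJumpAt_symCauchy hboundary.1 (a 0) hx
    rwa [← hΦA] at this
  · rw [jumpFunction_one_div, neg_neg]
  · exact norm_jumpFunction_le h0 (hreg σ hσ).2.2 (h1.trans hx)
  · have hx1 : 1 < 1 / x := by
      rw [lt_div_iff₀ hx.1, one_mul]
      exact hx.2.trans (Real.exp_lt_one_iff.2 (by linarith))
    have := norm_jumpFunction_le h0 (hreg σ hσ).2.2 hx1
    rwa [one_div, Real.inv_rpow hx.1.le, ← Real.rpow_neg hx.1.le, ← one_div] at this
  · have hs : -(1 / 2 : ℝ) < ((σ : ℂ) + (ν : ℂ) * Complex.I).re := by simpa using hσ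
    exact ⟨mellin_Ioi_one hΦ h0 hs, mellin_Ioo_zero_one hΦ h0 hs⟩
  · have h2 := memLp_vertical_halfPlaneTransform hΦ h0 hσ
    exact (memLp_two_iff_integrable_sq_norm h2.1).1 h2
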